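/- **Language.** Types are built from sorts (among them $\mathsf{bool}$ and $\mathsf{list}$) by $\sigma\times\tau$ and $\sigma\Rightarrow\tau$; the order of a sort is $0$, that of $\sigma\times\tau$ is the maximum of the orders of $\sigma$ and $\tau$, and $\mathrm{ord}(\sigma\Rightarrow\tau)=\max(\mathrm{ord}(\sigma)+1,\mathrm{ord}(\tau))$. Expressions are $s ::= x \mid \mathsf c \mid \mathsf f \mid \mathtt{if}\ s_1\ \mathtt{then}\ s_2\ \mathtt{else}\ s_3 \mid \mathtt{choose}\ s_1\cdots s_n\ (n\ge 1) \mid (s,t) \mid s\,t$, with variables $x$, data constructors $\mathsf c$ (among them $\mathsf{true},\mathsf{false}:\mathsf{bool}$, $[\,]:\mathsf{list}$ and ${::}:\mathsf{bool}\Rightarrow\mathsf{list}\Rightarrow\mathsf{list}$) and defined symbols $\mathsf f$. In $s\,t$ the head $s$ is not counted as a sub-expression. Patterns are built from variables, data constructors applied to patterns, and pairs; data are variable-free patterns. A program is a finite list of clauses $\mathsf f\ \ell_1\cdots\ell_k = s$ with patterns $\ell_i$; its main function is the root of the first clause. Programs are evaluated call-by-value: a call uses the first matching clause, $\mathtt{choose}\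 s_1\cdots s_n$ may evaluate to any value of any $s_i$, and a defined symbol applied to fewer values than its clauses have patterns is a value. A list of clauses is *well-formed* if it can be simply typed by a single assignment of types to constructors and defined symbols (with a type environment for each clause; constructors have types $\kappa_1\Rightarrow\dots\Rightarrow\kappa_m\Rightarrow\iota$ with all $\kappa_i$ of order $0$ and $\iota$ a sort), left-hand sides are linear and contain all variables of the right-hand side, constructors only occur fully applied, and all clauses for the same symbol have the same number of patterns. It has *data order* $K$ if moreover all variables are typed with types of order at most $K$. It is *cons-free* if in each clause $\mathsf f\ \ell_1\cdots\ell_k=s$ every sub-expression of $s$ of the form $\mathsf c\,s_1\cdots s_m$ with $\mathsf c$ a data constructor is a data expression or a sub-expression of some $\ell_i$. "Non-deterministic" means that $\mathtt{choose}$ is allowed, not that it has to occur. **Complexity.** A decision problem is a set $X\subseteq\{0,1\}^+$. A program with main function of type $\mathsf{list}\Rightarrow\mathsf{bool}$ accepts $X$ if $X$ is exactly the set of words in $\{0,1\}^*$ on whose encoding as a boolean list the program can evaluate to $\mathsf{true}$. Let $\exp_2^0(n)=n$ and $\exp_2^{K+1}(n)=2^{\exp_2^K(n)}$; $\mathsf{ELEMENTARY}$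 is the class of all $X$ that, for some $K,a,b,c\in\mathbb N$, are decided by a deterministic Turing machine with a single right-infinite tape that halts on every input of length $n\ge1$ within $c\cdot\exp_2^K(a\,n^b)$ steps. **Counting modules.** Let $P:\mathbb N\to\mathbb N\setminus\{0\}$. A *$P$-counting module of data order $K$* consists of a type $\alpha$; a well-formed cons-free list $\mathsf p$ of clauses of data order $K$ over a finite set $\mathcal D$ of defined symbols that contains $\mathsf{seed}:\mathsf{list}\Rightarrow\alpha$, $\mathsf{pred}:\mathsf{list}\Rightarrow\alpha\Rightarrow\alpha$ and $\mathsf{zero}:\mathsf{list}\Rightarrow\alpha\Rightarrow\mathsf{bool}$; and, for each $n$, a set $\mathcal A^n$ of values of type $\alpha$ over the constructors and $\mathcal D$, with a function $\langle\cdot\rangle^n:\mathcal A^n\to\mathbb N$; such that for every boolean list $cs$ of length $n$: * the call $\mathsf{seed}\ cs$ has exactly one value $v$, and $v\in\mathcal A^n$, $\langle v\rangle^n=P(n)-1$; * if $v\in\mathcal A^n$ and $\langle v\rangle^n=i>0$, then the call $\mathsf{pred}\ cs\ v$ has exactly one value $w$, and $w\in\mathcal A^n$, $\langle w\rangle^n=i-1$;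 * if $v\in\mathcal A^n$, then the call $\mathsf{zero}\ cs\ v$ can evaluate to $\mathsf{true}$ if and only if $\langle v\rangle^n=0$, and to $\mathsf{false}$ if and only if $\langle v\rangle^n>0$. **Lemma.** 1. Every decision problem in $\mathsf{ELEMENTARY}$ is accepted by a non-deterministic well-formed cons-free program of data order $1$. 2. For every $P:\mathbb N\to\mathbb N\setminus\{0\}$ and every $K\le1$: if there is a $P$-counting module of data order $K$, then there is a (non-deterministic) $(\lambda n.\,2^{P(n)-1})$-counting module of data order $1$. -/

import Mathlib

namespace CFProg

/-! ### Types -/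

/-- Sort identifiers: `bool`, `list`, and an unlimited supply of further sorts. -/
inductive Srt where
  | bool
  | list
  | other (n : ℕ)

/-- Simple types. -/
inductive Ty where
  | sort (ι : Srt)
  | prod (σ τ : Ty)
  | arrow (σ τ : Ty)

namespace Ty

abbrev bool : Ty := .sort .bool
abbrev list : Ty := .sort .list

/-- The order of a type. -/
def order : Ty → ℕ
  | .sort _ => 0
  | .prod σ τ => max σ.order τ.order
  | .arrow σ τ => max (σ.order + 1) τ.order

/-- The number `m` of arguments in `σ₁ ⇒ ⋯ ⇒ σₘ ⇒ κ` with `κ` a sort or a pair type. -/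
def arity : Ty → ℕ
  | .sort _ => 0
  | .prod _ _ => 0
  | .arrow _ τ => τ.arity + 1

/-- `κ₁ ⇒ ⋯ ⇒ κₘ ⇒ ι` with `ι` a sort and all `κᵢ` of order `0`. -/
def IsConstructorType : Ty → Prop
  | .sort _ => True
  | .prod _ _ => False
  | .arrow σ τ => σ.order = 0 ∧ τ.IsConstructorType

end Ty

/-! ### Expressions -/

/-- Data constructors: `true`, `false`, `[]`, `::`, and an unlimited supply of further ones. -/
inductive Con where
  | tt
  | ff
  | nil
  | cons
  | other (n : ℕ)

/-- Expressions.  Variables and defined symbols are named by natural numbers (in two separate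
name spaces); `choose` takes one or more arguments. -/
inductive Expr where
  | var (x : ℕ)
  | con (c : Con)
  | fn (f : ℕ)
  | ite (s₁ s₂ s₃ : Expr)
  | choose (n : ℕ) (s : Fin (n + 1) → Expr)
  | pair (s t : Expr)
  | app (s t : Expr)

namespace Expr

/-- The iterated application `s t₁ ⋯ tₙ`. -/
def apps (s : Expr) (ts : List Expr) : Expr := ts.foldl .app s

/-- The occurrences of variables in an expression, from left to right. -/
def varList : Expr → List ℕ
  | .var x => [x]
  | .con _ => []
  | .fn _ => []
  | .ite s₁ s₂ s₃ => s₁.varList ++ s₂.varList ++ s₃.varList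
  | .choose _ s => (List.ofFn fun i => (s i).varList).flatten
  | .pair s t => s.varList ++ t.varList
  | .app s t => s.varList ++ t.varList

/-- The set of defined symbols that occur in an expression. -/
def fns : Expr → Set ℕ
  | .var _ => ∅
  | .con _ => ∅
  | .fn f => {f}
  | .ite s₁ s₂ s₃ => s₁.fns ∪ s₂.fns ∪ s₃.fns
  | .choose _ s => ⋃ i, (s i).fns
  | .pair s t => s.fns ∪ t.fns
  | .app s t => s.fns ∪ t.fns

/-- `s ▷ u`: the expression `u` is a strict sub-expression of `s`.  The head `s` of an
application `s t` does not count as a sub-expression of `s t`. -/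
def StrictSub : Expr → Expr → Prop
  | .var _, _ => False
  | .con _, _ => False
  | .fn _, _ => False
  | .ite s₁ s₂ s₃, u =>
      (s₁ = u ∨ s₁.StrictSub u) ∨ (s₂ = u ∨ s₂.StrictSub u) ∨ (s₃ = u ∨ s₃.StrictSub u)
  | .choose _ s, u => ∃ i, s i = u ∨ (s i).StrictSub u
  | .pair s t, u => (s = u ∨ s.StrictSub u) ∨ (t = u ∨ t.StrictSub u)
  | .app s t, u => s.StrictSub u ∨ (t = u ∨ t.StrictSub u)

/-- `s ⊵ u`: the expression `u` is a sub-expression of `s`. -/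
def Sub (s u : Expr) : Prop := s = u ∨ s.StrictSub u

/-- Patterns: variables, data constructors applied to patterns, and pairs of patterns. -/
inductive IsPattern : Expr → Prop
  | var (x : ℕ) : IsPattern (.var x)
  | con (c : Con) (ls : List Expr) : (∀ l ∈ ls, IsPattern l) → IsPattern (apps (.con c) ls)
  | pair (l l' : Expr) : IsPattern l → IsPattern l' → IsPattern (.pair l l')

/-- Data expressions: data constructors applied to data, and pairs of data. -/
inductive IsData : Expr → Prop
  | con (c : Con) (ds : List Expr) : (∀ d ∈ ds, IsData d) → IsData (apps (.con c) ds)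
  | pair (d b : Expr) : IsData d → IsData b → IsData (.pair d b)

end Expr

/-- Environments: partial functions from variables to expressions (in evaluation: values). -/
abbrev Env := ℕ → Option Expr

/-- Instantiation of the variables in the domain of `γ`; it is only used on patterns. -/
def Expr.inst (γ : Env) : Expr → Expr
  | .var x => (γ x).getD (.var x)
  | .con c => .con c
  | .fn f => .fn f
  | .ite s₁ s₂ s₃ => .ite (s₁.inst γ) (s₂.inst γ) (s₃.inst γ)
  | .choose n s => .choose n fun i => (s i).inst γ
  | .pair s t => .pair (s.inst γ) (t.inst γ)
  | .app s t => .app (s.inst γ) (t.inst γ)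

/-! ### Programs -/

/-- A clause `f ℓ₁ ⋯ ℓₖ = s`. -/
structure Clause where
  root : ℕ
  pats : List Expr
  rhs : Expr

/-- The left-hand side `f ℓ₁ ⋯ ℓₖ` of a clause. -/
def Clause.lhs (c : Clause) : Expr := (Expr.fn c.root).apps c.pats

/-- Programs are finite lists of clauses. -/
abbrev Program := List Clause

/-- The number of arguments of the clauses for `f` (`0` if there are none). -/
def Program.arity (p : Program) (f : ℕ) : ℕ :=
  ((List.find? (fun c : Clause => c.root == f) p).map fun c => c.pats.length).getD 0

/-- The values of a program: data, pairs of values, and partially applied defined symbols. -/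
inductive IsValue (p : Program) : Expr → Prop
  | data (d : Expr) : d.IsData → IsValue p d
  | pair (v w : Expr) : IsValue p v → IsValue p w → IsValue p (.pair v w)
  | closure (f : ℕ) (vs : List Expr) : (∀ v ∈ vs, IsValue p v) → vs.length < p.arity f →
      IsValue p ((Expr.fn f).apps vs)

/-! ### Typing -/

/-- A type assignment for data constructors and defined symbols. -/
structure Signature where
  con : Con → Ty
  fn : ℕ → Ty

/-- The fixed types of `true`, `false`, `[]` and `::`, and the condition on the types of all
data constructors. -/
structure Signature.Valid (F : Signature) : Prop where
  tt : F.con .tt = .bool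
  ff : F.con .ff = .bool
  nil : F.con .nil = .list
  cons : F.con .cons = .arrow .bool (.arrow .list .list)
  isConstructorType : ∀ c, (F.con c).IsConstructorType

/-- The typing rules. -/
inductive HasType (F : Signature) (Γ : ℕ → Ty) : Expr → Ty → Prop
  | var (x : ℕ) : HasType F Γ (.var x) (Γ x)
  | con (c : Con) : HasType F Γ (.con c) (F.con c)
  | fn (f : ℕ) : HasType F Γ (.fn f) (F.fn f)
  | pair (s t : Expr) (σ τ : Ty) : HasType F Γ s σ → HasType F Γ t τ →
      HasType F Γ (.pair s t) (.prod σ τ)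
  | app (s t : Expr) (σ τ : Ty) : HasType F Γ s (.arrow σ τ) → HasType F Γ t σ →
      HasType F Γ (.app s t) τ
  | ite (s₁ s₂ s₃ : Expr) (σ : Ty) : HasType F Γ s₁ .bool → HasType F Γ s₂ σ →
      HasType F Γ s₃ σ → HasType F Γ (.ite s₁ s₂ s₃) σ
  | choose (n : ℕ) (s : Fin (n + 1) → Expr) (σ : Ty) : (∀ i, HasType F Γ (s i) σ) →
      HasType F Γ (.choose n s) σ

/-- Every data constructor that heads a sub-expression of `s` is fully applied there. -/
def FullyApplied (F : Signature) (s : Expr) : Prop :=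
  ∀ (c : Con) (ts : List Expr), s.Sub ((Expr.con c).apps ts) → ts.length = (F.con c).arity

/-- The clause is well-typed for `F`, by a type environment in which all variables have a type
of order at most `K`. -/
structure Clause.WellTyped (F : Signature) (K : ℕ) (c : Clause) : Prop where
  pattern : ∀ l ∈ c.pats, l.IsPattern
  linear : c.lhs.varList.Nodup
  vars : ∀ x ∈ c.rhs.varList, x ∈ c.lhs.varList
  typed : ∃ (Γ : ℕ → Ty) (σ : Ty), (∀ x ∈ c.lhs.varList, (Γ x).order ≤ K) ∧
    HasType F Γ c.lhs σ ∧ HasType F Γ c.rhs σ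

/-- The clauses are well-typed for `F` and well-formed, and they have data order `K`.  (There is
no condition on a main function here.) -/
structure ClausesWellFormed (F : Signature) (K : ℕ) (p : Program) : Prop where
  valid : F.Valid
  wellTyped : ∀ c ∈ p, c.WellTyped F K
  constructors : ∀ c ∈ p, FullyApplied F c.lhs ∧ FullyApplied F c.rhs
  arities : ∀ c ∈ p, ∀ c' ∈ p, c.root = c'.root → c.pats.length = c'.pats.length

/-- The program is well-formed of data order `K`, and its main function, which is the root of its
first clause, has type `list ⇒ bool`. -/
def Program.IsDecisionProgram (p : Program) (K : ℕ) : Prop :=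
  ∃ F : Signature, ClausesWellFormed F K p ∧
    ∃ c : Clause, p.head? = some c ∧ F.fn c.root = .arrow .list .bool

/-! ### Cons-freeness -/

/-- Every sub-expression of the right-hand side that is headed by a data constructor is a data
expression or a sub-expression of an argument on the left-hand side. -/
def Clause.ConsFree (c : Clause) : Prop :=
  ∀ (k : Con) (ts : List Expr), c.rhs.Sub ((Expr.con k).apps ts) →
    ((Expr.con k).apps ts).IsData ∨ ∃ l ∈ c.pats, l.Sub ((Expr.con k).apps ts)

def Program.ConsFree (p : Program) : Prop := ∀ c ∈ p, c.ConsFree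

/-! ### Call-by-value semantics -/

/-- The environment `γ` has the variables of the left-hand side as its domain, and it
instantiates the left-hand side to `f v₁ ⋯ vₙ`. -/
def Clause.Matches (c : Clause) (γ : Env) (f : ℕ) (vs : List Expr) : Prop :=
  c.root = f ∧ (∀ x, (γ x).isSome ↔ x ∈ c.lhs.varList) ∧ c.pats.map (Expr.inst γ) = vs

/-- The left-hand sides of the three kinds of judgments `γ ⊢ s → w`, `γ ⊢ⁱᶠ d, s, t → w` and
`⊢ᶜᵃˡˡ f v₁ ⋯ vₙ → w`. -/
inductive Judgment where
  | expr (γ : Env) (s : Expr)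
  | ite (γ : Env) (d s t : Expr)
  | call (f : ℕ) (vs : List Expr)

/-- The evaluation rules of the program `p`. -/
inductive Eval (p : Program) : Judgment → Expr → Prop
  | instance_ (γ : Env) (x : ℕ) (v : Expr) : γ x = some v → Eval p (.expr γ (.var x)) v
  | function (γ : Env) (f : ℕ) (w : Expr) : Eval p (.call f []) w → Eval p (.expr γ (.fn f)) w
  | constructor (γ : Env) (c : Con) (ss bs : List Expr) : ss.length = bs.length →
      (∀ q ∈ ss.zip bs, Eval p (.expr γ q.1) q.2) →
      Eval p (.expr γ ((Expr.con c).apps ss)) ((Expr.con c).apps bs)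
  | pair (γ : Env) (s t v w : Expr) : Eval p (.expr γ s) v → Eval p (.expr γ t) w →
      Eval p (.expr γ (.pair s t)) (.pair v w)
  | choice (γ : Env) (n : ℕ) (s : Fin (n + 1) → Expr) (i : Fin (n + 1)) (w : Expr) :
      Eval p (.expr γ (s i)) w → Eval p (.expr γ (.choose n s)) w
  | conditional (γ : Env) (s₁ s₂ s₃ d w : Expr) : Eval p (.expr γ s₁) d →
      Eval p (.ite γ d s₂ s₃) w → Eval p (.expr γ (.ite s₁ s₂ s₃)) w
  | ifTrue (γ : Env) (s₂ s₃ w : Expr) : Eval p (.expr γ s₂) w →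
      Eval p (.ite γ (.con .tt) s₂ s₃) w
  | ifFalse (γ : Env) (s₂ s₃ w : Expr) : Eval p (.expr γ s₃) w →
      Eval p (.ite γ (.con .ff) s₂ s₃) w
  | appl (γ : Env) (s t : Expr) (f : ℕ) (vs : List Expr) (v w : Expr) :
      Eval p (.expr γ s) ((Expr.fn f).apps vs) → Eval p (.expr γ t) v →
      Eval p (.call f (vs ++ [v])) w → Eval p (.expr γ (.app s t)) w
  | closure (f : ℕ) (vs : List Expr) : vs.length < p.arity f →
      Eval p (.call f vs) ((Expr.fn f).apps vs)
  | call (f : ℕ) (vs : List Expr) (pre post : List Clause) (c : Clause) (γ : Env) (w : Expr) :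
      p = pre ++ c :: post → (∀ c' ∈ pre, ¬ ∃ δ, c'.Matches δ f vs) → c.Matches γ f vs →
      Eval p (.expr γ c.rhs) w → Eval p (.call f vs) w

/-- `⟦p⟧(d₁, …, d_M) ↦ b`: the main function applied to variables `x₁, …, x_M` evaluates to the
data expression `b` in the environment `[x₁ := d₁, …, x_M := d_M]`. -/
def Program.Executes (p : Program) (ds : List Expr) (b : Expr) : Prop :=
  b.IsData ∧ ∃ c : Clause, p.head? = some c ∧
    Eval p (.expr (fun i => ds[i]?) ((Expr.fn c.root).apps ((List.range ds.length).map .var))) b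

/-- The list of booleans that represents a word over `{0, 1}`. -/
def encode : List Bool → Expr
  | [] => .con .nil
  | a :: as => (Expr.con .cons).apps [.con (if a then .tt else .ff), encode as]

/-- The set of words accepted by a program. -/
def Program.acceptedSet (p : Program) : Set (List Bool) :=
  {a | p.Executes [encode a] (.con .tt)}

/-! ### Turing machines and elementary time -/

/-- The two directions in which the head may move. -/
inductive Dir where
  | L
  | R

/-- Deterministic Turing machines with one tape, infinite to the right.  The transition
`δ i r = (w, d, j)` is only used for `i` different from `accept` and `reject`. -/
structure DTM where
  A : Type
  S : Type
  finA : Finite A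
  finS : Finite S
  zero : A
  one : A
  blank : A
  zero_ne_one : zero ≠ one
  zero_ne_blank : zero ≠ blank
  one_ne_blank : one ≠ blank
  start : S
  accept : S
  reject : S
  start_ne_accept : start ≠ accept
  start_ne_reject : start ≠ reject
  accept_ne_reject : accept ≠ reject
  δ : S → A → A × Dir × S

namespace DTM

variable (M : DTM)

/-- Configurations: tape, head position and state. -/
structure Cfg where
  tape : ℕ → M.A
  pos : ℕ
  state : M.S

/-- The state is `accept` or `reject`. -/
def Halted (c : M.Cfg) : Prop := c.state = M.accept ∨ c.state = M.reject

/-- The new head position.  A move to the left from position `0` leaves the head in place. -/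
def move : Dir → ℕ → ℕ
  | .L, n => n - 1
  | .R, n => n + 1

/-- The configuration after a transition. -/
def next (c : M.Cfg) : M.Cfg where
  tape := Function.update c.tape c.pos (M.δ c.state (c.tape c.pos)).1
  pos := move (M.δ c.state (c.tape c.pos)).2.1 c.pos
  state := (M.δ c.state (c.tape c.pos)).2.2

/-- `k` transitions lead from one configuration to the other. -/
inductive ReachesIn : ℕ → M.Cfg → M.Cfg → Prop
  | refl (c : M.Cfg) : ReachesIn 0 c c
  | step (k : ℕ) (c c' : M.Cfg) : ¬ M.Halted c → ReachesIn k (M.next c) c' →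
      ReachesIn (k + 1) c c'

/-- The tape holds a blank, then the word `x`, then blanks only; the head is at position `0`. -/
def init (x : List Bool) : M.Cfg where
  tape
    | 0 => M.blank
    | i + 1 => (x[i]?.map fun a => if a then M.one else M.zero).getD M.blank
  pos := 0
  state := M.start

/-- `M` decides the set `X` of nonempty words. -/
def Decides (X : Set (List Bool)) : Prop :=
  ∀ x : List Bool, x ≠ [] →
    (x ∈ X ↔ ∃ k c, M.ReachesIn k (M.init x) c ∧ c.state = M.accept) ∧
    (x ∉ X ↔ ∃ k c, M.ReachesIn k (M.init x) c ∧ c.state = M.reject)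

/-- On every nonempty word `x`, the machine halts after at most `h |x|` transitions. -/
def RunsInTime (h : ℕ → ℕ) : Prop :=
  ∀ x : List Bool, x ≠ [] → ∃ k c, k ≤ h x.length ∧ M.ReachesIn k (M.init x) c ∧ M.Halted c

end DTM

/-- Decision problems: sets of nonempty words over `{0, 1}`. -/
def IsDecisionProblem (X : Set (List Bool)) : Prop := [] ∉ X

/-- The class `TIME(h(n))`. -/
def TIME (h : ℕ → ℕ) : Set (Set (List Bool)) :=
  {X | IsDecisionProblem X ∧
    ∃ a : ℕ, 0 < a ∧ ∃ M : DTM, M.RunsInTime (fun n => a * h n) ∧ M.Decides X}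

/-- `exp₂^K(n)`: the tower of `K` twos with `n` on top. -/
def exp2 : ℕ → ℕ → ℕ
  | 0, n => n
  | K + 1, n => 2 ^ exp2 K n

/-- The class `EXP^K TIME`. -/
def EXPTIME (K : ℕ) : Set (Set (List Bool)) :=
  ⋃ (a : ℕ) (b : ℕ), TIME (fun n => exp2 K (a * n ^ b))

/-- The class `ELEMENTARY`. -/
def ELEMENTARY : Set (Set (List Bool)) := ⋃ K : ℕ, EXPTIME K

/-! ### Counting modules -/

/-- `P`-counting modules of data order `K`.  `ty` is the type of numbers, `syms` is the set of
defined symbols of the module, `vals n` is the set of values that represent numbers for input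
lists of length `n`, and `interp n` maps these values to the numbers they represent (its values
outside `vals n` are irrelevant). -/
structure CountingModule (P : ℕ → ℕ) (K : ℕ) where
  ty : Ty
  syms : Finset ℕ
  seed : ℕ
  pred : ℕ
  zero : ℕ
  vals : ℕ → Set Expr
  interp : ℕ → Expr → ℕ
  prog : Program
  sig : Signature
  seed_mem : seed ∈ syms
  pred_mem : pred ∈ syms
  zero_mem : zero ∈ syms
  seed_type : sig.fn seed = .arrow .list ty
  pred_type : sig.fn pred = .arrow .list (.arrow ty ty)
  zero_type : sig.fn zero = .arrow .list (.arrow ty .bool)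
  wellFormed : ClausesWellFormed sig K prog
  consFree : prog.ConsFree
  prog_syms : ∀ c ∈ prog, c.lhs.fns ⊆ syms ∧ c.rhs.fns ⊆ syms
  vals_value : ∀ n, ∀ v ∈ vals n, IsValue prog v ∧ FullyApplied sig v ∧
    (∀ Γ, HasType sig Γ v ty) ∧ v.fns ⊆ syms
  seed_unique : ∀ cs : List Bool, ∃! v, Eval prog (.call seed [encode cs]) v
  seed_eval : ∀ (cs : List Bool) (v : Expr), Eval prog (.call seed [encode cs]) v →
    v ∈ vals cs.length ∧ interp cs.length v = P cs.length - 1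
  pred_unique : ∀ (cs : List Bool), ∀ v ∈ vals cs.length, 0 < interp cs.length v →
    ∃! w, Eval prog (.call pred [encode cs, v]) w
  pred_eval : ∀ (cs : List Bool), ∀ v ∈ vals cs.length, 0 < interp cs.length v →
    ∀ w, Eval prog (.call pred [encode cs, v]) w →
      w ∈ vals cs.length ∧ interp cs.length w = interp cs.length v - 1
  zero_true : ∀ (cs : List Bool), ∀ v ∈ vals cs.length,
    (Eval prog (.call zero [encode cs, v]) (.con .tt) ↔ interp cs.length v = 0)
  zero_false : ∀ (cs : List Bool), ∀ v ∈ vals cs.length,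
    (Eval prog (.call zero [encode cs, v]) (.con .ff) ↔ 0 < interp cs.length v)

end CFProg

/-!
Both parts rest on one construction on counting modules and one on Turing machines.

**From `P` to `2 ^ (P n - 1)`** (`CountingModule.exp`). A number below `2 ^ (P n - 1)` is a value `F`
of type `bool ⇒ α`, read as a non-deterministic function: `F true` may evaluate to the indices of the
bits that are one and `F false` to those of the bits that are zero, with indices from `1` to
`P n - 1` in the given module. The order stays at `1`, since the type `α` of a module of data order
at most `1` has order at most `1` (`CountingModule.order_ty_le`). A counting module asks for exactly
one value of `seed cs` and of `pred cs F`. The clauses for `seed` and `pred` therefore have one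
pattern more than these calls supply arguments, so that the calls are closures and all choices are
postponed until a bit is asked for (`eval_call_partial`). The bits of the predecessor are computed by
guessing an index and returning it only if the bit there is the requested one (`eval_pick`,
`hit_pred`); wrong guesses die in a symbol without clauses. Bit `i` of the predecessor differs from
bit `i` of the number if and only if all lower bits are zero (`sum_two_pow_pred`). Every index
from `1` to `P n - 1` is a value for exactly one of the two booleans (`IsBits`), so zero tests have
one correct answer.

A module may contain arbitrary clauses. New clauses use symbols that are not among its own, and
`eval_append_iff` shows that evaluation of the old symbols is unaffected. Cons-freeness of the new
clauses is immediate as all constructor terms on their right-hand sides are closed data.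

**Elementary time.** Pairs of lists, suffixes of the input and of a constant list, count up to `n + c`
(`baseModule`). Iterating the exponential construction reaches every tower of exponentials at data
order `1` (`exists_countingModule`), in particular beyond twice the running time of a given machine.
The computation is then described by a tableau of tape contents, in skewed coordinates in which an
entry depends only on the entries in the row above with the same or a smaller column
(`DTM.tableau`); thus the predecessor function is enough to evaluate it. For each possible content
`x` there is a symbol that takes a row and a column and may evaluate to `true` if and only if the
entry is `x`: it guesses the three entries above among those that the transition rule maps to `x`,
and checks each of them recursively (`eval_cell`). Only the value `true` carries information, which
is what non-deterministic acceptance asks for. The main function guesses the row and the column of an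
accepting entry (`eval_main`, `DTM.mem_iff_tableau`).
-/

namespace CFProg

/-! ### Applications -/

namespace Expr

/-- The head of an iterated application. -/
def hd : Expr → Expr
  | .app s _ => s.hd
  | e => e

/-- The arguments of an iterated application. -/
def args : Expr → List Expr
  | .app s t => s.args ++ [t]
  | _ => []

theorem apps_nil (s : Expr) : s.apps [] = s := rfl

theorem apps_cons (s t : Expr) (ts : List Expr) : s.apps (t :: ts) = (s.app t).apps ts :=
  rfl

theorem apps_concat (s t : Expr) (ts : List Expr) :
    s.apps (ts ++ [t]) = .app (s.apps ts) t := by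
  simp [apps, List.foldl_append]

theorem hd_apps (s : Expr) (ts : List Expr) : (s.apps ts).hd = s.hd := by
  induction ts generalizing s with
  | nil => rfl
  | cons t ts ih => simp [apps_cons, ih, hd]

theorem args_apps (s : Expr) (ts : List Expr) : (s.apps ts).args = s.args ++ ts := by
  induction ts generalizing s with
  | nil => simp [apps_nil]
  | cons t ts ih => simp [apps_cons, ih, args]

theorem apps_con_inj {c c' : Con} {ts ts' : List Expr}
    (h : (Expr.con c).apps ts = (Expr.con c').apps ts') : c = c' ∧ ts = ts' := by
  have h1 := congrArg hd h
  have h2 := congrArg args h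
  simp only [hd_apps, args_apps, hd, args, List.nil_append] at h1 h2
  exact ⟨by injection h1, h2⟩

theorem apps_fn_inj {f f' : ℕ} {ts ts' : List Expr}
    (h : (Expr.fn f).apps ts = (Expr.fn f').apps ts') : f = f' ∧ ts = ts' := by
  have h1 := congrArg hd h
  have h2 := congrArg args h
  simp only [hd_apps, args_apps, hd, args, List.nil_append] at h1 h2
  exact ⟨by injection h1, h2⟩

theorem apps_con_ne_of_hd {c : Con} {ts : List Expr} {e : Expr} (he : e.hd ≠ .con c) :
    e ≠ (Expr.con c).apps ts := by
  rintro rfl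
  exact he (hd_apps _ _)

theorem apps_fn_ne_apps_con {c : Con} {f : ℕ} {ts us : List Expr} :
    (Expr.fn f).apps us ≠ (Expr.con c).apps ts :=
  apps_con_ne_of_hd (by simp [hd_apps, hd])

theorem varList_apps (s : Expr) (ts : List Expr) :
    (s.apps ts).varList = s.varList ++ (ts.map varList).flatten := by
  induction ts generalizing s with
  | nil => simp [apps_nil]
  | cons t ts ih => simp [apps_cons, ih, varList]

theorem mem_fns_apps {s : Expr} {ts : List Expr} {f : ℕ} :
    f ∈ (s.apps ts).fns ↔ f ∈ s.fns ∨ ∃ t ∈ ts, f ∈ t.fns := by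
  induction ts generalizing s with
  | nil => simp [apps_nil]
  | cons t ts ih => simp [apps_cons, ih, fns, or_assoc]

end Expr

open _root_.CFProg.Expr

/-! ### Inversion of the evaluation rules -/

variable {p : Program} {γ : Env}

theorem eval_var {x : ℕ} {v : Expr} : Eval p (.expr γ (.var x)) v ↔ γ x = some v := by
  refine ⟨fun h => ?_, .instance_ _ _ _⟩
  generalize hJ : Judgment.expr γ (.var x) = J at h
  cases h <;> simp only [Judgment.expr.injEq, reduceCtorEq] at hJ <;> obtain ⟨h1, h2⟩ := hJ
  case instance_ h => cases h2; subst h1; exact h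
  case constructor => exact absurd h2 (apps_con_ne_of_hd (by simp [hd]))
  all_goals cases h2

theorem eval_fn {f : ℕ} {v : Expr} : Eval p (.expr γ (.fn f)) v ↔ Eval p (.call f []) v := by
  refine ⟨fun h => ?_, .function _ _ _⟩
  generalize hJ : Judgment.expr γ (.fn f) = J at h
  cases h <;> simp only [Judgment.expr.injEq, reduceCtorEq] at hJ <;> obtain ⟨h1, h2⟩ := hJ
  case function h => cases h2; exact h
  case constructor => exact absurd h2 (apps_con_ne_of_hd (by simp [hd]))
  all_goals cases h2

theorem eval_pair {s t v : Expr} : Eval p (.expr γ (.pair s t)) v ↔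
    ∃ a b, Eval p (.expr γ s) a ∧ Eval p (.expr γ t) b ∧ v = .pair a b := by
  constructor
  · intro h
    generalize hJ : Judgment.expr γ (.pair s t) = J at h
    cases h <;> simp only [Judgment.expr.injEq, reduceCtorEq] at hJ <;> obtain ⟨h1, h2⟩ := hJ
    case pair h h' => cases h2; subst h1; exact ⟨_, _, h, h', rfl⟩
    case constructor => exact absurd h2 (apps_con_ne_of_hd (by simp [hd]))
    all_goals cases h2
  · rintro ⟨a, b, ha, hb, rfl⟩
    exact .pair _ _ _ _ _ ha hb

theorem eval_choose {n : ℕ} {s : Fin (n + 1) → Expr} {v : Expr} :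
    Eval p (.expr γ (.choose n s)) v ↔ ∃ i, Eval p (.expr γ (s i)) v := by
  refine ⟨fun h => ?_, fun ⟨i, h⟩ => .choice _ _ _ i _ h⟩
  generalize hJ : Judgment.expr γ (.choose n s) = J at h
  cases h <;> simp only [Judgment.expr.injEq, reduceCtorEq] at hJ <;> obtain ⟨h1, h2⟩ := hJ
  case choice i h => cases h2; subst h1; exact ⟨i, h⟩
  case constructor => exact absurd h2 (apps_con_ne_of_hd (by simp [hd]))
  all_goals cases h2

theorem eval_ite {s₁ s₂ s₃ v : Expr} : Eval p (.expr γ (.ite s₁ s₂ s₃)) v ↔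
    (Eval p (.expr γ s₁) (.con .tt) ∧ Eval p (.expr γ s₂) v) ∨
    (Eval p (.expr γ s₁) (.con .ff) ∧ Eval p (.expr γ s₃) v) := by
  constructor
  · intro h
    generalize hJ : Judgment.expr γ (.ite s₁ s₂ s₃) = J at h
    cases h <;> simp only [Judgment.expr.injEq, reduceCtorEq] at hJ <;> obtain ⟨h1, h2⟩ := hJ
    case conditional h h' =>
      cases h2; subst h1
      cases h' with
      | ifTrue _ _ _ _ h' => exact .inl ⟨h, h'⟩
      | ifFalse _ _ _ _ h' => exact .inr ⟨h, h'⟩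
    case constructor => exact absurd h2 (apps_con_ne_of_hd (by simp [hd]))
    all_goals cases h2
  · rintro (⟨h, h'⟩ | ⟨h, h'⟩)
    · exact .conditional _ _ _ _ _ _ h (.ifTrue _ _ _ _ h')
    · exact .conditional _ _ _ _ _ _ h (.ifFalse _ _ _ _ h')

/-- The side condition excludes the constructor rule. -/
theorem eval_app {s t v : Expr} (hs : ∀ c, s.hd ≠ .con c) : Eval p (.expr γ (.app s t)) v ↔
    ∃ f vs a, Eval p (.expr γ s) ((Expr.fn f).apps vs) ∧ Eval p (.expr γ t) a ∧
      Eval p (.call f (vs ++ [a])) v := by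
  constructor
  · intro h
    generalize hJ : Judgment.expr γ (.app s t) = J at h
    cases h <;> simp only [Judgment.expr.injEq, reduceCtorEq] at hJ <;> obtain ⟨h1, h2⟩ := hJ
    case appl h h' h'' => cases h2; subst h1; exact ⟨_, _, _, h, h', h''⟩
    case constructor c _ _ _ _ => exact absurd h2 (apps_con_ne_of_hd (by simpa [hd] using hs c))
    all_goals cases h2
  · rintro ⟨f, vs, a, h, h', h''⟩
    exact .appl _ _ _ _ _ _ _ h h' h''

theorem eval_apps_con_fn {c : Con} {ss : List Expr} {f : ℕ} {vs : List Expr} :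
    ¬ Eval p (.expr γ ((Expr.con c).apps ss)) ((Expr.fn f).apps vs) := by
  induction ss using List.reverseRecOn generalizing f vs with
  | nil =>
    intro h
    generalize hJ : Judgment.expr γ ((Expr.con c).apps []) = J at h
    generalize hw : (Expr.fn f).apps vs = w at h
    cases h <;> simp only [Judgment.expr.injEq, reduceCtorEq] at hJ <;> obtain ⟨h1, h2⟩ := hJ
    case constructor => exact apps_fn_ne_apps_con hw
    all_goals cases h2
  | append_singleton ss t ih =>
    intro h
    generalize hJ : Judgment.expr γ ((Expr.con c).apps (ss ++ [t])) = J at h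
    generalize hw : (Expr.fn f).apps vs = w at h
    rw [apps_concat] at hJ
    cases h <;> simp only [Judgment.expr.injEq, reduceCtorEq] at hJ <;> obtain ⟨h1, h2⟩ := hJ
    case constructor => exact apps_fn_ne_apps_con hw
    case appl h _ _ => cases h2; subst h1; exact ih h
    all_goals cases h2

theorem eval_apps_con {c : Con} {ss : List Expr} {v : Expr} :
    Eval p (.expr γ ((Expr.con c).apps ss)) v ↔
    ∃ bs, List.Forall₂ (fun s b => Eval p (.expr γ s) b) ss bs ∧ v = (Expr.con c).apps bs := by
  constructor
  · intro h
    generalize hJ : Judgment.expr γ ((Expr.con c).apps ss) = J at h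
    cases h <;> simp only [Judgment.expr.injEq, reduceCtorEq] at hJ <;> obtain ⟨h1, h2⟩ := hJ
    case constructor hl hq =>
      obtain ⟨rfl, rfl⟩ := apps_con_inj h2
      subst h1
      exact ⟨_, List.forall₂_iff_zip.2 ⟨hl, fun {a b} h => hq (a, b) h⟩, rfl⟩
    case appl h _ _ =>
      subst h1
      rcases List.eq_nil_or_concat ss with rfl | ⟨ss, t, rfl⟩
      · cases h2
      · rw [List.concat_eq_append, apps_concat] at h2
        cases h2
        exact absurd h eval_apps_con_fn
    all_goals
      have := congrArg hd h2
      rw [hd_apps] at this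
      cases this
  · rintro ⟨bs, hb, rfl⟩
    obtain ⟨hl, hq⟩ := List.forall₂_iff_zip.1 hb
    exact .constructor _ _ _ _ hl fun q hq' => hq hq'

theorem eval_con {c : Con} {v : Expr} : Eval p (.expr γ (.con c)) v ↔ v = .con c := by
  have := eval_apps_con (p := p) (γ := γ) (c := c) (ss := []) (v := v)
  simpa [apps_nil] using this

theorem eval_encode {as : List Bool} {v : Expr} :
    Eval p (.expr γ (encode as)) v ↔ v = encode as := by
  induction as generalizing v with
  | nil => exact eval_con
  | cons a as ih =>
    rw [encode, eval_apps_con]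
    simp [List.forall₂_cons_left_iff, eval_con, ih]

/-! ### Calls -/

/-- All clauses for `f` have as many patterns as the first one. -/
def Program.ArityOK (p : Program) : Prop := ∀ c ∈ p, c.pats.length = p.arity c.root

theorem Clause.Matches.length {c : Clause} {f : ℕ} {vs : List Expr} (h : c.Matches γ f vs) :
    c.pats.length = vs.length := by
  rw [← h.2.2, List.length_map]

theorem Program.arityOK_of (h : ∀ c ∈ p, ∀ c' ∈ p, c.root = c'.root →
    c.pats.length = c'.pats.length) : p.ArityOK := by
  intro c hc
  unfold Program.arity
  cases hf : List.find? (fun d : Clause => d.root == c.root) p with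
  | none =>
    rw [List.find?_eq_none] at hf
    exact absurd (beq_self_eq_true _) (hf c hc)
  | some d =>
    have h1 := List.find?_some hf
    simp only [beq_iff_eq] at h1
    simpa using h c hc d (List.mem_of_find?_eq_some hf) h1.symm

theorem eval_call_iff {f : ℕ} {vs : List Expr} {w : Expr} : Eval p (.call f vs) w ↔
    (vs.length < p.arity f ∧ w = (Expr.fn f).apps vs) ∨
    ∃ (pre post : List Clause) (c : Clause) (γ : Env), p = pre ++ c :: post ∧
      (∀ c' ∈ pre, ¬ ∃ δ, c'.Matches δ f vs) ∧ c.Matches γ f vs ∧ Eval p (.expr γ c.rhs) w := by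
  constructor
  · intro h
    cases h with
    | closure _ _ h => exact .inl ⟨h, rfl⟩
    | call _ _ pre post c γ _ h1 h2 h3 h4 => exact .inr ⟨pre, post, c, γ, h1, h2, h3, h4⟩
  · rintro (⟨h, rfl⟩ | ⟨pre, post, c, γ, h1, h2, h3, h4⟩)
    · exact .closure _ _ h
    · exact .call _ _ pre post c γ _ h1 h2 h3 h4

theorem eval_call_partial (hp : p.ArityOK) {f : ℕ} {vs : List Expr} (h : vs.length < p.arity f)
    {w : Expr} : Eval p (.call f vs) w ↔ w = (Expr.fn f).apps vs := by
  rw [eval_call_iff]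
  constructor
  · rintro (⟨-, h⟩ | ⟨pre, post, c, γ, rfl, -, h3, -⟩)
    · exact h
    · have h1 := hp c (by simp)
      rw [h3.1, h3.length] at h1
      omega
  · exact fun hw => .inl ⟨h, hw⟩

theorem length_le_arity_of_eval_call (hp : p.ArityOK) {f : ℕ} {vs : List Expr} {w : Expr}
    (h : Eval p (.call f vs) w) : vs.length ≤ p.arity f := by
  rw [eval_call_iff] at h
  rcases h with h | ⟨pre, post, c, γ, rfl, -, h3, -⟩
  · exact h.1.le
  · have h1 := hp c (by simp)
    rw [h3.1, h3.length] at h1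
    omega

/-- Call-by-value evaluation of an application of a defined symbol to no more arguments than
its clauses have patterns. -/
theorem eval_apps_fn (hp : p.ArityOK) {f : ℕ} {ts : List Expr} (h : ts.length ≤ p.arity f)
    {w : Expr} : Eval p (.expr γ ((Expr.fn f).apps ts)) w ↔
    ∃ vs, List.Forall₂ (fun t v => Eval p (.expr γ t) v) ts vs ∧ Eval p (.call f vs) w := by
  induction ts using List.reverseRecOn generalizing w with
  | nil => simp [apps_nil, eval_fn]
  | append_singleton ts t ih =>
    rw [List.length_append, List.length_singleton] at h
    rw [apps_concat, eval_app (by simp [hd_apps, hd])]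
    constructor
    · rintro ⟨g, us, a, h1, h2, h3⟩
      obtain ⟨vs, hvs, h4⟩ := (ih (by omega)).1 h1
      rw [eval_call_partial hp (by rw [← hvs.length_eq]; omega)] at h4
      obtain ⟨rfl, rfl⟩ := apps_fn_inj h4
      exact ⟨_, List.rel_append hvs (.cons h2 .nil), h3⟩
    · rintro ⟨vs, hvs, h3⟩
      obtain ⟨us, a, h1, ha, rfl⟩ : ∃ us a, List.Forall₂ (fun t v => Eval p (.expr γ t) v) ts us ∧
          Eval p (.expr γ t) a ∧ vs = us ++ [a] := by
        have h1 := (List.forall₂_take_append _ _ _ hvs.flip).flip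
        have h2 := (List.forall₂_drop_append _ _ _ hvs.flip).flip
        obtain ⟨a, as, ha, h4, h5⟩ := List.forall₂_cons_left_iff.1 h2
        cases h4
        exact ⟨_, a, h1, ha, by rw [← h5, List.take_append_drop]⟩
      refine ⟨f, us, a, (ih (by omega)).2 ⟨us, h1, ?_⟩, ha, h3⟩
      exact (eval_call_partial hp (by rw [← h1.length_eq]; omega)).2 rfl

theorem eval_apps_fn₁ (hp : p.ArityOK) {f : ℕ} {s : Expr} (h : 1 ≤ p.arity f) {w : Expr} :
    Eval p (.expr γ ((Expr.fn f).apps [s])) w ↔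
    ∃ a, Eval p (.expr γ s) a ∧ Eval p (.call f [a]) w := by
  rw [eval_apps_fn hp (by simpa using h)]
  simp [List.forall₂_cons_left_iff]

theorem eval_apps_fn₂ (hp : p.ArityOK) {f : ℕ} {s t : Expr} (h : 2 ≤ p.arity f) {w : Expr} :
    Eval p (.expr γ ((Expr.fn f).apps [s, t])) w ↔
    ∃ a b, Eval p (.expr γ s) a ∧ Eval p (.expr γ t) b ∧ Eval p (.call f [a, b]) w := by
  rw [eval_apps_fn hp (by simpa using h)]
  constructor
  · rintro ⟨vs, _ | ⟨ha, _ | ⟨hb, _ | _⟩⟩, h⟩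
    exact ⟨_, _, ha, hb, h⟩
  · rintro ⟨a, b, ha, hb, h⟩
    exact ⟨_, .cons ha (.cons hb .nil), h⟩

theorem eval_apps_fn₃ (hp : p.ArityOK) {f : ℕ} {s t u : Expr} (h : 3 ≤ p.arity f) {w : Expr} :
    Eval p (.expr γ ((Expr.fn f).apps [s, t, u])) w ↔
    ∃ a b c, Eval p (.expr γ s) a ∧ Eval p (.expr γ t) b ∧ Eval p (.expr γ u) c ∧
      Eval p (.call f [a, b, c]) w := by
  rw [eval_apps_fn hp (by simpa using h)]
  constructor
  · rintro ⟨vs, _ | ⟨ha, _ | ⟨hb, _ | ⟨hc, _ | _⟩⟩⟩, h⟩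
    exact ⟨_, _, _, ha, hb, hc, h⟩
  · rintro ⟨a, b, c, ha, hb, hc, h⟩
    exact ⟨_, .cons ha (.cons hb (.cons hc .nil)), h⟩

theorem eval_apps_fn₄ (hp : p.ArityOK) {f : ℕ} {s t u r : Expr} (h : 4 ≤ p.arity f) {w : Expr} :
    Eval p (.expr γ ((Expr.fn f).apps [s, t, u, r])) w ↔
    ∃ a b c d, Eval p (.expr γ s) a ∧ Eval p (.expr γ t) b ∧ Eval p (.expr γ u) c ∧
      Eval p (.expr γ r) d ∧ Eval p (.call f [a, b, c, d]) w := by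
  rw [eval_apps_fn hp (by simpa using h)]
  constructor
  · rintro ⟨vs, _ | ⟨ha, _ | ⟨hb, _ | ⟨hc, _ | ⟨hd, _ | _⟩⟩⟩⟩, h⟩
    exact ⟨_, _, _, _, ha, hb, hc, hd, h⟩
  · rintro ⟨a, b, c, d, ha, hb, hc, hd, h⟩
    exact ⟨_, .cons ha (.cons hb (.cons hc (.cons hd .nil))), h⟩

/-! ### Matching -/

theorem Expr.eq_of_inst_eq {γ δ : Env} {e : Expr} (hγ : ∀ x ∈ e.varList, (γ x).isSome)
    (hδ : ∀ x ∈ e.varList, (δ x).isSome) (h : e.inst γ = e.inst δ) :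
    ∀ x ∈ e.varList, γ x = δ x := by
  induction e with
  | var x =>
    simp only [varList, List.mem_singleton, forall_eq] at hγ hδ ⊢
    obtain ⟨v, hv⟩ := Option.isSome_iff_exists.1 hγ
    obtain ⟨w, hw⟩ := Option.isSome_iff_exists.1 hδ
    simpa [inst, hv, hw] using h
  | con c => simp [varList]
  | fn f => simp [varList]
  | ite s₁ s₂ s₃ h1 h2 h3 =>
    simp only [varList, List.mem_append] at *
    simp only [inst, Expr.ite.injEq] at h
    rintro x ((hx | hx) | hx)
    · exact h1 (fun x h => hγ x (by tauto)) (fun x h => hδ x (by tauto)) h.1 x hx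
    · exact h2 (fun x h => hγ x (by tauto)) (fun x h => hδ x (by tauto)) h.2.1 x hx
    · exact h3 (fun x h => hγ x (by tauto)) (fun x h => hδ x (by tauto)) h.2.2 x hx
  | choose n s ih =>
    simp only [varList, List.mem_flatten, List.mem_ofFn] at *
    simp only [inst, Expr.choose.injEq, heq_eq_eq, true_and] at h
    rintro x ⟨_, ⟨i, rfl⟩, hx⟩
    exact ih i (fun x h => hγ x ⟨_, ⟨i, rfl⟩, h⟩) (fun x h => hδ x ⟨_, ⟨i, rfl⟩, h⟩)
      (congrFun h i) x hx
  | pair s t h1 h2 =>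
    simp only [varList, List.mem_append] at *
    simp only [inst, Expr.pair.injEq] at h
    rintro x (hx | hx)
    · exact h1 (fun x h => hγ x (by tauto)) (fun x h => hδ x (by tauto)) h.1 x hx
    · exact h2 (fun x h => hγ x (by tauto)) (fun x h => hδ x (by tauto)) h.2 x hx
  | app s t h1 h2 =>
    simp only [varList, List.mem_append] at *
    simp only [inst, Expr.app.injEq] at h
    rintro x (hx | hx)
    · exact h1 (fun x h => hγ x (by tauto)) (fun x h => hδ x (by tauto)) h.1 x hx
    · exact h2 (fun x h => hγ x (by tauto)) (fun x h => hδ x (by tauto)) h.2 x hx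

theorem Clause.mem_varList_lhs {c : Clause} {x : ℕ} :
    x ∈ c.lhs.varList ↔ ∃ l ∈ c.pats, x ∈ l.varList := by
  simp [Clause.lhs, varList_apps, varList]

theorem Clause.Matches.unique {c : Clause} {f : ℕ} {vs : List Expr} {γ δ : Env}
    (h : c.Matches γ f vs) (h' : c.Matches δ f vs) : γ = δ := by
  funext x
  by_cases hx : x ∈ c.lhs.varList
  · obtain ⟨l, hl, hxl⟩ := Clause.mem_varList_lhs.1 hx
    have h1 := h.2.2.trans h'.2.2.symm
    rw [List.map_inj_left] at h1
    exact Expr.eq_of_inst_eq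
      (fun y hy => (h.2.1 y).2 (Clause.mem_varList_lhs.2 ⟨l, hl, hy⟩))
      (fun y hy => (h'.2.1 y).2 (Clause.mem_varList_lhs.2 ⟨l, hl, hy⟩)) (h1 l hl) x hxl
  · have h1 := mt (h.2.1 x).1 hx
    have h2 := mt (h'.2.1 x).1 hx
    simp only [Bool.not_eq_true, Option.isSome_eq_false_iff, Option.isNone_iff_eq_none] at h1 h2
    rw [h1, h2]

/-- A call that is matched by exactly one clause of the program. -/
theorem eval_call_of_matches (hp : p.ArityOK) {f : ℕ} {vs : List Expr} {c : Clause} {γ : Env}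
    (hc : c ∈ p) (hm : c.Matches γ f vs) (hu : ∀ c' ∈ p, ∀ δ, c'.Matches δ f vs → c' = c)
    {w : Expr} : Eval p (.call f vs) w ↔ Eval p (.expr γ c.rhs) w := by
  rw [eval_call_iff]
  constructor
  · rintro (⟨h, -⟩ | ⟨pre, post, c', δ, h1, -, h3, h4⟩)
    · have h1 := hp c hc
      rw [hm.1, hm.length] at h1
      omega
    · obtain rfl := hu c' (by simp [h1]) δ h3
      rwa [hm.unique h3]
  · intro h
    obtain ⟨pre, post, h1, h2⟩ := List.eq_append_cons_of_mem hc
    exact .inr ⟨pre, post, c, γ, h1,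
      fun c' hc' ⟨δ, hδ⟩ => h2 (hu c' (by simp [h1, hc']) δ hδ ▸ hc'), hm, h⟩

/-- The clause `f x₀ ⋯ xₖ₋₁ = s`. -/
def varClause (f k : ℕ) (s : Expr) : Clause := ⟨f, (List.range k).map .var, s⟩

theorem mem_varList_lhs_varClause {f k x : ℕ} {s : Expr} :
    x ∈ (varClause f k s).lhs.varList ↔ x < k := by
  rw [Clause.mem_varList_lhs]
  simp [varClause, varList]

theorem varClause_matches {f : ℕ} {s : Expr} {vs : List Expr} :
    (varClause f vs.length s).Matches (fun i => vs[i]?) f vs := by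
  refine ⟨rfl, fun x => ?_, ?_⟩
  · rw [mem_varList_lhs_varClause]
    simp
  · apply List.ext_getElem
    · simp [varClause]
    · intro i h1 h2
      simp [varClause, inst, h2]

/-- `f` is defined in `p` by the single clause `f x₀ ⋯ xₖ₋₁ = s`. -/
def Program.Defines (p : Program) (f k : ℕ) (s : Expr) : Prop :=
  varClause f k s ∈ p ∧ ∀ c ∈ p, c.root = f → c = varClause f k s

theorem Program.Defines.arity {f k : ℕ} {s : Expr} (h : p.Defines f k s) (hp : p.ArityOK) :
    p.arity f = k := by
  rw [← show (varClause f k s).root = f from rfl, ← hp _ h.1]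
  simp [varClause]

theorem Program.Defines.eval_call {f k : ℕ} {s : Expr} (h : p.Defines f k s) (hp : p.ArityOK)
    {vs : List Expr} (hk : vs.length = k) {w : Expr} :
    Eval p (.call f vs) w ↔ Eval p (.expr (fun i => vs[i]?) s) w := by
  subst hk
  exact eval_call_of_matches hp h.1 varClause_matches fun c hc δ hδ => h.2 c hc hδ.1

/-- A symbol without clauses has no value. -/
theorem eval_fn_of_no_clause {f : ℕ} (h : ∀ c ∈ p, c.root ≠ f) {w : Expr} :
    ¬ Eval p (.expr γ (.fn f)) w := by
  rw [eval_fn, eval_call_iff]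
  rintro (⟨h1, -⟩ | ⟨pre, post, c, γ, h1, -, h3, -⟩)
  · have h2 : List.find? (fun c : Clause => c.root == f) p = none := by
      simpa [List.find?_eq_none] using h
    simp [Program.arity, h2] at h1
  · exact h c (by simp [h1]) h3.1

/-! ### Well-formed clauses -/

theorem isData_encode (as : List Bool) : (encode as).IsData := by
  induction as with
  | nil => exact .con .nil [] (by simp)
  | cons a as ih =>
    refine .con .cons _ fun d hd => ?_
    simp only [List.mem_cons, List.not_mem_nil, or_false] at hd
    rcases hd with rfl | rfl
    · exact .con _ [] (by simp)
    · exact ih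

theorem fns_encode (as : List Bool) : (encode as).fns = ∅ := by
  induction as with
  | nil => rfl
  | cons a as ih => simp [encode, apps_cons, apps_nil, fns, ih]

theorem varList_encode (as : List Bool) : (encode as).varList = [] := by
  induction as with
  | nil => rfl
  | cons a as ih => simp [encode, apps_cons, apps_nil, varList, ih]

/-- `choose d e₁ ⋯ eₙ`. -/
def Expr.chooseList (d : Expr) (es : List Expr) : Expr :=
  .choose es.length fun i => (d :: es).get i

theorem eval_chooseList {p : Program} {γ : Env} {d v : Expr} {es : List Expr} :
    Eval p (.expr γ (chooseList d es)) v ↔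
      Eval p (.expr γ d) v ∨ ∃ e ∈ es, Eval p (.expr γ e) v := by
  rw [chooseList, eval_choose, ← List.exists_mem_cons_iff (fun e => Eval p (.expr γ e) v)]
  constructor
  · rintro ⟨i, h⟩
    exact ⟨_, List.get_mem _ _, h⟩
  · rintro ⟨e, he, h⟩
    obtain ⟨i, rfl⟩ := List.get_of_mem he
    exact ⟨i, h⟩

theorem Expr.mem_fns_chooseList {d : Expr} {es : List Expr} {f : ℕ} :
    f ∈ (chooseList d es).fns ↔ f ∈ d.fns ∨ ∃ e ∈ es, f ∈ e.fns := by
  rw [← List.exists_mem_cons_iff (p := fun e : Expr => f ∈ e.fns), chooseList, fns, Set.mem_iUnion]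
  constructor
  · rintro ⟨i, h⟩
    exact ⟨_, List.get_mem _ _, h⟩
  · rintro ⟨e, he, h⟩
    obtain ⟨i, rfl⟩ := List.get_of_mem he
    exact ⟨i, h⟩

/-- Every sub-expression that is headed by a data constructor is a data expression in which the
constructor is fully applied.  Right-hand sides of this kind are cons-free. -/
def Expr.Plain (F : Signature) (s : Expr) : Prop :=
  ∀ (c : Con) (ts : List Expr), s.Sub ((Expr.con c).apps ts) →
    ts.length = (F.con c).arity ∧ ((Expr.con c).apps ts).IsData

section Plain
variable {F : Signature}

theorem plain_var (x : ℕ) : Plain F (.var x) := by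
  rintro c ts (h | h)
  · exact absurd h (apps_con_ne_of_hd (by simp [hd]))
  · exact h.elim

theorem plain_fn (f : ℕ) : Plain F (.fn f) := by
  rintro c ts (h | h)
  · exact absurd h (apps_con_ne_of_hd (by simp [hd]))
  · exact h.elim

theorem Expr.Plain.ite {s t u : Expr} (hs : Plain F s) (ht : Plain F t) (hu : Plain F u) :
    Plain F (.ite s t u) := by
  rintro c ts (h | h | h | h)
  · exact absurd h (apps_con_ne_of_hd (by simp [hd]))
  · exact hs c ts h
  · exact ht c ts h
  · exact hu c ts h

theorem Expr.Plain.pair {s t : Expr} (hs : Plain F s) (ht : Plain F t) :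
    Plain F (.pair s t) := by
  rintro c ts (h | h | h)
  · exact absurd h (apps_con_ne_of_hd (by simp [hd]))
  · exact hs c ts h
  · exact ht c ts h

theorem Expr.Plain.app {s t : Expr} (hc : ∀ c, s.hd ≠ .con c) (hs : Plain F s) (ht : Plain F t) :
    Plain F (.app s t) := by
  rintro c ts (h | h | h)
  · exact absurd h (apps_con_ne_of_hd (by simpa [hd] using hc c))
  · exact hs c ts (.inr h)
  · exact ht c ts h

theorem Expr.Plain.apps {s : Expr} {ts : List Expr} (hc : ∀ c, s.hd ≠ .con c) (hs : Plain F s)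
    (ht : ∀ t ∈ ts, Plain F t) : Plain F (s.apps ts) := by
  induction ts generalizing s with
  | nil => exact hs
  | cons t ts ih =>
    exact ih (by simpa [hd] using hc) (hs.app hc (ht t (by simp))) fun u hu => ht u (by simp [hu])

theorem Expr.Plain.chooseList {d : Expr} {es : List Expr} (hd' : Plain F d)
    (he : ∀ e ∈ es, Plain F e) : Plain F (chooseList d es) := by
  rintro c ts (h | ⟨i, h⟩)
  · exact absurd h (apps_con_ne_of_hd (by simp [hd, Expr.chooseList]))
  · have h1 : (d :: es).get i ∈ d :: es := List.get_mem _ _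
    rcases List.mem_cons.1 h1 with h1 | h1
    · exact hd' c ts (h1 ▸ h)
    · exact he _ h1 c ts h

theorem plain_con {c : Con} (hc : (F.con c).arity = 0) : Plain F (.con c) := by
  rintro c' ts (h | h)
  · obtain ⟨rfl, rfl⟩ := apps_con_inj (ts := []) h
    exact ⟨hc.symm, .con _ [] (by simp)⟩
  · exact h.elim

theorem plain_encode (hF : F.Valid) (as : List Bool) : Plain F (encode as) := by
  induction as with
  | nil => exact plain_con (by simp [hF.nil, Ty.arity])
  | cons a as ih =>
    rintro c ts (h | (h | h) | h)
    · rw [← h]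
      obtain ⟨rfl, rfl⟩ := apps_con_inj h
      exact ⟨by simp [hF.cons, Ty.arity], isData_encode (a :: as)⟩
    · exact h.elim
    · exact plain_con (by cases a <;> simp [hF.tt, hF.ff, Ty.arity]) c ts h
    · exact ih c ts h

theorem Expr.Plain.fullyApplied {s : Expr} (h : Plain F s) : FullyApplied F s :=
  fun c ts hs => (h c ts hs).1

end Plain

/-- `σ₁ ⇒ ⋯ ⇒ σₙ ⇒ τ`. -/
abbrev Ty.arrows (σs : List Ty) (τ : Ty) : Ty := σs.foldr .arrow τ

/-- The conditions on a right-hand side of type `τ` whose variables are among `x₀, …, xₖ₋₁`. -/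
structure GoodRhs (F : Signature) (Γ : ℕ → Ty) (k : ℕ) (s : Expr) (τ : Ty) : Prop where
  typed : HasType F Γ s τ
  vars : ∀ x ∈ s.varList, x < k
  plain : Plain F s

namespace GoodRhs
variable {F : Signature} {Γ : ℕ → Ty} {k : ℕ} {τ : Ty}

theorem var {x : ℕ} (hx : x < k) (h : Γ x = τ) : GoodRhs F Γ k (.var x) τ :=
  ⟨h ▸ .var x, by simpa [varList] using hx, plain_var x⟩

theorem fn {f : ℕ} (h : F.fn f = τ) : GoodRhs F Γ k (.fn f) τ :=
  ⟨h ▸ .fn f, by simp [varList], plain_fn f⟩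

theorem tt (hF : F.Valid) : GoodRhs F Γ k (.con .tt) .bool :=
  ⟨hF.tt ▸ .con _, by simp [varList], plain_con (by simp [hF.tt, Ty.arity])⟩

theorem ff (hF : F.Valid) : GoodRhs F Γ k (.con .ff) .bool :=
  ⟨hF.ff ▸ .con _, by simp [varList], plain_con (by simp [hF.ff, Ty.arity])⟩

theorem encode (hF : F.Valid) (as : List Bool) : GoodRhs F Γ k (encode as) .list := by
  refine ⟨?_, by simp [varList_encode], plain_encode hF as⟩
  induction as with
  | nil => exact hF.nil ▸ .con _
  | cons a as ih =>
    refine .app _ _ .list _ (.app _ _ .bool _ (hF.cons ▸ .con _) ?_) ih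
    cases a
    · exact hF.ff ▸ .con _
    · exact hF.tt ▸ .con _

theorem ite {s t u : Expr} (hs : GoodRhs F Γ k s .bool) (ht : GoodRhs F Γ k t τ)
    (hu : GoodRhs F Γ k u τ) : GoodRhs F Γ k (.ite s t u) τ := by
  refine ⟨.ite _ _ _ _ hs.typed ht.typed hu.typed, fun x hx => ?_,
    hs.plain.ite ht.plain hu.plain⟩
  simp only [varList, List.mem_append] at hx
  rcases hx with (hx | hx) | hx
  exacts [hs.vars x hx, ht.vars x hx, hu.vars x hx]

theorem pair {s t : Expr} {σ : Ty} (hs : GoodRhs F Γ k s σ) (ht : GoodRhs F Γ k t τ) :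
    GoodRhs F Γ k (.pair s t) (.prod σ τ) := by
  refine ⟨.pair _ _ _ _ hs.typed ht.typed, fun x hx => ?_, hs.plain.pair ht.plain⟩
  simp only [varList, List.mem_append] at hx
  rcases hx with hx | hx
  exacts [hs.vars x hx, ht.vars x hx]

theorem app {s t : Expr} {σ : Ty} (hc : ∀ c, s.hd ≠ .con c)
    (hs : GoodRhs F Γ k s (.arrow σ τ)) (ht : GoodRhs F Γ k t σ) :
    GoodRhs F Γ k (.app s t) τ := by
  refine ⟨.app _ _ _ _ hs.typed ht.typed, fun x hx => ?_, hs.plain.app hc ht.plain⟩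
  simp only [varList, List.mem_append] at hx
  rcases hx with hx | hx
  exacts [hs.vars x hx, ht.vars x hx]

theorem apps {s : Expr} {ts : List Expr} {σs : List Ty} (hc : ∀ c, s.hd ≠ .con c)
    (hs : GoodRhs F Γ k s (.arrows σs τ)) (ht : List.Forall₂ (GoodRhs F Γ k) ts σs) :
    GoodRhs F Γ k (s.apps ts) τ := by
  induction ht generalizing s with
  | nil => exact hs
  | cons h _ ih => exact ih (by simpa [hd] using hc) (hs.app hc h)

theorem call₁ {f : ℕ} {s : Expr} {σ : Ty} (hf : F.fn f = .arrow σ τ)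
    (hs : GoodRhs F Γ k s σ) : GoodRhs F Γ k ((Expr.fn f).apps [s]) τ :=
  apps (by simp [hd]) (fn (τ := .arrows [σ] τ) hf) (.cons hs .nil)

theorem call₂ {f : ℕ} {s t : Expr} {σ σ' : Ty} (hf : F.fn f = .arrow σ (.arrow σ' τ))
    (hs : GoodRhs F Γ k s σ) (ht : GoodRhs F Γ k t σ') :
    GoodRhs F Γ k ((Expr.fn f).apps [s, t]) τ :=
  apps (by simp [hd]) (fn (τ := .arrows [σ, σ'] τ) hf) (.cons hs (.cons ht .nil))

theorem call₃ {f : ℕ} {s t u : Expr} {σ σ' σ'' : Ty}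
    (hf : F.fn f = .arrow σ (.arrow σ' (.arrow σ'' τ)))
    (hs : GoodRhs F Γ k s σ) (ht : GoodRhs F Γ k t σ') (hu : GoodRhs F Γ k u σ'') :
    GoodRhs F Γ k ((Expr.fn f).apps [s, t, u]) τ :=
  apps (by simp [hd]) (fn (τ := .arrows [σ, σ', σ''] τ) hf) (.cons hs (.cons ht (.cons hu .nil)))

theorem call₄ {f : ℕ} {s t u r : Expr} {σ σ' σ'' σ''' : Ty}
    (hf : F.fn f = .arrow σ (.arrow σ' (.arrow σ'' (.arrow σ''' τ))))
    (hs : GoodRhs F Γ k s σ) (ht : GoodRhs F Γ k t σ') (hu : GoodRhs F Γ k u σ'')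
    (hr : GoodRhs F Γ k r σ''') :
    GoodRhs F Γ k ((Expr.fn f).apps [s, t, u, r]) τ :=
  apps (by simp [hd]) (fn (τ := .arrows [σ, σ', σ'', σ'''] τ) hf)
    (.cons hs (.cons ht (.cons hu (.cons hr .nil))))

theorem chooseList {d : Expr} {es : List Expr} (hd' : GoodRhs F Γ k d τ)
    (he : ∀ e ∈ es, GoodRhs F Γ k e τ) : GoodRhs F Γ k (chooseList d es) τ := by
  have hall : ∀ e ∈ d :: es, GoodRhs F Γ k e τ := by
    intro e h
    rcases List.mem_cons.1 h with rfl | h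
    exacts [hd', he e h]
  refine ⟨.choose _ _ _ fun i => (hall _ (List.get_mem _ _)).typed, fun x hx => ?_,
    hd'.plain.chooseList fun e h => (he e h).plain⟩
  simp only [Expr.chooseList, varList, List.mem_flatten, List.mem_ofFn] at hx
  obtain ⟨_, ⟨i, rfl⟩, hx⟩ := hx
  exact (hall _ (List.get_mem _ _)).vars x hx

end GoodRhs

/-- The conditions on a single clause in a well-formed cons-free program of data order `K`. -/
structure Clause.Good (F : Signature) (K : ℕ) (c : Clause) : Prop where
  wellTyped : c.WellTyped F K
  lhs : FullyApplied F c.lhs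
  rhs : FullyApplied F c.rhs
  consFree : c.ConsFree

/-- The type environment that assigns the listed types to `x₀, x₁, …`. -/
def tyEnv (τs : List Ty) (i : ℕ) : Ty := τs[i]?.getD .bool

theorem hasType_fn {F : Signature} {Γ : ℕ → Ty} {f : ℕ} {τ : Ty} (h : F.fn f = τ) :
    HasType F Γ (.fn f) τ := h ▸ .fn f

theorem hasType_con {F : Signature} {Γ : ℕ → Ty} {c : Con} {τ : Ty} (h : F.con c = τ) :
    HasType F Γ (.con c) τ := h ▸ .con c

theorem hasType_apps {F : Signature} {Γ : ℕ → Ty} {s : Expr} {ts : List Expr} {σs : List Ty}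
    {τ : Ty} (hs : HasType F Γ s (.arrows σs τ)) (ht : List.Forall₂ (HasType F Γ) ts σs) :
    HasType F Γ (s.apps ts) τ := by
  induction ht generalizing s with
  | nil => exact hs
  | cons h _ ih => exact ih (.app _ _ _ _ hs h)

theorem fullyApplied_apps {F : Signature} (f : ℕ) {ls : List Expr}
    (h : ∀ l ∈ ls, FullyApplied F l) : FullyApplied F ((Expr.fn f).apps ls) := by
  induction ls using List.reverseRecOn with
  | nil => exact (plain_fn f).fullyApplied
  | append_singleton ls l ih =>
    rw [apps_concat]
    rintro c ts (h' | h' | h')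
    · exact absurd h' (apps_con_ne_of_hd (by simp [hd, hd_apps]))
    · exact ih (fun l hl => h l (by simp [hl])) c ts (.inr h')
    · exact h l (by simp) c ts h'

theorem good_of_plain {F : Signature} {K : ℕ} {c : Clause} (hc : c.WellTyped F K)
    (hl : ∀ l ∈ c.pats, FullyApplied F l) (hr : Plain F c.rhs) : c.Good F K :=
  ⟨hc, fullyApplied_apps _ hl, hr.fullyApplied, fun k ts h => .inl (hr k ts h).2⟩

theorem varClause_good {F : Signature} {K f : ℕ} {s : Expr} (σs : List Ty) (τ : Ty)
    (hf : F.fn f = .arrows σs τ) (hK : ∀ σ ∈ σs, σ.order ≤ K)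
    (hs : GoodRhs F (tyEnv σs) σs.length s τ) : (varClause f σs.length s).Good F K := by
  refine good_of_plain ⟨?_, ?_, ?_, tyEnv σs, τ, ?_, ?_, hs.typed⟩ ?_ hs.plain
  · simp only [varClause, List.mem_map]
    rintro l ⟨x, -, rfl⟩
    exact .var x
  · have : (varClause f σs.length s).lhs.varList = List.range σs.length := by
      simp [varClause, Clause.lhs, varList_apps, varList, Function.comp_def, ← List.flatMap_def]
    rw [this]
    exact List.nodup_range
  · exact fun x hx => mem_varList_lhs_varClause.2 (hs.vars x hx)
  · intro x hx
    rw [mem_varList_lhs_varClause] at hx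
    simpa [tyEnv, hx] using hK _ (List.getElem_mem hx)
  · refine hasType_apps (hasType_fn hf) ?_
    rw [List.forall₂_iff_get]
    refine ⟨by simp [varClause], fun i h1 h2 => ?_⟩
    have : tyEnv σs i = σs.get ⟨i, h2⟩ := by simp [tyEnv, h2]
    rw [← this]
    simpa [varClause] using HasType.var (F := F) (Γ := tyEnv σs) i
  · simp only [varClause, List.mem_map]
    rintro l ⟨x, -, rfl⟩
    exact (plain_var x).fullyApplied

theorem Clause.Good.mono {F : Signature} {K K' : ℕ} (hK : K ≤ K') {c : Clause}
    (h : c.Good F K) : c.Good F K' := by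
  obtain ⟨Γ, σ, h1, h2⟩ := h.wellTyped.typed
  exact ⟨⟨h.wellTyped.pattern, h.wellTyped.linear, h.wellTyped.vars, Γ, σ,
    fun x hx => (h1 x hx).trans hK, h2⟩, h.lhs, h.rhs, h.consFree⟩

/-- Typing depends only on the types of the symbols that occur. -/
theorem HasType.congr {F F' : Signature} {Γ : ℕ → Ty} {s : Expr} {τ : Ty}
    (h : HasType F Γ s τ) (hc : F'.con = F.con) (hf : ∀ f ∈ s.fns, F'.fn f = F.fn f) :
    HasType F' Γ s τ := by
  induction h with
  | var x => exact .var x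
  | con c => rw [← hc]; exact .con c
  | fn f => rw [← hf f rfl]; exact .fn f
  | pair s t σ τ _ _ h1 h2 =>
    exact .pair _ _ _ _ (h1 fun f h => hf f (.inl h)) (h2 fun f h => hf f (.inr h))
  | app s t σ τ _ _ h1 h2 =>
    exact .app _ _ _ _ (h1 fun f h => hf f (.inl h)) (h2 fun f h => hf f (.inr h))
  | ite s₁ s₂ s₃ σ _ _ _ h1 h2 h3 =>
    exact .ite _ _ _ _ (h1 fun f h => hf f (.inl (.inl h))) (h2 fun f h => hf f (.inl (.inr h)))
      (h3 fun f h => hf f (.inr h))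
  | choose n s σ _ ih =>
    exact .choose _ _ _ fun i => ih i fun f h => hf f (Set.mem_iUnion.2 ⟨i, h⟩)

theorem FullyApplied.congr {F F' : Signature} {s : Expr} (h : FullyApplied F s)
    (hc : F'.con = F.con) : FullyApplied F' s := by
  intro c ts hs
  rw [hc]
  exact h c ts hs

theorem Clause.Good.congr {F F' : Signature} {K : ℕ} {c : Clause} (h : c.Good F K)
    (hc : F'.con = F.con) (hl : ∀ f ∈ c.lhs.fns, F'.fn f = F.fn f)
    (hr : ∀ f ∈ c.rhs.fns, F'.fn f = F.fn f) : c.Good F' K := by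
  obtain ⟨Γ, σ, h1, h2, h3⟩ := h.wellTyped.typed
  exact ⟨⟨h.wellTyped.pattern, h.wellTyped.linear, h.wellTyped.vars, Γ, σ, h1,
    h2.congr hc hl, h3.congr hc hr⟩, h.lhs.congr hc, h.rhs.congr hc, h.consFree⟩

/-! ### The order of the type of a pattern -/

theorem isConstructorType_of_hasType {F : Signature} (hF : F.Valid) {Γ : ℕ → Ty} {c : Con}
    {ts : List Expr} {τ : Ty} (h : HasType F Γ ((Expr.con c).apps ts) τ) :
    τ.IsConstructorType ∧ τ.arity + ts.length = (F.con c).arity := by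
  induction ts using List.reverseRecOn generalizing τ with
  | nil =>
    cases h
    exact ⟨hF.isConstructorType c, rfl⟩
  | append_singleton ts t ih =>
    rw [apps_concat] at h
    cases h with
    | app _ _ σ _ h _ =>
      obtain ⟨h1, h2⟩ := ih h
      refine ⟨h1.2, ?_⟩
      simp only [Ty.arity, List.length_append, List.length_singleton] at h2 ⊢
      omega

theorem order_le_of_isPattern {F : Signature} (hF : F.Valid) {Γ : ℕ → Ty} {K : ℕ} {l : Expr}
    (hl : l.IsPattern) (hfull : FullyApplied F l) (hK : ∀ x ∈ l.varList, (Γ x).order ≤ K)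
    {τ : Ty} (h : HasType F Γ l τ) : τ.order ≤ K := by
  induction hl generalizing τ with
  | var x =>
    cases h
    exact hK x (by simp [varList])
  | con c ls _ _ =>
    obtain ⟨h1, h2⟩ := isConstructorType_of_hasType hF h
    rw [← hfull c ls (.inl rfl)] at h2
    cases τ with
    | sort ι => simp [Ty.order]
    | prod σ τ => exact h1.elim
    | arrow σ τ => simp [Ty.arity] at h2
  | pair l l' _ _ ih ih' =>
    cases h with
    | pair _ _ σ τ hσ hτ =>
      refine max_le (ih (fun c ts h => hfull c ts ?_) (fun x hx => hK x ?_) hσ)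
        (ih' (fun c ts h => hfull c ts ?_) (fun x hx => hK x ?_) hτ)
      · exact .inr (.inl h)
      · simp [varList, hx]
      · exact .inr (.inr h)
      · simp [varList, hx]

/-! ### Evaluation in a larger program -/

/-- All defined symbols of the left-hand side of a judgment belong to `S`. -/
def Judgment.Over (S : Set ℕ) : Judgment → Prop
  | .expr γ s => s.fns ⊆ S ∧ ∀ x v, γ x = some v → v.fns ⊆ S
  | .ite γ _ s t => (s.fns ⊆ S ∧ t.fns ⊆ S) ∧ ∀ x v, γ x = some v → v.fns ⊆ S
  | .call f vs => f ∈ S ∧ ∀ v ∈ vs, v.fns ⊆ S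

theorem Expr.fns_subset_fns_inst {γ : Env} {e v : Expr} {x : ℕ} (hx : x ∈ e.varList)
    (hv : γ x = some v) : v.fns ⊆ (e.inst γ).fns := by
  induction e with
  | var y =>
    simp only [varList, List.mem_singleton] at hx
    subst hx
    simp [inst, hv]
  | con c => simp [varList] at hx
  | fn f => simp [varList] at hx
  | ite s₁ s₂ s₃ h1 h2 h3 =>
    simp only [varList, List.mem_append] at hx
    rcases hx with (hx | hx) | hx
    · exact fun f hf => .inl (.inl (h1 hx hf))
    · exact fun f hf => .inl (.inr (h2 hx hf))
    · exact fun f hf => .inr (h3 hx hf)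
  | choose n s ih =>
    simp only [varList, List.mem_flatten, List.mem_ofFn] at hx
    obtain ⟨_, ⟨i, rfl⟩, hx⟩ := hx
    exact fun f hf => Set.mem_iUnion.2 ⟨i, ih i hx hf⟩
  | pair s t h1 h2 =>
    simp only [varList, List.mem_append] at hx
    rcases hx with hx | hx
    · exact fun f hf => .inl (h1 hx hf)
    · exact fun f hf => .inr (h2 hx hf)
  | app s t h1 h2 =>
    simp only [varList, List.mem_append] at hx
    rcases hx with hx | hx
    · exact fun f hf => .inl (h1 hx hf)
    · exact fun f hf => .inr (h2 hx hf)

theorem Clause.Matches.fns_subset {S : Set ℕ} {c : Clause} {γ : Env} {f : ℕ} {vs : List Expr}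
    (h : c.Matches γ f vs) (hvs : ∀ v ∈ vs, v.fns ⊆ S) {x : ℕ} {v : Expr}
    (hv : γ x = some v) : v.fns ⊆ S := by
  have hx := (h.2.1 x).1 (by simp [hv])
  obtain ⟨l, hl, hxl⟩ := Clause.mem_varList_lhs.1 hx
  refine (fns_subset_fns_inst hxl hv).trans (hvs _ ?_)
  rw [← h.2.2]
  exact List.mem_map_of_mem hl

theorem Program.arity_congr {p p' : Program} {f : ℕ}
    (h : p.filter (fun c => c.root == f) = p'.filter fun c => c.root == f) :
    p.arity f = p'.arity f := by
  rw [Program.arity, Program.arity, ← List.head?_filter, ← List.head?_filter, h]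

/-- Two programs with the same clauses for the symbols of a closed set `S` evaluate judgments over
`S` in the same way. -/
theorem Eval.congr {p p' : Program} {S : Set ℕ}
    (h : ∀ f ∈ S, p.filter (fun c => c.root == f) = p'.filter fun c => c.root == f)
    (hS : ∀ c ∈ p, c.root ∈ S → c.rhs.fns ⊆ S) {J : Judgment} {w : Expr} (hw : Eval p J w)
    (hJ : J.Over S) : Eval p' J w ∧ w.fns ⊆ S := by
  induction hw with
  | instance_ γ x v hv => exact ⟨.instance_ _ _ _ hv, hJ.2 x v hv⟩
  | function γ f w _ ih =>
    obtain ⟨h1, h2⟩ := ih ⟨hJ.1 rfl, by simp⟩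
    exact ⟨.function _ _ _ h1, h2⟩
  | constructor γ c ss bs hl _ ih =>
    have hss : ∀ q ∈ ss.zip bs, (Judgment.expr γ q.1).Over S := fun q hq =>
      ⟨fun f hf => hJ.1 (mem_fns_apps.2 (.inr ⟨q.1, (List.of_mem_zip hq).1, hf⟩)), hJ.2⟩
    refine ⟨.constructor _ _ _ _ hl fun q hq => (ih q hq (hss q hq)).1, fun f hf => ?_⟩
    rcases mem_fns_apps.1 hf with hf | ⟨b, hb, hf⟩
    · exact hf.elim
    · obtain ⟨i, hi, rfl⟩ := List.getElem_of_mem hb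
      have hq : (ss[i], bs[i]) ∈ ss.zip bs := by
        rw [← List.getElem_zip (h := by simpa [hl] using hi)]
        exact List.getElem_mem _
      exact (ih _ hq (hss _ hq)).2 hf
  | pair γ s t v w _ _ h1 h2 =>
    obtain ⟨h1, h1'⟩ := h1 ⟨fun f hf => hJ.1 (.inl hf), hJ.2⟩
    obtain ⟨h2, h2'⟩ := h2 ⟨fun f hf => hJ.1 (.inr hf), hJ.2⟩
    exact ⟨.pair _ _ _ _ _ h1 h2, Set.union_subset h1' h2'⟩
  | choice γ n s i w _ ih =>
    obtain ⟨h1, h2⟩ := ih ⟨fun f hf => hJ.1 (Set.mem_iUnion.2 ⟨i, hf⟩), hJ.2⟩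
    exact ⟨.choice _ _ _ i _ h1, h2⟩
  | conditional γ s₁ s₂ s₃ d w _ _ h1 h2 =>
    obtain ⟨h1, -⟩ := h1 ⟨fun f hf => hJ.1 (.inl (.inl hf)), hJ.2⟩
    obtain ⟨h2, h2'⟩ := h2
      ⟨⟨fun f hf => hJ.1 (.inl (.inr hf)), fun f hf => hJ.1 (.inr hf)⟩, hJ.2⟩
    exact ⟨.conditional _ _ _ _ _ _ h1 h2, h2'⟩
  | ifTrue γ s₂ s₃ w _ ih =>
    obtain ⟨h1, h2⟩ := ih ⟨hJ.1.1, hJ.2⟩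
    exact ⟨.ifTrue _ _ _ _ h1, h2⟩
  | ifFalse γ s₂ s₃ w _ ih =>
    obtain ⟨h1, h2⟩ := ih ⟨hJ.1.2, hJ.2⟩
    exact ⟨.ifFalse _ _ _ _ h1, h2⟩
  | appl γ s t f vs v w _ _ _ h1 h2 h3 =>
    obtain ⟨h1, h1'⟩ := h1 ⟨fun f hf => hJ.1 (.inl hf), hJ.2⟩
    obtain ⟨h2, h2'⟩ := h2 ⟨fun f hf => hJ.1 (.inr hf), hJ.2⟩
    obtain ⟨h3, h3'⟩ := h3 ⟨h1' (mem_fns_apps.2 (.inl rfl)), fun u hu => by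
      rcases List.mem_append.1 hu with hu | hu
      · exact fun f hf => h1' (mem_fns_apps.2 (.inr ⟨u, hu, hf⟩))
      · rwa [List.mem_singleton.1 hu]⟩
    exact ⟨.appl _ _ _ _ _ _ _ h1 h2 h3, h3'⟩
  | closure f vs hlt =>
    refine ⟨.closure _ _ (Program.arity_congr (h f hJ.1) ▸ hlt), fun g hg => ?_⟩
    rcases mem_fns_apps.1 hg with hg | ⟨v, hv, hg⟩
    · rw [Set.mem_singleton_iff.1 hg]
      exact hJ.1
    · exact hJ.2 v hv hg
  | call f vs pre post c γ w hp hpre hm _ ih =>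
    have hcS : c.root ∈ S := hm.1 ▸ hJ.1
    obtain ⟨h1, h2⟩ := ih ⟨hS c (by simp [hp]) hcS, fun x v hv => hm.fns_subset hJ.2 hv⟩
    refine ⟨?_, h2⟩
    have hfil := (h f hJ.1).symm
    rw [hp, List.filter_append, List.filter_cons_of_pos (by simpa using hm.1),
      List.filter_eq_append_iff] at hfil
    obtain ⟨l₁, l₂, hl, hl₁, hl₂⟩ := hfil
    rw [List.filter_eq_cons_iff] at hl₂
    obtain ⟨m₁, m₂, rfl, hm₁, -, -⟩ := hl₂
    refine .call _ _ (l₁ ++ m₁) m₂ c γ _ (by simp [hl]) (fun c' hc' => ?_) hm h1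
    rintro ⟨δ, hδ⟩
    rcases List.mem_append.1 hc' with hc' | hc'
    · refine hpre c' ?_ ⟨δ, hδ⟩
      have : c' ∈ l₁.filter fun c => c.root == f :=
        List.mem_filter.2 ⟨hc', by simpa using hδ.1⟩
      rw [hl₁] at this
      exact (List.mem_filter.1 this).1
    · exact hm₁ c' hc' (by simpa using hδ.1)

/-- A program extended by clauses for symbols outside a closed set evaluates calls over this set
as before. -/
theorem eval_append_iff {q p : Program} {S : Set ℕ} (hq : ∀ c ∈ q, c.root ∉ S)
    (hp : ∀ c ∈ p, c.rhs.fns ⊆ S) {J : Judgment} {w : Expr} (hJ : J.Over S) :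
    Eval (q ++ p) J w ↔ Eval p J w := by
  have h : ∀ f ∈ S, (q ++ p).filter (fun c => c.root == f) = p.filter fun c => c.root == f := by
    intro f hf
    have hnil : q.filter (fun c => c.root == f) = [] := by
      rw [List.filter_eq_nil_iff]
      rintro c hc h
      exact hq c hc (by rw [beq_iff_eq.1 h]; exact hf)
    rw [List.filter_append, hnil, List.nil_append]
  refine ⟨fun hw => (hw.congr h (fun c hc hS => ?_) hJ).1,
    fun hw => (hw.congr (fun f hf => (h f hf).symm) (fun c hc _ => hp c hc) hJ).1⟩
  rcases List.mem_append.1 hc with hc | hc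
  · exact absurd hS (hq c hc)
  · exact hp c hc

/-! ### Extensions of counting modules -/

/-- The expression `s` has `v` as its only value. -/
def HasOnlyValue (p : Program) (γ : Env) (s v : Expr) : Prop :=
  ∀ w, Eval p (.expr γ s) w ↔ w = v

theorem hasOnlyValue_var {p : Program} {γ : Env} {x : ℕ} {v : Expr} (h : γ x = some v) :
    HasOnlyValue p γ (.var x) v := fun w => by
  rw [eval_var, h, Option.some_inj, eq_comm]

theorem eval_apps_fn_of_hasOnlyValue {p : Program} (hp : p.ArityOK) {γ : Env} {f : ℕ}
    {ts vs : List Expr} (hf : p.arity f = ts.length) (h : List.Forall₂ (HasOnlyValue p γ) ts vs)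
    {w : Expr} : Eval p (.expr γ ((Expr.fn f).apps ts)) w ↔ Eval p (.call f vs) w := by
  rw [eval_apps_fn hp hf.ge]
  constructor
  · rintro ⟨us, h1, h2⟩
    have : us = vs := by
      clear h2 hf
      induction h generalizing us with
      | nil => cases h1; rfl
      | cons ht _ ih =>
        cases h1 with
        | cons h3 h4 => rw [(ht _).1 h3, ih _ h4]
    exact this ▸ h2
  · exact fun h2 => ⟨vs, h.imp fun t v ht => (ht v).2 rfl, h2⟩

namespace CountingModule

variable {P : ℕ → ℕ} {K : ℕ} (M : CountingModule P K)

/-- The first of the symbols that are reserved for new functions. -/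
def fresh : ℕ := M.syms.sup id + 1

theorem lt_fresh {f : ℕ} (hf : f ∈ M.syms) : f < M.fresh :=
  Nat.lt_succ_of_le (Finset.le_sup (f := id) hf)

/-- The signature of the module with types for the new symbols. -/
def extendSig (ty : ℕ → Ty) : Signature where
  con := M.sig.con
  fn f := if f < M.fresh then M.sig.fn f else ty (f - M.fresh)

theorem extendSig_fresh (ty : ℕ → Ty) (i : ℕ) : (M.extendSig ty).fn (M.fresh + i) = ty i := by
  simp [extendSig]

theorem extendSig_old (ty : ℕ → Ty) {f : ℕ} (hf : f ∈ M.syms) :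
    (M.extendSig ty).fn f = M.sig.fn f := by
  simp [extendSig, M.lt_fresh hf]

theorem extendSig_valid (ty : ℕ → Ty) : (M.extendSig ty).Valid :=
  let h := M.wellFormed.valid
  ⟨h.tt, h.ff, h.nil, h.cons, h.isConstructorType⟩

theorem good_of_mem {c : Clause} (hc : c ∈ M.prog) : c.Good M.sig K :=
  ⟨M.wellFormed.wellTyped c hc, (M.wellFormed.constructors c hc).1,
    (M.wellFormed.constructors c hc).2, M.consFree c hc⟩

theorem root_mem {c : Clause} (hc : c ∈ M.prog) : c.root ∈ M.syms :=
  (M.prog_syms c hc).1 (mem_fns_apps.2 (.inl rfl))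

theorem good_append (hK : K ≤ 1) {ty : ℕ → Ty} {q : Program}
    (hq : ∀ c ∈ q, c.Good (M.extendSig ty) 1) : ∀ c ∈ q ++ M.prog, c.Good (M.extendSig ty) 1 := by
  intro c hc
  rcases List.mem_append.1 hc with hc | hc
  · exact hq c hc
  · exact ((M.good_of_mem hc).mono hK).congr rfl
      (fun f hf => M.extendSig_old ty ((M.prog_syms c hc).1 hf))
      (fun f hf => M.extendSig_old ty ((M.prog_syms c hc).2 hf))

theorem wellFormed_append (hK : K ≤ 1) {ty : ℕ → Ty} {q : Program}
    (hq : ∀ c ∈ q, c.Good (M.extendSig ty) 1)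
    (har : ∀ c ∈ q ++ M.prog, ∀ c' ∈ q ++ M.prog, c.root = c'.root →
      c.pats.length = c'.pats.length) :
    ClausesWellFormed (M.extendSig ty) 1 (q ++ M.prog) ∧ Program.ConsFree (q ++ M.prog) :=
  ⟨⟨M.extendSig_valid ty, fun c hc => (M.good_append hK hq c hc).wellTyped,
    fun c hc => ⟨(M.good_append hK hq c hc).lhs, (M.good_append hK hq c hc).rhs⟩, har⟩,
    fun c hc => (M.good_append hK hq c hc).consFree⟩

theorem defines_append {q : Program} {f k : ℕ} {s : Expr} (hf : M.fresh ≤ f)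
    (hmem : varClause f k s ∈ q) (hu : ∀ c ∈ q, c.root = f → c = varClause f k s) :
    Program.Defines (q ++ M.prog) f k s := by
  refine ⟨List.mem_append_left _ hmem, fun c hc h => ?_⟩
  rcases List.mem_append.1 hc with hc | hc
  · exact hu c hc h
  · have h1 := M.lt_fresh (M.root_mem hc)
    omega

theorem arities_append {q : Program} (hq : ∀ c ∈ q, M.fresh ≤ c.root)
    (hq' : ∀ c ∈ q, ∀ c' ∈ q, c.root = c'.root → c.pats.length = c'.pats.length) :
    ∀ c ∈ q ++ M.prog, ∀ c' ∈ q ++ M.prog, c.root = c'.root → c.pats.length = c'.pats.length := by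
  intro c hc c' hc' h
  rcases List.mem_append.1 hc with hc | hc <;> rcases List.mem_append.1 hc' with hc' | hc'
  · exact hq' c hc c' hc' h
  · have h1 := hq c hc
    have h2 := M.lt_fresh (M.root_mem hc')
    omega
  · have h1 := hq c' hc'
    have h2 := M.lt_fresh (M.root_mem hc)
    omega
  · exact M.wellFormed.arities c hc c' hc' h

/-- A program that consists of the clauses of the module and of clauses for new symbols. -/
structure Extension (p : Program) : Prop where
  arityOK : p.ArityOK
  eq_append : ∃ q, p = q ++ M.prog ∧ ∀ c ∈ q, M.fresh ≤ c.root

namespace Extension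

variable {M} {p : Program} (h : M.Extension p)
include h

/-- New clauses do not change calls of the symbols of the module. -/
theorem eval_iff {f : ℕ} (hf : f ∈ M.syms) {vs : List Expr} (hvs : ∀ v ∈ vs, v.fns ⊆ M.syms)
    {w : Expr} : Eval p (.call f vs) w ↔ Eval M.prog (.call f vs) w := by
  obtain ⟨q, rfl, hq⟩ := h.eq_append
  refine eval_append_iff (S := M.syms) (fun c hc hS => ?_) (fun c hc => (M.prog_syms c hc).2)
    ⟨hf, hvs⟩
  have h1 := hq c hc
  have h2 := M.lt_fresh hS
  omega

theorem eval_iff₂ {f : ℕ} (hf : f ∈ M.syms) {cs : List Bool} {n : ℕ} {v : Expr}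
    (hv : v ∈ M.vals n) {w : Expr} :
    Eval p (.call f [encode cs, v]) w ↔ Eval M.prog (.call f [encode cs, v]) w := by
  refine h.eval_iff hf ?_
  simp only [List.mem_cons, List.not_mem_nil, or_false, forall_eq_or_imp, forall_eq, fns_encode]
  exact ⟨Set.empty_subset _, (M.vals_value n v hv).2.2.2⟩

variable {γ : Env} {cs : List Bool} {s t v : Expr}

/-- The clauses for `seed` have at least one pattern; they may have more if the numbers are
functions. -/
theorem exists_seed (cs : List Bool) : ∃ v ∈ M.vals cs.length, M.interp cs.length v =
    P cs.length - 1 ∧ 1 ≤ p.arity M.seed ∧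
    ∀ w, Eval p (.call M.seed [encode cs]) w ↔ w = v := by
  have key : ∀ w, Eval p (.call M.seed [encode cs]) w ↔ Eval M.prog (.call M.seed [encode cs]) w :=
    fun w => h.eval_iff M.seed_mem (by simp [fns_encode])
  obtain ⟨v, hv, hu⟩ := M.seed_unique cs
  obtain ⟨h1, h2⟩ := M.seed_eval cs v hv
  refine ⟨v, h1, h2, ?_, fun w => (key w).trans ⟨hu w, fun hw => hw ▸ hv⟩⟩
  simpa using length_le_arity_of_eval_call h.arityOK ((key v).2 hv)

theorem seed_value (hs : HasOnlyValue p γ s (encode cs)) : ∃ v ∈ M.vals cs.length,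
    M.interp cs.length v = P cs.length - 1 ∧
    HasOnlyValue p γ ((Expr.fn M.seed).apps [s]) v := by
  obtain ⟨v, h1, h2, h3, h4⟩ := h.exists_seed cs
  refine ⟨v, h1, h2, fun w => ?_⟩
  rw [eval_apps_fn₁ h.arityOK h3]
  simp [hs _, h4]

theorem pred_value (hv : v ∈ M.vals cs.length) (hpos : 0 < M.interp cs.length v)
    (hs : HasOnlyValue p γ s (encode cs)) (ht : HasOnlyValue p γ t v) :
    ∃ w ∈ M.vals cs.length, M.interp cs.length w = M.interp cs.length v - 1 ∧
    HasOnlyValue p γ ((Expr.fn M.pred).apps [s, t]) w := by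
  obtain ⟨w, hw, hu⟩ := M.pred_unique cs v hv hpos
  obtain ⟨h1, h2⟩ := M.pred_eval cs v hv hpos w hw
  have h3 : 2 ≤ p.arity M.pred := by
    simpa using length_le_arity_of_eval_call h.arityOK ((h.eval_iff₂ M.pred_mem hv).2 hw)
  refine ⟨w, h1, h2, fun u => ?_⟩
  rw [eval_apps_fn₂ h.arityOK h3]
  simp only [hs _, ht _, exists_and_left, exists_eq_left, h.eval_iff₂ M.pred_mem hv]
  exact ⟨hu u, fun hu' => hu' ▸ hw⟩

theorem two_le_arity_zero (hv : v ∈ M.vals cs.length) : 2 ≤ p.arity M.zero := by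
  rcases Nat.eq_zero_or_pos (M.interp cs.length v) with h0 | h0
  · have h1 := (M.zero_true cs v hv).2 h0
    simpa using length_le_arity_of_eval_call h.arityOK ((h.eval_iff₂ M.zero_mem hv).2 h1)
  · have h1 := (M.zero_false cs v hv).2 h0
    simpa using length_le_arity_of_eval_call h.arityOK ((h.eval_iff₂ M.zero_mem hv).2 h1)

theorem eval_zero (hv : v ∈ M.vals cs.length) (hs : HasOnlyValue p γ s (encode cs))
    (ht : HasOnlyValue p γ t v) {w : Expr} : Eval p (.expr γ ((Expr.fn M.zero).apps [s, t])) w ↔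
    Eval M.prog (.call M.zero [encode cs, v]) w := by
  rw [eval_apps_fn₂ h.arityOK (h.two_le_arity_zero hv)]
  simp [hs _, ht _, h.eval_iff₂ M.zero_mem hv]

theorem zero_true_iff (hv : v ∈ M.vals cs.length) (hs : HasOnlyValue p γ s (encode cs))
    (ht : HasOnlyValue p γ t v) : Eval p (.expr γ ((Expr.fn M.zero).apps [s, t])) (.con .tt) ↔
    M.interp cs.length v = 0 :=
  (h.eval_zero hv hs ht).trans (M.zero_true cs v hv)

theorem zero_false_iff (hv : v ∈ M.vals cs.length) (hs : HasOnlyValue p γ s (encode cs))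
    (ht : HasOnlyValue p γ t v) : Eval p (.expr γ ((Expr.fn M.zero).apps [s, t])) (.con .ff) ↔
    0 < M.interp cs.length v :=
  (h.eval_zero hv hs ht).trans (M.zero_false cs v hv)

/-- A conditional on a zero test. -/
theorem eval_ite_zero (hv : v ∈ M.vals cs.length) (hs : HasOnlyValue p γ s (encode cs))
    (ht : HasOnlyValue p γ t v) {s₂ s₃ w : Expr} :
    Eval p (.expr γ (.ite ((Expr.fn M.zero).apps [s, t]) s₂ s₃)) w ↔
    (M.interp cs.length v = 0 ∧ Eval p (.expr γ s₂) w) ∨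
    (0 < M.interp cs.length v ∧ Eval p (.expr γ s₃) w) := by
  rw [eval_ite, h.zero_true_iff hv hs ht, h.zero_false_iff hv hs ht]

end Extension

/-- The numbers of a module have a type of order at most `K`, because the function `zero` has a
clause with a pattern of this type. -/
theorem order_ty_le : M.ty.order ≤ K := by
  obtain ⟨v, hv, -⟩ := M.seed_unique []
  have hv := (M.seed_eval [] v hv).1
  obtain ⟨b, hb⟩ : ∃ b, Eval M.prog (.call M.zero [encode [], v]) (.con b) := by
    rcases Nat.eq_zero_or_pos (M.interp ([] : List Bool).length v) with h0 | h0
    · exact ⟨_, (M.zero_true [] v hv).2 h0⟩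
    · exact ⟨_, (M.zero_false [] v hv).2 h0⟩
  rw [eval_call_iff] at hb
  rcases hb with ⟨-, hb⟩ | ⟨pre, post, c, γ, hp, -, hm, -⟩
  · exact absurd hb.symm (apps_con_ne_of_hd (ts := []) (by simp [hd_apps, hd]))
  have hc : c ∈ M.prog := by simp [hp]
  obtain ⟨Γ, σ, hΓ, hl, -⟩ := (M.wellFormed.wellTyped c hc).typed
  have hfull := (M.wellFormed.constructors c hc).1
  obtain ⟨f, pats, rhs⟩ := c
  obtain ⟨rfl, -, hm⟩ := hm
  have hpat := (M.wellFormed.wellTyped _ hc).pattern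
  obtain ⟨l₁, l₂, rfl⟩ := List.length_eq_two.1
    (by simpa using congrArg List.length hm : pats.length = 2)
  cases hl with
  | app _ _ σ₂ _ hl h2 =>
    cases hl with
    | app _ _ σ₁ _ hl h1 =>
      generalize hτ : Ty.arrow σ₁ (.arrow σ₂ σ) = τ at hl
      cases hl
      dsimp only at hτ
      rw [M.zero_type] at hτ
      cases hτ
      refine order_le_of_isPattern M.wellFormed.valid (hpat l₂ (by simp))
        (fun c ts h => hfull c ts (.inr (.inr h))) (fun x hx => hΓ x ?_) h2
      rw [Clause.mem_varList_lhs]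
      exact ⟨l₂, by simp, hx⟩

/-! ### Guessing a positive number -/

/-- The body of a function `any`: the call `any cs i` may evaluate to any of the numbers from `1`
to `i`.  There is no number to return for `i = 0`, so the evaluation is made to fail there by the
symbol `bot`, which has no clauses.  The number `0` is excluded since the predecessor of a number
is only defined if the number is positive. -/
def anyBody (any bot : ℕ) : Expr :=
  .ite ((Expr.fn M.zero).apps [.var 0, .var 1]) (.fn bot)
    (.chooseList (.var 1)
      [(Expr.fn any).apps [.var 0, (Expr.fn M.pred).apps [.var 0, .var 1]]])

variable {M} in
theorem Extension.eval_any {p : Program} (h : M.Extension p) {any bot : ℕ}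
    (hany : p.Defines any 2 (M.anyBody any bot)) (hbot : ∀ c ∈ p, c.root ≠ bot)
    {cs : List Bool} {v : Expr} (hv : v ∈ M.vals cs.length) :
    (∀ w, Eval p (.call any [encode cs, v]) w →
      w ∈ M.vals cs.length ∧ 0 < M.interp cs.length w ∧
        M.interp cs.length w ≤ M.interp cs.length v) ∧
    ∀ j, 0 < j → j ≤ M.interp cs.length v → ∃ w ∈ M.vals cs.length,
      M.interp cs.length w = j ∧ Eval p (.call any [encode cs, v]) w := by
  induction hk : M.interp cs.length v generalizing v with
  | zero =>
    refine ⟨fun w hw => ?_, fun j h1 h2 => by omega⟩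
    rw [hany.eval_call h.arityOK rfl, anyBody,
      h.eval_ite_zero hv (hasOnlyValue_var rfl) (hasOnlyValue_var rfl)] at hw
    simp [hk, eval_fn_of_no_clause hbot] at hw
  | succ k ih =>
    obtain ⟨u, hu, hu', hu''⟩ := h.pred_value (γ := fun i => [encode cs, v][i]?) hv (by omega)
      (hasOnlyValue_var (x := 0) rfl) (hasOnlyValue_var (x := 1) rfl)
    obtain ⟨ih1, ih2⟩ := ih hu (by omega)
    have key : ∀ w, Eval p (.call any [encode cs, v]) w ↔
        w = v ∨ Eval p (.call any [encode cs, u]) w := by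
      intro w
      rw [hany.eval_call h.arityOK rfl, anyBody,
        h.eval_ite_zero hv (hasOnlyValue_var rfl) (hasOnlyValue_var rfl), eval_chooseList,
        hasOnlyValue_var (v := v) rfl w]
      have h2 := fun w => eval_apps_fn_of_hasOnlyValue (w := w) h.arityOK
        (hany.arity h.arityOK) (.cons (hasOnlyValue_var (x := 0) rfl) (.cons hu'' .nil))
      simp [hk, h2]
    refine ⟨fun w hw => ?_, fun j h1 h2 => ?_⟩
    · rcases (key w).1 hw with rfl | hw
      · exact ⟨hv, by omega, by omega⟩
      · obtain ⟨h1, h2, h3⟩ := ih1 w hw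
        exact ⟨h1, h2, by omega⟩
    · rcases Nat.lt_or_ge k j with h3 | h3
      · exact ⟨v, hv, by omega, (key v).2 (.inl rfl)⟩
      · obtain ⟨w, h4, h5, h6⟩ := ih2 j h1 (by omega)
        exact ⟨w, h4, h5, (key w).2 (.inr h6)⟩

end CountingModule

/-! ### Functional values -/

/-- The data expression of a boolean. -/
def ofBool (b : Bool) : Expr := .con (if b then .tt else .ff)

/-- The application of the functional value `v` to `a` may evaluate to `w`. -/
def Applies (p : Program) (v a w : Expr) : Prop :=
  ∃ f vs, v = (Expr.fn f).apps vs ∧ Eval p (.call f (vs ++ [a])) w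

theorem applies_closure {p : Program} {f : ℕ} {vs : List Expr} {a w : Expr} :
    Applies p ((Expr.fn f).apps vs) a w ↔ Eval p (.call f (vs ++ [a])) w := by
  constructor
  · rintro ⟨f', vs', h, hw⟩
    obtain ⟨rfl, rfl⟩ := apps_fn_inj h
    exact hw
  · exact fun hw => ⟨f, vs, rfl, hw⟩

theorem eval_app_var {p : Program} {γ : Env} {x : ℕ} {t a v w : Expr} (hx : γ x = some v)
    (ht : HasOnlyValue p γ t a) :
    Eval p (.expr γ (.app (.var x) t)) w ↔ Applies p v a w := by
  rw [eval_app (by simp [hd])]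
  simp only [hasOnlyValue_var hx _, ht _]
  constructor
  · rintro ⟨f, vs, _, rfl, rfl, h⟩
    exact ⟨f, vs, rfl, h⟩
  · rintro ⟨f, vs, rfl, h⟩
    exact ⟨f, vs, a, rfl, rfl, h⟩

/-! ### Binary numbers as non-deterministic functions -/

/-- If `b` are the bits of a number and `b'` those of the number one less, modulo `2 ^ m`: a bit
changes if and only if all lower bits are zero. -/
theorem sum_two_pow_pred {b b' : ℕ → Prop} [DecidablePred b] [DecidablePred b'] {m : ℕ}
    (h : ∀ i < m, (b' i ↔ ((∀ j < i, ¬ b j) ∧ ¬ b i) ∨ ((∃ j < i, b j) ∧ b i))) :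
    (∑ i ∈ Finset.range m, if b' i then 2 ^ i else 0) + 1 =
      (∑ i ∈ Finset.range m, if b i then 2 ^ i else 0) + if ∀ j < m, ¬ b j then 2 ^ m else 0 := by
  induction m with
  | zero => simp
  | succ m ih =>
    have ih := ih fun i hi => h i (by omega)
    have hm := h m (by omega)
    rw [Finset.sum_range_succ, Finset.sum_range_succ, add_right_comm, ih]
    by_cases h0 : ∀ j < m, ¬ b j
    · have h1 : ¬ ∃ j < m, b j := by simpa using h0
      by_cases hb : b m
      · have h2 : ¬ ∀ j < m + 1, ¬ b j := fun h => h m (by omega) hb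
        have h3 : ¬ b' m := by tauto
        rw [if_pos h0, if_neg h3, if_pos hb, if_neg h2]
      · have h2 : ∀ j < m + 1, ¬ b j := fun j hj => by
          rcases Nat.lt_succ_iff_lt_or_eq.1 hj with hj | rfl
          exacts [h0 j hj, hb]
        have h3 : b' m := by tauto
        rw [if_pos h0, if_pos h3, if_neg hb, if_pos h2]
        ring
    · have h1 : ∃ j < m, b j := by simpa using h0
      have h2 : ¬ ∀ j < m + 1, ¬ b j := fun h => h0 fun j hj => h j (by omega)
      have h3 : b' m ↔ b m :=
        ⟨fun h => (hm.1 h).elim (fun h => absurd h.1 h0) And.right, fun h => hm.2 (.inr ⟨h1, h⟩)⟩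
      rw [if_neg h0, if_neg h2, if_congr h3 rfl rfl, add_zero, add_zero]

theorem sum_two_pow_pos_iff {b : ℕ → Prop} [DecidablePred b] {m : ℕ} :
    0 < (∑ i ∈ Finset.range m, if b i then 2 ^ i else 0) ↔ ∃ i < m, b i := by
  simp only [Finset.sum_pos_iff, Finset.mem_range]
  refine exists_congr fun i => and_congr_right fun _ => ?_
  split_ifs with h <;> simp [h]

namespace CountingModule

variable {P : ℕ → ℕ} {K : ℕ} (M : CountingModule P K)

/-- Equality of numbers. -/
abbrev eqSym : ℕ := M.fresh + 1
/-- Guessing a positive number. -/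
abbrev anySym : ℕ := M.fresh + 2
/-- A bit of a binary number. -/
abbrev bitSym : ℕ := M.fresh + 3
/-- The test that the lowest bits of a binary number are zero. -/
abbrev lowSym : ℕ := M.fresh + 4
/-- The test whether a given bit of the predecessor of a binary number has a given value. -/
abbrev pickSym : ℕ := M.fresh + 5
/-- The largest binary number. -/
abbrev seedSym : ℕ := M.fresh + 6
/-- The predecessor of a binary number. -/
abbrev predSym : ℕ := M.fresh + 7
/-- The test for the binary number zero. -/
abbrev zeroSym : ℕ := M.fresh + 8
/-- A symbol without clauses, to make an evaluation fail where a number is expected. -/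
abbrev failSym : ℕ := M.fresh + 9
/-- A symbol without clauses, to make an evaluation fail where a boolean is expected. -/
abbrev failBoolSym : ℕ := M.fresh + 10

/-- The types of the new symbols. -/
def expTypes : ℕ → Ty
  | 1 => .arrow .list (.arrow M.ty (.arrow M.ty .bool))
  | 2 => .arrow .list (.arrow M.ty M.ty)
  | 3 => .arrow .list (.arrow (.arrow .bool M.ty) (.arrow M.ty .bool))
  | 4 => .arrow .list (.arrow (.arrow .bool M.ty) (.arrow M.ty .bool))
  | 5 => .arrow .list (.arrow (.arrow .bool M.ty) (.arrow .bool (.arrow M.ty M.ty)))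
  | 6 => .arrow .list (.arrow .bool M.ty)
  | 7 => .arrow .list (.arrow (.arrow .bool M.ty) (.arrow .bool M.ty))
  | 8 => .arrow .list (.arrow (.arrow .bool M.ty) .bool)
  | 9 => M.ty
  | _ => .bool

/-- The signature of the exponential module. -/
def expSig : Signature := M.extendSig M.expTypes

/-- `eq cs i j`, by counting down both numbers. -/
def eqBody : Expr :=
  .ite ((Expr.fn M.zero).apps [.var 0, .var 1]) ((Expr.fn M.zero).apps [.var 0, .var 2])
    (.ite ((Expr.fn M.zero).apps [.var 0, .var 2]) (.con .ff)
      ((Expr.fn M.eqSym).apps [.var 0, (Expr.fn M.pred).apps [.var 0, .var 1],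
        (Expr.fn M.pred).apps [.var 0, .var 2]]))

/-- `bit cs F i`, where `F` represents a binary number: compare `i` with some value of `F true` or
of `F false`.  A comparison that fails makes the evaluation fail, so that it says nothing about the
bit. -/
def bitBody : Expr :=
  .chooseList
    (.ite ((Expr.fn M.eqSym).apps [.var 0, .var 2, .app (.var 1) (.con .tt)]) (.con .tt)
      (.fn M.failBoolSym))
    [.ite ((Expr.fn M.eqSym).apps [.var 0, .var 2, .app (.var 1) (.con .ff)]) (.con .ff)
      (.fn M.failBoolSym)]

/-- `low cs F i`: the bits of `F` with indices from `1` to `i` are zero. -/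
def lowBody : Expr :=
  .ite ((Expr.fn M.zero).apps [.var 0, .var 2]) (.con .tt)
    (.ite ((Expr.fn M.bitSym).apps [.var 0, .var 1, .var 2]) (.con .ff)
      ((Expr.fn M.lowSym).apps [.var 0, .var 1, (Expr.fn M.pred).apps [.var 0, .var 2]]))

/-- `pick cs F b i` is `i` if bit `i` of the predecessor of `F` is `b`, and fails otherwise.  This
bit is the negation of bit `i` of `F` if all lower bits of `F` are zero. -/
def pickBody : Expr :=
  .ite ((Expr.fn M.lowSym).apps [.var 0, .var 1, (Expr.fn M.pred).apps [.var 0, .var 3]])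
    (.ite ((Expr.fn M.eqSym).apps [.var 0, .var 3,
      .app (.var 1) (.ite (.var 2) (.con .ff) (.con .tt))]) (.var 3) (.fn M.failSym))
    (.ite ((Expr.fn M.eqSym).apps [.var 0, .var 3, .app (.var 1) (.var 2)]) (.var 3)
      (.fn M.failSym))

/-- `seed cs b`: any positive index for `true`, and no value for `false`.  Because of the second
argument, the call `seed cs` is a value, although its values as a function of `b` are many. -/
def seedBody : Expr :=
  .ite (.var 1) ((Expr.fn M.anySym).apps [.var 0, (Expr.fn M.seed).apps [.var 0]])
    (.fn M.failSym)

/-- `pred cs F b`: any positive index of a bit `b` in the predecessor of `F`.  Because of the third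
argument, the call `pred cs F` is a value. -/
def predBody : Expr :=
  (Expr.fn M.pickSym).apps [.var 0, .var 1, .var 2,
    (Expr.fn M.anySym).apps [.var 0, (Expr.fn M.seed).apps [.var 0]]]

/-- `zero cs F`: all bits of `F` are zero. -/
def zeroBody : Expr :=
  (Expr.fn M.lowSym).apps [.var 0, .var 1, (Expr.fn M.seed).apps [.var 0]]

/-- The new clauses of the exponential module. -/
def expClauses : Program :=
  [varClause M.eqSym 3 M.eqBody, varClause M.anySym 2 (M.anyBody M.anySym M.failSym),
    varClause M.bitSym 3 M.bitBody, varClause M.lowSym 3 M.lowBody,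
    varClause M.pickSym 4 M.pickBody, varClause M.seedSym 2 M.seedBody,
    varClause M.predSym 3 M.predBody, varClause M.zeroSym 2 M.zeroBody]

/-- The program of the exponential module. -/
def expProg : Program := M.expClauses ++ M.prog

theorem expClauses_roots : M.expClauses.map Clause.root =
    [M.eqSym, M.anySym, M.bitSym, M.lowSym, M.pickSym, M.seedSym, M.predSym, M.zeroSym] := rfl

theorem expClauses_unique {c c' : Clause} (hc : c ∈ M.expClauses) (hc' : c' ∈ M.expClauses)
    (h : c.root = c'.root) : c = c' :=
  List.inj_on_of_nodup_map (by rw [M.expClauses_roots]; simp) hc hc' h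

theorem expClauses_fresh {c : Clause} (hc : c ∈ M.expClauses) :
    M.fresh ≤ c.root ∧ c.root ≤ M.fresh + 8 := by
  have := List.mem_map_of_mem (f := Clause.root) hc
  rw [M.expClauses_roots] at this
  simp only [eqSym, anySym, bitSym, lowSym, pickSym, seedSym, predSym, zeroSym, List.mem_cons,
    List.not_mem_nil, or_false] at this
  omega

theorem exp_arities : ∀ c ∈ M.expProg, ∀ c' ∈ M.expProg, c.root = c'.root →
    c.pats.length = c'.pats.length :=
  M.arities_append (fun _ hc => (M.expClauses_fresh hc).1)
    fun _ hc _ hc' h => congrArg (fun c => c.pats.length) (M.expClauses_unique hc hc' h)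

theorem exp_extension : M.Extension M.expProg :=
  ⟨Program.arityOK_of M.exp_arities, M.expClauses, rfl, fun _ hc => (M.expClauses_fresh hc).1⟩

theorem exp_defines {f k : ℕ} {s : Expr} (hmem : varClause f k s ∈ M.expClauses) :
    M.expProg.Defines f k s :=
  M.defines_append (M.expClauses_fresh hmem).1 hmem
    fun _ hc h => M.expClauses_unique hc hmem h

theorem exp_not_root {f : ℕ} (hf : M.fresh + 8 < f) : ∀ c ∈ M.expProg, c.root ≠ f := by
  rintro c hc rfl
  rcases List.mem_append.1 hc with hc | hc
  · have := (M.expClauses_fresh hc).2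
    omega
  · have := M.lt_fresh (M.root_mem hc)
    omega

theorem eval_fail {γ : Env} {w : Expr} : ¬ Eval M.expProg (.expr γ (.fn M.failSym)) w :=
  eval_fn_of_no_clause (M.exp_not_root (by simp))

theorem eq_defines : M.expProg.Defines M.eqSym 3 M.eqBody :=
  M.exp_defines (by simp [expClauses])

theorem any_defines : M.expProg.Defines M.anySym 2 (M.anyBody M.anySym M.failSym) :=
  M.exp_defines (by simp [expClauses])

theorem bit_defines : M.expProg.Defines M.bitSym 3 M.bitBody :=
  M.exp_defines (by simp [expClauses])

theorem low_defines : M.expProg.Defines M.lowSym 3 M.lowBody :=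
  M.exp_defines (by simp [expClauses])

theorem pick_defines : M.expProg.Defines M.pickSym 4 M.pickBody :=
  M.exp_defines (by simp [expClauses])

theorem seed_defines : M.expProg.Defines M.seedSym 2 M.seedBody :=
  M.exp_defines (by simp [expClauses])

theorem pred_defines : M.expProg.Defines M.predSym 3 M.predBody :=
  M.exp_defines (by simp [expClauses])

theorem zero_defines : M.expProg.Defines M.zeroSym 2 M.zeroBody :=
  M.exp_defines (by simp [expClauses])

theorem eval_eq {cs : List Bool} {v w : Expr} (hv : v ∈ M.vals cs.length)
    (hw : w ∈ M.vals cs.length) :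
    (Eval M.expProg (.call M.eqSym [encode cs, v, w]) (.con .tt) ↔
      M.interp cs.length v = M.interp cs.length w) ∧
    (Eval M.expProg (.call M.eqSym [encode cs, v, w]) (.con .ff) ↔
      M.interp cs.length v ≠ M.interp cs.length w) := by
  have h := M.exp_extension
  induction hk : M.interp cs.length v generalizing v w with
  | zero =>
    have h0 : HasOnlyValue M.expProg (fun i => [encode cs, v, w][i]?) (.var 0) (encode cs) :=
      hasOnlyValue_var rfl
    have h2 : HasOnlyValue M.expProg (fun i => [encode cs, v, w][i]?) (.var 2) w :=
      hasOnlyValue_var rfl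
    simp only [M.eq_defines.eval_call h.arityOK (vs := [encode cs, v, w]) rfl, eqBody,
      h.eval_ite_zero hv h0 (hasOnlyValue_var (x := 1) (v := v) rfl), h.zero_true_iff hw h0 h2,
      h.zero_false_iff hw h0 h2, hk]
    simp only [true_and, lt_irrefl, false_and, or_false]
    omega
  | succ k ih =>
    have h0 : HasOnlyValue M.expProg (fun i => [encode cs, v, w][i]?) (.var 0) (encode cs) :=
      hasOnlyValue_var rfl
    have h2 : HasOnlyValue M.expProg (fun i => [encode cs, v, w][i]?) (.var 2) w :=
      hasOnlyValue_var rfl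
    have h1 : HasOnlyValue M.expProg (fun i => [encode cs, v, w][i]?) (.var 1) v :=
      hasOnlyValue_var rfl
    simp only [M.eq_defines.eval_call h.arityOK (vs := [encode cs, v, w]) rfl, eqBody,
      h.eval_ite_zero hv h0 h1, h.eval_ite_zero hw h0 h2, hk, eval_con]
    simp only [Nat.add_eq_zero_iff, one_ne_zero, and_false, false_and, false_or,
      Nat.zero_lt_succ, true_and]
    rcases Nat.eq_zero_or_pos (M.interp cs.length w) with hw0 | hw0
    · simp [hw0]
    · obtain ⟨v', hv', hv1, hv2⟩ := h.pred_value hv (by omega) h0 h1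
      obtain ⟨w', hw', hw1, hw2⟩ := h.pred_value hw (by omega) h0 h2
      have key := fun u => eval_apps_fn_of_hasOnlyValue (w := u) h.arityOK
        (M.eq_defines.arity h.arityOK) (.cons h0 (.cons hv2 (.cons hw2 .nil)))
      obtain ⟨ih1, ih2⟩ := ih hv' hw' (by omega)
      simp only [key, ih1, ih2, hw0, hw0.ne', false_and, true_and, false_or]
      omega

/-- The function `F` may return the index `i` for the argument `b`: bit `i` of the number that
`F` represents is `b`. -/
def Hit (n : ℕ) (F : Expr) (b : Bool) (i : ℕ) : Prop :=
  ∃ w, Applies M.expProg F (ofBool b) w ∧ M.interp n w = i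

/-- The function `F` returns numbers of the given module only, and for each index from `1` to
`P n - 1` it determines one bit.  Index `0` is not used, since guessed numbers are positive. -/
structure IsBits (n : ℕ) (F : Expr) : Prop where
  mem : ∀ b w, Applies M.expProg F (ofBool b) w → w ∈ M.vals n
  compl : ∀ i, 0 < i → i < P n → (M.Hit n F false i ↔ ¬ M.Hit n F true i)

variable {M} {γ : Env} {cs : List Bool} {F : Expr}

/-- A conditional on the comparison of a number with a value of `F`, with a failing alternative: it
can be evaluated if some value of `F` is equal to the number. -/
theorem eval_ite_hit {x : ℕ} {s t u i a w : Expr} {f : ℕ} {b : Bool}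
    (hs : HasOnlyValue M.expProg γ s (encode cs)) (ht : HasOnlyValue M.expProg γ t i)
    (hi : i ∈ M.vals cs.length) (hx : γ x = some F)
    (hu : HasOnlyValue M.expProg γ u (ofBool b)) (hF : M.IsBits cs.length F)
    (hf : M.fresh + 8 < f) :
    Eval M.expProg (.expr γ (.ite ((Expr.fn M.eqSym).apps [s, t, .app (.var x) u]) a (.fn f))) w ↔
      M.Hit cs.length F b (M.interp cs.length i) ∧ Eval M.expProg (.expr γ a) w := by
  have h := M.exp_extension
  rw [eval_ite, eval_apps_fn₃ h.arityOK (M.eq_defines.arity h.arityOK).ge]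
  simp only [eval_fn_of_no_clause (M.exp_not_root hf), and_false, or_false, hs _, ht _,
    eval_app_var hx hu, exists_and_left, exists_eq_left]
  refine and_congr_left fun _ => exists_congr fun w => and_congr_right fun hw => ?_
  rw [(M.eval_eq hi (hF.mem b w hw)).1, eq_comm]

theorem hasOnlyValue_tt {p : Program} : HasOnlyValue p γ (.con .tt) (ofBool true) :=
  fun _ => eval_con

theorem hasOnlyValue_ff {p : Program} : HasOnlyValue p γ (.con .ff) (ofBool false) :=
  fun _ => eval_con

theorem eval_bit {i : Expr} (hF : M.IsBits cs.length F) (hi : i ∈ M.vals cs.length) (b : Bool) :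
    Eval M.expProg (.call M.bitSym [encode cs, F, i]) (ofBool b) ↔
      M.Hit cs.length F b (M.interp cs.length i) := by
  have h := M.exp_extension
  rw [M.bit_defines.eval_call h.arityOK rfl, bitBody, eval_chooseList]
  simp only [List.mem_singleton, exists_eq_left]
  rw [eval_ite_hit (cs := cs) (i := i) (F := F) (b := true) (hasOnlyValue_var rfl)
      (hasOnlyValue_var rfl) hi rfl hasOnlyValue_tt hF (by simp),
    eval_ite_hit (cs := cs) (i := i) (F := F) (b := false) (hasOnlyValue_var rfl)
      (hasOnlyValue_var rfl) hi rfl hasOnlyValue_ff hF (by simp)]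
  cases b <;> simp [eval_con, ofBool]

theorem eval_low {i : Expr} (hF : M.IsBits cs.length F) (hi : i ∈ M.vals cs.length)
    (hlt : M.interp cs.length i < P cs.length) :
    (Eval M.expProg (.call M.lowSym [encode cs, F, i]) (.con .tt) ↔
      ∀ j, 0 < j → j ≤ M.interp cs.length i → ¬ M.Hit cs.length F true j) ∧
    (Eval M.expProg (.call M.lowSym [encode cs, F, i]) (.con .ff) ↔
      ∃ j, 0 < j ∧ j ≤ M.interp cs.length i ∧ M.Hit cs.length F true j) := by
  have h := M.exp_extension
  have h0 : ∀ i, HasOnlyValue M.expProg (fun k => [encode cs, F, i][k]?) (.var 0) (encode cs) :=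
    fun i => hasOnlyValue_var rfl
  have h1 : ∀ i, HasOnlyValue M.expProg (fun k => [encode cs, F, i][k]?) (.var 1) F :=
    fun i => hasOnlyValue_var rfl
  have h2 : ∀ i, HasOnlyValue M.expProg (fun k => [encode cs, F, i][k]?) (.var 2) i :=
    fun i => hasOnlyValue_var rfl
  induction hk : M.interp cs.length i generalizing i with
  | zero =>
    simp only [M.low_defines.eval_call h.arityOK (vs := [encode cs, F, i]) rfl, lowBody,
      h.eval_ite_zero hi (h0 i) (h2 i), hk, eval_con]
    simp only [lt_irrefl, false_and, or_false, true_and, Expr.con.injEq, reduceCtorEq, true_iff,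
      false_iff]
    exact ⟨fun j h1 h2 => by omega, fun ⟨j, h1, h2, _⟩ => by omega⟩
  | succ k ih =>
    obtain ⟨u, hu, hu1, hu2⟩ := h.pred_value hi (by omega) (h0 i) (h2 i)
    obtain ⟨ih1, ih2⟩ := ih hu (by omega) (by omega)
    have key := fun w => eval_apps_fn_of_hasOnlyValue (w := w) h.arityOK
      (M.low_defines.arity h.arityOK) (.cons (h0 i) (.cons (h1 i) (.cons hu2 .nil)))
    have key' := fun w => eval_apps_fn_of_hasOnlyValue (w := w) h.arityOK
      (M.bit_defines.arity h.arityOK) (.cons (h0 i) (.cons (h1 i) (.cons (h2 i) .nil)))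
    have ht := eval_bit hF hi true
    have hf := eval_bit hF hi false
    rw [hF.compl _ (by omega) hlt] at hf
    simp only [ofBool, if_true, Bool.false_eq_true, if_false] at ht hf
    simp only [M.low_defines.eval_call h.arityOK (vs := [encode cs, F, i]) rfl, lowBody,
      h.eval_ite_zero hi (h0 i) (h2 i), eval_ite, key, key', eval_con, ih1, ih2, ht, hf, hk]
    simp only [Nat.add_eq_zero_iff, one_ne_zero, and_false, false_or,
      Nat.zero_lt_succ, true_and, Expr.con.injEq, reduceCtorEq, and_true]
    constructor
    · constructor
      · rintro ⟨hb, hl⟩ j hj hj'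
        rcases Nat.le_succ_iff.1 hj' with hj' | rfl
        exacts [hl j hj hj', hb]
      · exact fun hl => ⟨hl _ (by omega) le_rfl, fun j hj hj' => hl j hj (by omega)⟩
    · constructor
      · rintro (hb | ⟨-, j, hj, hj', hb⟩)
        exacts [⟨k + 1, by omega, le_rfl, hb⟩, ⟨j, hj, by omega, hb⟩]
      · rintro ⟨j, hj, hj', hb⟩
        by_cases hb' : M.Hit cs.length F true (k + 1)
        · exact .inl hb'
        · rcases Nat.le_succ_iff.1 hj' with hj' | rfl
          exacts [.inr ⟨hb', j, hj, hj', hb⟩, absurd hb hb']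

/-- The bits of the predecessor. -/
theorem eval_pick {i w : Expr} (hF : M.IsBits cs.length F) (hi : i ∈ M.vals cs.length)
    (hpos : 0 < M.interp cs.length i) (hlt : M.interp cs.length i < P cs.length) (b : Bool) :
    Eval M.expProg (.call M.pickSym [encode cs, F, ofBool b, i]) w ↔ w = i ∧
      (((∀ j, 0 < j → j < M.interp cs.length i → ¬ M.Hit cs.length F true j) ∧
        M.Hit cs.length F (!b) (M.interp cs.length i)) ∨
      ((∃ j, 0 < j ∧ j < M.interp cs.length i ∧ M.Hit cs.length F true j) ∧
        M.Hit cs.length F b (M.interp cs.length i))) := by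
  have h := M.exp_extension
  have h0 : HasOnlyValue M.expProg (fun k => [encode cs, F, ofBool b, i][k]?) (.var 0)
    (encode cs) := hasOnlyValue_var rfl
  have h1 : HasOnlyValue M.expProg (fun k => [encode cs, F, ofBool b, i][k]?) (.var 1) F :=
    hasOnlyValue_var rfl
  have h2 : HasOnlyValue M.expProg (fun k => [encode cs, F, ofBool b, i][k]?) (.var 2)
    (ofBool b) := hasOnlyValue_var rfl
  have h3 : HasOnlyValue M.expProg (fun k => [encode cs, F, ofBool b, i][k]?) (.var 3) i :=
    hasOnlyValue_var rfl
  have h4 : HasOnlyValue M.expProg (fun k => [encode cs, F, ofBool b, i][k]?)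
      (.ite (.var 2) (.con .ff) (.con .tt)) (ofBool !b) := fun w => by
    rw [eval_ite, h2, h2, eval_con, eval_con]
    cases b <;> simp [ofBool]
  obtain ⟨u, hu, hu1, hu2⟩ := h.pred_value hi hpos h0 h3
  have key := fun w => eval_apps_fn_of_hasOnlyValue (w := w) h.arityOK
    (M.low_defines.arity h.arityOK) (.cons h0 (.cons h1 (.cons hu2 .nil)))
  obtain ⟨hl1, hl2⟩ := eval_low hF hu (by omega)
  have hle : ∀ j, j ≤ M.interp cs.length i - 1 ↔ j < M.interp cs.length i := fun _ =>
    Nat.le_sub_one_iff_lt hpos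
  rw [M.pick_defines.eval_call h.arityOK rfl, pickBody, eval_ite, key, key, hl1, hl2, hu1,
    eval_ite_hit h0 h3 hi rfl h4 hF (by simp), eval_ite_hit h0 h3 hi rfl h2 hF (by simp), h3]
  simp only [hle]
  tauto

/-- The functions `seed`, `pred` and `zero` of the exponential module in terms of the auxiliary
functions.  The number `s` is the largest one of the given module. -/
theorem eval_seedSym (cs : List Bool) : ∃ s ∈ M.vals cs.length,
    M.interp cs.length s = P cs.length - 1 ∧
    (∀ b w, Applies M.expProg ((Expr.fn M.seedSym).apps [encode cs]) (ofBool b) w ↔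
      b = true ∧ Eval M.expProg (.call M.anySym [encode cs, s]) w) ∧
    (∀ F b w, Applies M.expProg ((Expr.fn M.predSym).apps [encode cs, F]) (ofBool b) w ↔
      ∃ i, Eval M.expProg (.call M.anySym [encode cs, s]) i ∧
        Eval M.expProg (.call M.pickSym [encode cs, F, ofBool b, i]) w) ∧
    ∀ F w, Eval M.expProg (.call M.zeroSym [encode cs, F]) w ↔
      Eval M.expProg (.call M.lowSym [encode cs, F, s]) w := by
  have h := M.exp_extension
  obtain ⟨s, hs, hs1, hs2, hs3⟩ := h.exists_seed cs
  -- The value of `seed cs` does not depend on the environment.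
  have hs4 : ∀ {γ : Env}, γ 0 = some (encode cs) →
      HasOnlyValue M.expProg γ ((Expr.fn M.seed).apps [.var 0]) s := fun hγ w => by
    rw [eval_apps_fn₁ h.arityOK hs2]
    simp [hasOnlyValue_var hγ _, hs3]
  refine ⟨s, hs, hs1, fun b w => ?_, fun F b w => ?_, fun F w => ?_⟩
  · rw [applies_closure, M.seed_defines.eval_call h.arityOK rfl, seedBody, eval_ite,
      hasOnlyValue_var (v := ofBool b) rfl, hasOnlyValue_var (v := ofBool b) rfl,
      eval_apps_fn_of_hasOnlyValue h.arityOK (M.any_defines.arity h.arityOK)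
        (.cons (hasOnlyValue_var rfl) (.cons (hs4 rfl) .nil))]
    cases b <;> simp [ofBool, M.eval_fail]
  · rw [applies_closure, M.pred_defines.eval_call h.arityOK rfl, predBody,
      eval_apps_fn₄ h.arityOK (M.pick_defines.arity h.arityOK).ge]
    have key := fun w => eval_apps_fn_of_hasOnlyValue (w := w) h.arityOK
      (M.any_defines.arity h.arityOK)
      (.cons (hasOnlyValue_var (γ := fun i => [encode cs, F, ofBool b][i]?) (x := 0) rfl)
        (.cons (hs4 rfl) .nil))
    simp [eval_var, key]
  · rw [M.zero_defines.eval_call h.arityOK rfl, zeroBody,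
      eval_apps_fn_of_hasOnlyValue h.arityOK (M.low_defines.arity h.arityOK)
        (.cons (hasOnlyValue_var rfl) (.cons (hasOnlyValue_var rfl) (.cons (hs4 rfl) .nil)))]

theorem hit_seed (cs : List Bool) {b : Bool} {i : ℕ} (hpos : 0 < i) (hlt : i < P cs.length) :
    M.Hit cs.length ((Expr.fn M.seedSym).apps [encode cs]) b i ↔ b = true := by
  obtain ⟨s, hs, hs1, hs2, -⟩ := M.eval_seedSym cs
  simp only [Hit, hs2]
  refine ⟨fun ⟨w, hw, _⟩ => hw.1, fun hb => ?_⟩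
  obtain ⟨w, -, hw, hw'⟩ := (M.exp_extension.eval_any M.any_defines
    (M.exp_not_root (by simp)) hs).2 i hpos (by omega)
  exact ⟨w, ⟨hb, hw'⟩, hw⟩

theorem isBits_seed (cs : List Bool) :
    M.IsBits cs.length ((Expr.fn M.seedSym).apps [encode cs]) := by
  obtain ⟨s, hs, hs1, hs2, -⟩ := M.eval_seedSym cs
  refine ⟨fun b w hw => ?_, fun i hpos hlt => ?_⟩
  · exact ((M.exp_extension.eval_any M.any_defines (M.exp_not_root (by simp)) hs).1 w
      ((hs2 b w).1 hw).2).1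
  · simp [hit_seed cs hpos hlt]

theorem hit_pred (hF : M.IsBits cs.length F) {b : Bool} {i : ℕ} (hpos : 0 < i)
    (hlt : i < P cs.length) :
    M.Hit cs.length ((Expr.fn M.predSym).apps [encode cs, F]) b i ↔
      (((∀ j, 0 < j → j < i → ¬ M.Hit cs.length F true j) ∧ M.Hit cs.length F (!b) i) ∨
      ((∃ j, 0 < j ∧ j < i ∧ M.Hit cs.length F true j) ∧ M.Hit cs.length F b i)) := by
  obtain ⟨s, hs, hs1, -, hs2, -⟩ := M.eval_seedSym cs
  obtain ⟨ha, ha'⟩ := M.exp_extension.eval_any M.any_defines (M.exp_not_root (by simp)) hs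
  rw [Hit]
  simp only [hs2]
  constructor
  · rintro ⟨w, ⟨i', hi, hw⟩, rfl⟩
    obtain ⟨h1, h2, h3⟩ := ha i' hi
    obtain ⟨rfl, hw⟩ := (eval_pick hF h1 h2 (by omega) b).1 hw
    exact hw
  · intro hw
    obtain ⟨w, h1, rfl, h2⟩ := ha' i hpos (by omega)
    exact ⟨w, ⟨w, h2, (eval_pick hF h1 hpos hlt b).2 ⟨rfl, hw⟩⟩, rfl⟩

theorem isBits_pred (hP : 0 < P cs.length) (hF : M.IsBits cs.length F) :
    M.IsBits cs.length ((Expr.fn M.predSym).apps [encode cs, F]) := by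
  obtain ⟨s, hs, hs1, -, hs2, -⟩ := M.eval_seedSym cs
  obtain ⟨ha, -⟩ := M.exp_extension.eval_any M.any_defines (M.exp_not_root (by simp)) hs
  refine ⟨fun b w hw => ?_, fun i hpos hlt => ?_⟩
  · obtain ⟨i, hi, hw⟩ := (hs2 F b w).1 hw
    obtain ⟨h1, h2, h3⟩ := ha i hi
    rw [((eval_pick hF h1 h2 (by omega) b).1 hw).1]
    exact h1
  · rw [hit_pred hF hpos hlt, hit_pred hF hpos hlt]
    have := hF.compl i hpos hlt
    have h1 : (∃ j, 0 < j ∧ j < i ∧ M.Hit cs.length F true j) ↔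
        ¬ ∀ j, 0 < j → j < i → ¬ M.Hit cs.length F true j := by
      push Not
      rfl
    simp only [Bool.not_false, Bool.not_true, h1]
    tauto

variable (M)

open Classical in
/-- The number with the binary digits that `F` determines; the digit of `2 ^ i` has index
`i + 1`. -/
noncomputable def expInterp (n : ℕ) (F : Expr) : ℕ :=
  ∑ i ∈ Finset.range (P n - 1), if M.Hit n F true (i + 1) then 2 ^ i else 0

variable {M}

theorem expInterp_seed (cs : List Bool) :
    M.expInterp cs.length ((Expr.fn M.seedSym).apps [encode cs]) =
      2 ^ (P cs.length - 1) - 1 := by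
  rw [expInterp, Finset.sum_congr rfl (g := fun i => 2 ^ i), Nat.geomSum_eq le_rfl]
  · simp
  · intro i hi
    rw [Finset.mem_range] at hi
    rw [if_pos ((hit_seed cs (by omega) (by omega)).2 rfl)]

theorem expInterp_pos_iff {n : ℕ} :
    0 < M.expInterp n F ↔ ∃ j, 0 < j ∧ j < P n ∧ M.Hit n F true j := by
  classical
  rw [expInterp, sum_two_pow_pos_iff]
  constructor
  · rintro ⟨i, hi, h⟩
    exact ⟨i + 1, by omega, by omega, h⟩
  · rintro ⟨j, h0, h1, h⟩
    exact ⟨j - 1, by omega, by rwa [Nat.sub_add_cancel h0]⟩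

theorem expInterp_pred (hF : M.IsBits cs.length F) (hpos : 0 < M.expInterp cs.length F) :
    M.expInterp cs.length ((Expr.fn M.predSym).apps [encode cs, F]) =
      M.expInterp cs.length F - 1 := by
  classical
  have hsum := sum_two_pow_pred (b := fun i => M.Hit cs.length F true (i + 1))
    (b' := fun i => M.Hit cs.length ((Expr.fn M.predSym).apps [encode cs, F]) true (i + 1))
    (m := P cs.length - 1) fun i hi => by
      rw [hit_pred hF (by omega) (by omega), Bool.not_true, hF.compl _ (by omega) (by omega)]
      refine or_congr (and_congr_left fun _ => ?_) (and_congr_left fun _ => ?_)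
      · refine ⟨fun h j hj => h _ (by omega) (by omega), fun h j h0 h1 => ?_⟩
        have := h (j - 1) (by omega)
        rwa [Nat.sub_add_cancel h0] at this
      · refine ⟨fun ⟨j, h0, h1, h⟩ => ⟨j - 1, by omega, ?_⟩,
          fun ⟨j, hj, h⟩ => ⟨j + 1, by omega, by omega, h⟩⟩
        rwa [Nat.sub_add_cancel h0]
  rw [if_neg, add_zero] at hsum
  · simp only [expInterp]
    omega
  · intro h
    obtain ⟨j, h0, h1, hj⟩ := expInterp_pos_iff.1 hpos
    refine h (j - 1) (by omega) ?_
    rwa [Nat.sub_add_cancel h0]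

theorem eval_zeroSym (hP : 0 < P cs.length) (hF : M.IsBits cs.length F) :
    (Eval M.expProg (.call M.zeroSym [encode cs, F]) (.con .tt) ↔
      M.expInterp cs.length F = 0) ∧
    (Eval M.expProg (.call M.zeroSym [encode cs, F]) (.con .ff) ↔
      0 < M.expInterp cs.length F) := by
  obtain ⟨s, hs, hs1, -, -, hs2⟩ := M.eval_seedSym cs
  obtain ⟨h1, h2⟩ := eval_low hF hs (by omega)
  have hle : ∀ j, j ≤ P cs.length - 1 ↔ j < P cs.length := fun _ => Nat.le_sub_one_iff_lt hP
  rw [hs2, hs2, h1, h2, hs1, ← Nat.le_zero (i := M.expInterp cs.length F), ← not_lt,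
    expInterp_pos_iff]
  simp only [hle]
  refine ⟨?_, trivial⟩
  push Not
  rfl

/-! ### The exponential module -/

theorem expSig_valid : M.expSig.Valid := M.extendSig_valid _

theorem expSig_fresh {i : ℕ} : M.expSig.fn (M.fresh + i) = M.expTypes i :=
  M.extendSig_fresh _ i

theorem expSig_seed : M.expSig.fn M.seed = .arrow .list M.ty :=
  (M.extendSig_old _ M.seed_mem).trans M.seed_type

theorem expSig_pred : M.expSig.fn M.pred = .arrow .list (.arrow M.ty M.ty) :=
  (M.extendSig_old _ M.pred_mem).trans M.pred_type

theorem expSig_zero : M.expSig.fn M.zero = .arrow .list (.arrow M.ty .bool) :=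
  (M.extendSig_old _ M.zero_mem).trans M.zero_type

theorem good_anyBody {F : Signature} {any bot : ℕ}
    (hpred : F.fn M.pred = .arrow .list (.arrow M.ty M.ty))
    (hzero : F.fn M.zero = .arrow .list (.arrow M.ty .bool))
    (hany : F.fn any = .arrow .list (.arrow M.ty M.ty)) (hbot : F.fn bot = M.ty) :
    GoodRhs F (tyEnv [.list, M.ty]) 2 (M.anyBody any bot) M.ty := by
  refine .ite (.call₂ hzero (.var (by simp) rfl) (.var (by simp) rfl)) (.fn hbot)
    (.chooseList (.var (by simp) rfl) ?_)
  simp only [List.mem_singleton, forall_eq]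
  exact .call₂ hany (.var (by simp) rfl)
    (.call₂ hpred (.var (by simp) rfl) (.var (by simp) rfl))

theorem expClauses_good (hK : K ≤ 1) : ∀ c ∈ M.expClauses, c.Good M.expSig 1 := by
  have hty : M.ty.order ≤ 1 := M.order_ty_le.trans hK
  have hF := M.expSig_valid
  have hv {Γ : ℕ → Ty} {k : ℕ} {x : ℕ} (hx : x < k) : GoodRhs M.expSig Γ k (.var x) (Γ x) :=
    .var hx rfl
  simp only [expClauses, List.forall_mem_cons, List.not_mem_nil, false_imp_iff, implies_true,
    and_true]
  refine ⟨?_, ?_, ?_, ?_, ?_, ?_, ?_, ?_⟩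
  · refine varClause_good [.list, M.ty, M.ty] .bool expSig_fresh (by simp [Ty.order, hty]) ?_
    have h0 := hv (Γ := tyEnv [.list, M.ty, M.ty]) (k := 3) (x := 0) (by simp)
    have h1 := hv (Γ := tyEnv [.list, M.ty, M.ty]) (k := 3) (x := 1) (by simp)
    have h2 := hv (Γ := tyEnv [.list, M.ty, M.ty]) (k := 3) (x := 2) (by simp)
    exact .ite (.call₂ expSig_zero h0 h1) (.call₂ expSig_zero h0 h2)
      (.ite (.call₂ expSig_zero h0 h2) (.ff hF)
        (.call₃ expSig_fresh h0 (.call₂ expSig_pred h0 h1) (.call₂ expSig_pred h0 h2)))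
  · exact varClause_good [.list, M.ty] M.ty expSig_fresh (by simp [Ty.order, hty])
      (good_anyBody expSig_pred expSig_zero expSig_fresh expSig_fresh)
  · refine varClause_good [.list, .arrow .bool M.ty, M.ty] .bool expSig_fresh
      (by simp [Ty.order, hty]) ?_
    have h0 := hv (Γ := tyEnv [.list, .arrow .bool M.ty, M.ty]) (k := 3) (x := 0) (by simp)
    have h1 := hv (Γ := tyEnv [.list, .arrow .bool M.ty, M.ty]) (k := 3) (x := 1) (by simp)
    have h2 := hv (Γ := tyEnv [.list, .arrow .bool M.ty, M.ty]) (k := 3) (x := 2) (by simp)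
    refine .chooseList (.ite (.call₃ expSig_fresh h0 h2 (.app (by simp [hd]) h1 (.tt hF)))
      (.tt hF) (.fn expSig_fresh)) ?_
    simp only [List.mem_singleton, forall_eq]
    exact .ite (.call₃ expSig_fresh h0 h2 (.app (by simp [hd]) h1 (.ff hF)))
      (.ff hF) (.fn expSig_fresh)
  · refine varClause_good [.list, .arrow .bool M.ty, M.ty] .bool expSig_fresh
      (by simp [Ty.order, hty]) ?_
    have h0 := hv (Γ := tyEnv [.list, .arrow .bool M.ty, M.ty]) (k := 3) (x := 0) (by simp)
    have h1 := hv (Γ := tyEnv [.list, .arrow .bool M.ty, M.ty]) (k := 3) (x := 1) (by simp)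
    have h2 := hv (Γ := tyEnv [.list, .arrow .bool M.ty, M.ty]) (k := 3) (x := 2) (by simp)
    exact .ite (.call₂ expSig_zero h0 h2) (.tt hF) (.ite (.call₃ expSig_fresh h0 h1 h2) (.ff hF)
      (.call₃ expSig_fresh h0 h1 (.call₂ expSig_pred h0 h2)))
  · refine varClause_good [.list, .arrow .bool M.ty, .bool, M.ty] M.ty expSig_fresh
      (by simp [Ty.order, hty]) ?_
    have h0 := hv (Γ := tyEnv [.list, .arrow .bool M.ty, .bool, M.ty]) (k := 4) (x := 0) (by simp)
    have h1 := hv (Γ := tyEnv [.list, .arrow .bool M.ty, .bool, M.ty]) (k := 4) (x := 1) (by simp)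
    have h2 := hv (Γ := tyEnv [.list, .arrow .bool M.ty, .bool, M.ty]) (k := 4) (x := 2) (by simp)
    have h3 := hv (Γ := tyEnv [.list, .arrow .bool M.ty, .bool, M.ty]) (k := 4) (x := 3) (by simp)
    exact .ite (.call₃ expSig_fresh h0 h1 (.call₂ expSig_pred h0 h3))
      (.ite (.call₃ expSig_fresh h0 h3 (.app (by simp [hd]) h1 (.ite h2 (.ff hF) (.tt hF)))) h3
        (.fn expSig_fresh))
      (.ite (.call₃ expSig_fresh h0 h3 (.app (by simp [hd]) h1 h2)) h3 (.fn expSig_fresh))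
  · refine varClause_good [.list, .bool] M.ty expSig_fresh (by simp [Ty.order]) ?_
    have h0 := hv (Γ := tyEnv [.list, .bool]) (k := 2) (x := 0) (by simp)
    have h1 := hv (Γ := tyEnv [.list, .bool]) (k := 2) (x := 1) (by simp)
    exact .ite h1 (.call₂ expSig_fresh h0 (.call₁ expSig_seed h0)) (.fn expSig_fresh)
  · refine varClause_good [.list, .arrow .bool M.ty, .bool] M.ty expSig_fresh
      (by simp [Ty.order, hty]) ?_
    have h0 := hv (Γ := tyEnv [.list, .arrow .bool M.ty, .bool]) (k := 3) (x := 0) (by simp)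
    have h1 := hv (Γ := tyEnv [.list, .arrow .bool M.ty, .bool]) (k := 3) (x := 1) (by simp)
    have h2 := hv (Γ := tyEnv [.list, .arrow .bool M.ty, .bool]) (k := 3) (x := 2) (by simp)
    exact .call₄ expSig_fresh h0 h1 h2 (.call₂ expSig_fresh h0 (.call₁ expSig_seed h0))
  · refine varClause_good [.list, .arrow .bool M.ty] .bool expSig_fresh
      (by simp [Ty.order, hty]) ?_
    have h0 := hv (Γ := tyEnv [.list, .arrow .bool M.ty]) (k := 2) (x := 0) (by simp)
    have h1 := hv (Γ := tyEnv [.list, .arrow .bool M.ty]) (k := 2) (x := 1) (by simp)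
    exact .call₃ expSig_fresh h0 h1 (.call₁ expSig_seed h0)

variable (M)

/-- The symbols of the exponential module. -/
def expSyms : Finset ℕ := M.syms ∪ Finset.Icc M.fresh (M.fresh + 10)

variable {M}

theorem mem_expSyms {f : ℕ} :
    f ∈ M.expSyms ↔ f ∈ M.syms ∨ (M.fresh ≤ f ∧ f ≤ M.fresh + 10) := by
  simp [expSyms]

theorem add_mem_expSyms {i : ℕ} (hi : i ≤ 10) : M.fresh + i ∈ M.expSyms :=
  mem_expSyms.2 (by omega)

theorem expProg_fns : ∀ c ∈ M.expProg,
    c.lhs.fns ⊆ (M.expSyms : Set ℕ) ∧ c.rhs.fns ⊆ (M.expSyms : Set ℕ) := by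
  intro c hc
  rcases List.mem_append.1 hc with hc | hc
  · have hroot := M.expClauses_fresh hc
    constructor
    · obtain ⟨k, hk⟩ : ∃ k, c.pats = (List.range k).map .var := by
        simp only [expClauses, List.mem_cons, List.not_mem_nil, or_false] at hc
        rcases hc with rfl | rfl | rfl | rfl | rfl | rfl | rfl | rfl <;> exact ⟨_, rfl⟩
      intro f hf
      rw [Clause.lhs, hk, mem_fns_apps] at hf
      simp only [fns, Set.mem_singleton_iff, List.mem_map, exists_exists_and_eq_and,
        Set.mem_empty_iff_false, and_false, exists_false, or_false] at hf
      rw [Finset.mem_coe, mem_expSyms]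
      omega
    · intro f hf
      have h1 := M.seed_mem
      have h2 := M.pred_mem
      have h3 := M.zero_mem
      rw [Finset.mem_coe, mem_expSyms]
      simp only [expClauses, List.mem_cons, List.not_mem_nil, or_false] at hc
      rcases hc with rfl | rfl | rfl | rfl | rfl | rfl | rfl | rfl <;>
      · simp only [varClause, eqBody, anyBody, bitBody, lowBody, pickBody, seedBody, predBody,
          zeroBody, eqSym, anySym, bitSym, lowSym, pickSym, seedSym, predSym, zeroSym, failSym,
          failBoolSym, fns, mem_fns_chooseList, mem_fns_apps, List.mem_cons, List.not_mem_nil,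
          or_false, Set.mem_union, Set.mem_singleton_iff, exists_eq_or_imp, exists_eq_left,
          Set.mem_empty_iff_false, false_or] at hf
        repeat' rcases hf with hf | hf
        all_goals first
          | exact .inl ‹_›
          | (right; omega)
  · exact ⟨fun f hf => mem_expSyms.2 (.inl ((M.prog_syms c hc).1 hf)),
      fun f hf => mem_expSyms.2 (.inl ((M.prog_syms c hc).2 hf))⟩

variable (M)

/-- The functional values that represent numbers below `2 ^ (P n - 1)`. -/
def expVals (n : ℕ) : Set Expr :=
  {v | (IsValue M.expProg v ∧ FullyApplied M.expSig v ∧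
    (∀ Γ, HasType M.expSig Γ v (.arrow .bool M.ty)) ∧ v.fns ⊆ (M.expSyms : Set ℕ)) ∧
    M.IsBits n v}

variable {M}

theorem seed_mem_expVals (cs : List Bool) :
    (Expr.fn M.seedSym).apps [encode cs] ∈ M.expVals cs.length := by
  have hF := M.expSig_valid
  refine ⟨⟨?_, ?_, fun Γ => ?_, fun f hf => ?_⟩, isBits_seed cs⟩
  · refine .closure _ _ ?_ ?_
    · simpa using IsValue.data _ (isData_encode cs)
    · rw [M.seed_defines.arity M.exp_extension.arityOK]
      simp
  · exact (Plain.apps (by simp [hd]) (plain_fn _)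
      (by simpa using plain_encode hF cs)).fullyApplied
  · exact (GoodRhs.call₁ (k := 0) expSig_fresh (.encode hF cs)).typed
  · simp only [mem_fns_apps, fns, Set.mem_singleton_iff, List.mem_singleton, exists_eq_left,
      fns_encode, Set.mem_empty_iff_false, or_false] at hf
    exact hf ▸ add_mem_expSyms (by simp)

theorem pred_mem_expVals (hP : 0 < P cs.length) (hF : F ∈ M.expVals cs.length) :
    (Expr.fn M.predSym).apps [encode cs, F] ∈ M.expVals cs.length := by
  have hval := M.expSig_valid
  obtain ⟨⟨h1, h2, h3, h4⟩, h5⟩ := hF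
  refine ⟨⟨?_, ?_, fun Γ => ?_, fun f hf => ?_⟩, isBits_pred hP h5⟩
  · refine .closure _ _ ?_ ?_
    · simpa using ⟨IsValue.data _ (isData_encode cs), h1⟩
    · rw [M.pred_defines.arity M.exp_extension.arityOK]
      simp
  · exact fullyApplied_apps _ (by simpa using ⟨(plain_encode hval cs).fullyApplied, h2⟩)
  · have h : M.expSig.fn M.predSym = .arrows [.list, .arrow .bool M.ty] (.arrow .bool M.ty) :=
      expSig_fresh
    exact hasType_apps (hasType_fn h)
      (.cons (GoodRhs.encode (k := 0) hval cs).typed (.cons (h3 Γ) .nil))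
  · simp only [mem_fns_apps, fns, Set.mem_singleton_iff, List.mem_cons, List.not_mem_nil,
      or_false, exists_eq_or_imp, exists_eq_left,
      fns_encode, Set.mem_empty_iff_false, false_or] at hf
    rcases hf with hf | hf
    · exact hf ▸ add_mem_expSyms (by simp)
    · exact h4 hf

end CountingModule

/-- A `P`-counting module gives a counting module for `2 ^ (P n - 1)` of data order `1`. -/
noncomputable def CountingModule.exp {P : ℕ → ℕ} (hP : ∀ n, 0 < P n) {K : ℕ} (hK : K ≤ 1)
    (M : CountingModule P K) : CountingModule (fun n => 2 ^ (P n - 1)) 1 where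
  ty := .arrow .bool M.ty
  syms := M.expSyms
  seed := M.seedSym
  pred := M.predSym
  zero := M.zeroSym
  vals := M.expVals
  interp := M.expInterp
  prog := M.expProg
  sig := M.expSig
  seed_mem := add_mem_expSyms (by simp)
  pred_mem := add_mem_expSyms (by simp)
  zero_mem := add_mem_expSyms (by simp)
  seed_type := expSig_fresh
  pred_type := expSig_fresh
  zero_type := expSig_fresh
  wellFormed := (M.wellFormed_append hK (expClauses_good hK) M.exp_arities).1
  consFree := (M.wellFormed_append hK (expClauses_good hK) M.exp_arities).2
  prog_syms := expProg_fns
  vals_value n v hv := hv.1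
  seed_unique cs := by
    have := M.seed_defines.arity M.exp_extension.arityOK
    refine ⟨_, (eval_call_partial M.exp_extension.arityOK (by simp [this])).2 rfl, fun w hw => ?_⟩
    exact (eval_call_partial M.exp_extension.arityOK (by simp [this])).1 hw
  seed_eval cs v hv := by
    have := M.seed_defines.arity M.exp_extension.arityOK
    rw [eval_call_partial M.exp_extension.arityOK (by simp [this])] at hv
    subst hv
    exact ⟨seed_mem_expVals cs, expInterp_seed cs⟩
  pred_unique cs v _ _ := by
    have := M.pred_defines.arity M.exp_extension.arityOK
    refine ⟨_, (eval_call_partial M.exp_extension.arityOK (by simp [this])).2 rfl, fun w hw => ?_⟩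
    exact (eval_call_partial M.exp_extension.arityOK (by simp [this])).1 hw
  pred_eval cs v hv hpos w hw := by
    have := M.pred_defines.arity M.exp_extension.arityOK
    rw [eval_call_partial M.exp_extension.arityOK (by simp [this])] at hw
    subst hw
    exact ⟨pred_mem_expVals (hP _) hv, expInterp_pred hv.2 hpos⟩
  zero_true cs v hv := (eval_zeroSym (hP _) hv.2).1
  zero_false cs v hv := (eval_zeroSym (hP _) hv.2).2

/-! ### Clauses with constructor patterns -/

/-- `f [] = s`. -/
def nilClause (f : ℕ) (s : Expr) : Clause := ⟨f, [.con .nil], s⟩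

/-- `f (x₀ :: x₁) = s`. -/
def consClause (f : ℕ) (s : Expr) : Clause := ⟨f, [(Expr.con .cons).apps [.var 0, .var 1]], s⟩

/-- `f (x₀, x₁) = s`. -/
def pairClause (f : ℕ) (s : Expr) : Clause := ⟨f, [.pair (.var 0) (.var 1)], s⟩

theorem nilClause_good {F : Signature} (hF : F.Valid) {K f : ℕ} {s : Expr} {τ : Ty}
    (hf : F.fn f = .arrow .list τ) (hs : GoodRhs F (tyEnv []) 0 s τ) :
    (nilClause f s).Good F K := by
  refine good_of_plain ⟨?_, ?_, fun x hx => ?_, tyEnv [], τ, ?_, ?_, hs.typed⟩ ?_ hs.plain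
  · simp only [nilClause, List.mem_singleton, forall_eq]
    exact .con .nil [] (by simp)
  · simp [nilClause, Clause.lhs, apps_cons, apps_nil, varList]
  · exact absurd (hs.vars x hx) (by simp)
  · simp [nilClause, Clause.lhs, apps_cons, apps_nil, varList]
  · exact .app _ _ _ _ (hasType_fn hf) (hasType_con hF.nil)
  · simpa [nilClause] using (plain_con (by simp [hF.nil, Ty.arity])).fullyApplied

theorem consClause_good {F : Signature} (hF : F.Valid) {K f : ℕ} {s : Expr} {τ : Ty}
    (hf : F.fn f = .arrow .list τ) (hs : GoodRhs F (tyEnv [.bool, .list]) 2 s τ) :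
    (consClause f s).Good F K := by
  have hv : (consClause f s).lhs.varList = [0, 1] := by
    simp [consClause, Clause.lhs, apps_cons, apps_nil, varList]
  refine good_of_plain ⟨?_, ?_, fun x hx => ?_, tyEnv [.bool, .list], τ, ?_, ?_, hs.typed⟩ ?_
    hs.plain
  · simp only [consClause, List.mem_singleton, forall_eq]
    refine .con _ _ fun l hl => ?_
    simp only [List.mem_cons, List.not_mem_nil, or_false] at hl
    rcases hl with rfl | rfl <;> exact .var _
  · simp [hv]
  · have := hs.vars x hx
    rw [hv]
    interval_cases x <;> simp
  · simp [hv, tyEnv, Ty.order]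
  · exact .app _ _ _ _ (hasType_fn hf) (.app _ _ _ _ (.app _ _ _ _ (hasType_con hF.cons) (.var 0))
      (.var 1))
  · simp only [consClause, List.mem_singleton, forall_eq]
    rintro c ts (h | (h | h) | h)
    · obtain ⟨rfl, rfl⟩ := apps_con_inj h
      simp [hF.cons, Ty.arity]
    · exact h.elim
    · exact (plain_var 0 c ts h).1
    · exact (plain_var 1 c ts h).1

theorem pairClause_good {F : Signature} {K f : ℕ} {s : Expr} {σ σ' τ : Ty}
    (hf : F.fn f = .arrow (.prod σ σ') τ) (hσ : σ.order ≤ K) (hσ' : σ'.order ≤ K)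
    (hs : GoodRhs F (tyEnv [σ, σ']) 2 s τ) : (pairClause f s).Good F K := by
  have hv : (pairClause f s).lhs.varList = [0, 1] := by
    simp [pairClause, Clause.lhs, apps_cons, apps_nil, varList]
  refine good_of_plain ⟨?_, ?_, fun x hx => ?_, tyEnv [σ, σ'], τ, ?_, ?_, hs.typed⟩ ?_ hs.plain
  · simp only [pairClause, List.mem_singleton, forall_eq]
    exact .pair _ _ (.var 0) (.var 1)
  · simp [hv]
  · have := hs.vars x hx
    rw [hv]
    interval_cases x <;> simp
  · simp [hv, tyEnv, hσ, hσ']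
  · exact .app _ _ _ _ (hasType_fn hf) (.pair _ _ _ _ (.var 0) (.var 1))
  · simpa [pairClause] using ((plain_var 0).pair (plain_var 1)).fullyApplied

theorem nilClause_matches {γ : Env} {f g : ℕ} {s v : Expr} :
    (nilClause f s).Matches γ g [v] ↔ f = g ∧ v = .con .nil ∧ γ = fun _ => none := by
  simp only [Clause.Matches, nilClause, Clause.lhs, apps_cons, apps_nil, varList, inst,
    List.append_nil, List.not_mem_nil, iff_false, List.map_cons, List.map_nil, List.cons.injEq,
    and_true, Bool.not_eq_true, Option.isSome_eq_false_iff, Option.isNone_iff_eq_none, funext_iff]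
  tauto

/-- The environment `[x₀ := v, x₁ := w]`. -/
abbrev env₂ (v w : Expr) : Env := fun i => [v, w][i]?

theorem isSome_env₂ {v w : Expr} {x : ℕ} : (env₂ v w x).isSome ↔ x ∈ [0, 1] := by
  rcases x with _ | _ | x <;> simp

theorem consClause_matches {f : ℕ} {s : Expr} {b : Bool} {bs : List Bool} :
    (consClause f s).Matches (env₂ (ofBool b) (encode bs)) f [encode (b :: bs)] := by
  refine ⟨rfl, fun x => ?_, rfl⟩
  rw [isSome_env₂]
  simp [consClause, Clause.lhs, apps_cons, apps_nil, varList]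

theorem not_consClause_matches {γ : Env} {f g : ℕ} {s : Expr} :
    ¬ (consClause f s).Matches γ g [encode []] := by
  rintro ⟨-, -, h⟩
  simp [consClause, apps_cons, apps_nil, inst, encode] at h

theorem pairClause_matches {f : ℕ} {s v w : Expr} :
    (pairClause f s).Matches (env₂ v w) f [.pair v w] := by
  refine ⟨rfl, fun x => ?_, rfl⟩
  rw [isSome_env₂]
  simp [pairClause, Clause.lhs, apps_cons, apps_nil, varList]

/-! ### List functions -/

/-- The program defines `isnil` and `tail` as the symbols `e` and `d`. -/
structure Program.DefinesList (p : Program) (e d : ℕ) : Prop where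
  mem : ∀ c ∈ [nilClause e (.con .tt), consClause e (.con .ff), nilClause d (.con .nil),
    consClause d (.var 1)], c ∈ p
  empty : ∀ c ∈ p, c.root = e → c ∈ [nilClause e (.con .tt), consClause e (.con .ff)]
  tail : ∀ c ∈ p, c.root = d → c ∈ [nilClause d (.con .nil), consClause d (.var 1)]

section
variable {p : Program}

theorem eval_call_nil (hp : p.ArityOK) {f : ℕ} {s t w : Expr} (hs : nilClause f s ∈ p)
    (hu : ∀ c ∈ p, c.root = f → c ∈ [nilClause f s, consClause f t]) :
    Eval p (.call f [encode []]) w ↔ Eval p (.expr (fun _ => none) s) w := by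
  refine eval_call_of_matches hp hs (nilClause_matches.2 ⟨rfl, rfl, rfl⟩) fun c hc δ hδ => ?_
  have := hu c hc hδ.1
  simp only [List.mem_cons, List.not_mem_nil, or_false] at this
  rcases this with rfl | rfl
  · rfl
  · exact absurd hδ not_consClause_matches

theorem eval_call_cons (hp : p.ArityOK) {f : ℕ} {s t w : Expr} {b : Bool} {bs : List Bool}
    (ht : consClause f t ∈ p)
    (hu : ∀ c ∈ p, c.root = f → c ∈ [nilClause f s, consClause f t]) :
    Eval p (.call f [encode (b :: bs)]) w ↔
      Eval p (.expr (env₂ (ofBool b) (encode bs)) t) w := by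
  refine eval_call_of_matches hp ht consClause_matches fun c hc δ hδ => ?_
  have := hu c hc hδ.1
  simp only [List.mem_cons, List.not_mem_nil, or_false] at this
  rcases this with rfl | rfl
  · exact absurd (nilClause_matches.1 hδ).2.1 (by simp [encode, apps_cons, apps_nil])
  · rfl

variable (hp : p.ArityOK) {e d : ℕ} (h : p.DefinesList e d) {γ : Env} {s : Expr} {l : List Bool}
include hp h

theorem isEmpty_value (hs : HasOnlyValue p γ s (encode l)) :
    HasOnlyValue p γ ((Expr.fn e).apps [s]) (ofBool l.isEmpty) := by
  intro w
  have har : p.arity e = 1 := by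
    have := hp _ (h.mem (nilClause e (.con .tt)) (by simp))
    simpa [nilClause] using this.symm
  rw [eval_apps_fn_of_hasOnlyValue hp har (.cons hs .nil)]
  cases l with
  | nil => rw [eval_call_nil hp (h.mem _ (by simp)) h.empty, eval_con]; rfl
  | cons b bs => rw [eval_call_cons hp (h.mem _ (by simp)) h.empty, eval_con]; rfl

theorem tail_value (hs : HasOnlyValue p γ s (encode l)) :
    HasOnlyValue p γ ((Expr.fn d).apps [s]) (encode l.tail) := by
  intro w
  have har : p.arity d = 1 := by
    have := hp _ (h.mem (nilClause d (.con .nil)) (by simp))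
    simpa [nilClause] using this.symm
  rw [eval_apps_fn_of_hasOnlyValue hp har (.cons hs .nil)]
  cases l with
  | nil => rw [eval_call_nil hp (h.mem _ (by simp)) h.tail, eval_con]; rfl
  | cons b bs =>
    rw [eval_call_cons hp (h.mem _ (by simp)) h.tail]
    exact hasOnlyValue_var rfl w

end

/-! ### A counting module for `n + c + 1` -/

namespace BaseModule

/-- `isnil`, `tail`, `fst`, `snd`, `seed`, `pred` and `zero`, with numbers as pairs of lists: the
first component is a suffix of the input, the second one a suffix of a constant list of
length `c`. -/
def prog (c : ℕ) : Program :=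
  [nilClause 0 (.con .tt), consClause 0 (.con .ff), nilClause 1 (.con .nil),
    consClause 1 (.var 1), pairClause 2 (.var 0), pairClause 3 (.var 1),
    varClause 4 1 (.pair (.var 0) (encode (List.replicate c true))),
    varClause 5 2 (.ite ((Expr.fn 0).apps [(Expr.fn 2).apps [.var 1]])
      (.pair ((Expr.fn 2).apps [.var 1]) ((Expr.fn 1).apps [(Expr.fn 3).apps [.var 1]]))
      (.pair ((Expr.fn 1).apps [(Expr.fn 2).apps [.var 1]]) ((Expr.fn 3).apps [.var 1]))),
    varClause 6 2 (.ite ((Expr.fn 0).apps [(Expr.fn 2).apps [.var 1]])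
      ((Expr.fn 0).apps [(Expr.fn 3).apps [.var 1]]) (.con .ff))]

/-- The type of numbers. -/
abbrev num : Ty := .prod .list .list

/-- The signature; the constructors without a role belong to the sort `bool`. -/
def sig : Signature where
  con
    | .tt => .bool
    | .ff => .bool
    | .nil => .list
    | .cons => .arrow .bool (.arrow .list .list)
    | .other _ => .bool
  fn
    | 0 => .arrow .list .bool
    | 1 => .arrow .list .list
    | 2 => .arrow num .list
    | 3 => .arrow num .list
    | 4 => .arrow .list num
    | 5 => .arrow .list (.arrow num num)
    | _ => .arrow .list (.arrow num .bool)

theorem sig_valid : sig.Valid := by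
  refine ⟨rfl, rfl, rfl, rfl, fun c => ?_⟩
  cases c <;> simp [sig, Ty.IsConstructorType, Ty.order]

theorem prog_good (c : ℕ) : ∀ d ∈ prog c, d.Good sig 0 := by
  have hF := sig_valid
  have h1 : GoodRhs sig (tyEnv [.list, num]) 2 (.var 1) num := .var (by simp) rfl
  have hfst : GoodRhs sig (tyEnv [.list, num]) 2 ((Expr.fn 2).apps [.var 1]) .list := .call₁ rfl h1
  have hsnd : GoodRhs sig (tyEnv [.list, num]) 2 ((Expr.fn 3).apps [.var 1]) .list := .call₁ rfl h1
  simp only [prog, List.forall_mem_cons, List.not_mem_nil, false_imp_iff, implies_true, and_true]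
  refine ⟨nilClause_good hF rfl (.tt hF), consClause_good hF rfl (.ff hF),
    nilClause_good hF rfl (.encode hF []), consClause_good hF rfl (.var (by simp) rfl),
    pairClause_good (σ := .list) (σ' := .list) rfl le_rfl le_rfl (.var (by simp) rfl),
    pairClause_good (σ := .list) (σ' := .list) rfl le_rfl le_rfl (.var (by simp) rfl),
    varClause_good [.list] num rfl (by simp [Ty.order])
      (.pair (.var (by simp) rfl) (.encode hF _)),
    varClause_good [.list, num] num rfl (by simp [Ty.order])
      (.ite (.call₁ rfl hfst) (.pair hfst (.call₁ rfl hsnd)) (.pair (.call₁ rfl hfst) hsnd)),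
    varClause_good [.list, num] .bool rfl (by simp [Ty.order])
      (.ite (.call₁ rfl hfst) (.call₁ rfl hsnd) (.ff hF))⟩

theorem arities (c : ℕ) : ∀ d ∈ prog c, ∀ d' ∈ prog c, d.root = d'.root →
    d.pats.length = d'.pats.length := by
  simp [prog, nilClause, consClause, pairClause, varClause]

theorem arityOK (c : ℕ) : (prog c).ArityOK := Program.arityOK_of (arities c)

theorem definesList (c : ℕ) : (prog c).DefinesList 0 1 := by
  constructor <;> simp [prog, nilClause, consClause, pairClause, varClause]

/-- The pair of lists of the given lengths. -/
def toExpr (l : List Bool × List Bool) : Expr := .pair (encode l.1) (encode l.2)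

theorem encode_injective : Function.Injective encode := by
  intro l l' h
  induction l generalizing l' with
  | nil => cases l' with
    | nil => rfl
    | cons b bs => simp [encode, apps_cons, apps_nil] at h
  | cons a as ih => cases l' with
    | nil => simp [encode, apps_cons, apps_nil] at h
    | cons b bs =>
      simp only [encode, apps_cons, apps_nil, Expr.app.injEq, true_and, Expr.con.injEq] at h
      rw [ih h.2]
      cases a <;> cases b <;> simp_all

theorem toExpr_injective : Function.Injective toExpr := by
  rintro ⟨a, b⟩ ⟨a', b'⟩ h
  simp only [toExpr, Expr.pair.injEq] at h
  rw [encode_injective h.1, encode_injective h.2]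

open Classical in
/-- The number that a pair of lists represents, and `0` for other expressions. -/
noncomputable def interp (v : Expr) : ℕ :=
  if h : ∃ l, toExpr l = v then h.choose.1.length + h.choose.2.length else 0

theorem interp_toExpr (l : List Bool × List Bool) :
    interp (toExpr l) = l.1.length + l.2.length := by
  have h : ∃ l', toExpr l' = toExpr l := ⟨l, rfl⟩
  rw [interp, dif_pos h, toExpr_injective h.choose_spec]

section
variable {c : ℕ} {γ : Env} {s : Expr} {l : List Bool × List Bool}

theorem fst_value (hs : HasOnlyValue (prog c) γ s (toExpr l)) :
    HasOnlyValue (prog c) γ ((Expr.fn 2).apps [s]) (encode l.1) := by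
  intro w
  rw [eval_apps_fn_of_hasOnlyValue (arityOK c) rfl (.cons hs .nil), toExpr,
    eval_call_of_matches (arityOK c) (c := pairClause 2 (.var 0)) (by simp [prog])
      pairClause_matches]
  · exact hasOnlyValue_var rfl w
  rintro d hd δ ⟨hδ, -⟩
  revert hδ
  revert d
  simp [prog, nilClause, consClause, pairClause, varClause]

theorem snd_value (hs : HasOnlyValue (prog c) γ s (toExpr l)) :
    HasOnlyValue (prog c) γ ((Expr.fn 3).apps [s]) (encode l.2) := by
  intro w
  rw [eval_apps_fn_of_hasOnlyValue (arityOK c) rfl (.cons hs .nil), toExpr,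
    eval_call_of_matches (arityOK c) (c := pairClause 3 (.var 1)) (by simp [prog])
      pairClause_matches]
  · exact hasOnlyValue_var rfl w
  rintro d hd δ ⟨hδ, -⟩
  revert hδ
  revert d
  simp [prog, nilClause, consClause, pairClause, varClause]

theorem eval_seed {cs : List Bool} {w : Expr} : Eval (prog c) (.call 4 [encode cs]) w ↔
    w = toExpr (cs, List.replicate c true) := by
  have h : (prog c).Defines 4 1 (.pair (.var 0) (encode (List.replicate c true))) := by
    constructor <;> simp [prog, nilClause, consClause, pairClause, varClause]
  rw [h.eval_call (arityOK c) rfl, eval_pair]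
  simp [eval_var, eval_encode, toExpr]

theorem eval_pred {cs : List Bool} {w : Expr} : Eval (prog c) (.call 5 [encode cs, toExpr l]) w ↔
    w = toExpr (if l.1.isEmpty then (l.1, l.2.tail) else (l.1.tail, l.2)) := by
  have h : (prog c).Defines 5 2 (.ite ((Expr.fn 0).apps [(Expr.fn 2).apps [.var 1]])
      (.pair ((Expr.fn 2).apps [.var 1]) ((Expr.fn 1).apps [(Expr.fn 3).apps [.var 1]]))
      (.pair ((Expr.fn 1).apps [(Expr.fn 2).apps [.var 1]]) ((Expr.fn 3).apps [.var 1]))) := by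
    constructor <;> simp [prog, nilClause, consClause, pairClause, varClause]
  have hp := arityOK c
  have hv : HasOnlyValue (prog c) (fun i => [encode cs, toExpr l][i]?) (.var 1) (toExpr l) :=
    hasOnlyValue_var rfl
  rw [h.eval_call hp rfl, eval_ite, eval_pair, eval_pair]
  simp only [isEmpty_value hp (definesList c) (fst_value hv) _, fst_value hv _, snd_value hv _,
    tail_value hp (definesList c) (snd_value hv) _, tail_value hp (definesList c) (fst_value hv) _]
  cases l.1.isEmpty <;> simp [ofBool, toExpr]

theorem eval_zero {cs : List Bool} {w : Expr} : Eval (prog c) (.call 6 [encode cs, toExpr l]) w ↔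
    w = ofBool (l.1.isEmpty && l.2.isEmpty) := by
  have h : (prog c).Defines 6 2 (.ite ((Expr.fn 0).apps [(Expr.fn 2).apps [.var 1]])
      ((Expr.fn 0).apps [(Expr.fn 3).apps [.var 1]]) (.con .ff)) := by
    constructor <;> simp [prog, nilClause, consClause, pairClause, varClause]
  have hp := arityOK c
  have hv : HasOnlyValue (prog c) (fun i => [encode cs, toExpr l][i]?) (.var 1) (toExpr l) :=
    hasOnlyValue_var rfl
  rw [h.eval_call hp rfl, eval_ite]
  simp only [isEmpty_value hp (definesList c) (fst_value hv) _,
    isEmpty_value hp (definesList c) (snd_value hv) _, eval_con]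
  cases l.1.isEmpty <;> simp [ofBool]

end

end BaseModule

open BaseModule in
/-- Numbers up to `n + c` as pairs of lists with total length at most `n + c`. -/
noncomputable def baseModule (c : ℕ) : CountingModule (fun n => n + c + 1) 0 where
  ty := num
  syms := Finset.range 7
  seed := 4
  pred := 5
  zero := 6
  vals _ := Set.range toExpr
  interp _ := interp
  prog := prog c
  sig := sig
  seed_mem := by simp
  pred_mem := by simp
  zero_mem := by simp
  seed_type := rfl
  pred_type := rfl
  zero_type := rfl
  wellFormed := ⟨sig_valid, fun d hd => (prog_good c d hd).wellTyped,
    fun d hd => ⟨(prog_good c d hd).lhs, (prog_good c d hd).rhs⟩, arities c⟩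
  consFree d hd := (prog_good c d hd).consFree
  prog_syms := by
    intro d hd
    constructor <;> intro f hf <;> revert hf <;> revert d <;>
      simp [prog, nilClause, consClause, pairClause, varClause, Clause.lhs, mem_fns_apps, fns,
        fns_encode] <;> omega
  vals_value := by
    rintro n _ ⟨l, rfl⟩
    refine ⟨.data _ (.pair _ _ (isData_encode _) (isData_encode _)),
      ((plain_encode sig_valid _).pair (plain_encode sig_valid _)).fullyApplied,
      fun Γ => .pair _ _ _ _ (GoodRhs.encode (k := 0) sig_valid _).typed
        (GoodRhs.encode (k := 0) sig_valid _).typed, ?_⟩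
    simp [toExpr, fns, fns_encode]
  seed_unique cs := ⟨_, eval_seed.2 rfl, fun w hw => eval_seed.1 hw⟩
  seed_eval cs v hv := by
    rw [eval_seed.1 hv]
    exact ⟨⟨_, rfl⟩, by simp [interp_toExpr]⟩
  pred_unique := by
    rintro cs _ ⟨l, rfl⟩ -
    exact ⟨_, eval_pred.2 rfl, fun w hw => eval_pred.1 hw⟩
  pred_eval := by
    rintro cs _ ⟨⟨l, l'⟩, rfl⟩ h w hw
    rw [eval_pred.1 hw]
    refine ⟨⟨_, rfl⟩, ?_⟩
    rw [interp_toExpr] at h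
    cases l with
    | nil => simp [interp_toExpr]
    | cons b bs =>
      simp only [List.isEmpty_cons, Bool.false_eq_true, if_false, interp_toExpr, List.tail_cons,
        List.length_cons]
      omega
  zero_true := by
    rintro cs _ ⟨⟨l, l'⟩, rfl⟩
    rw [eval_zero, interp_toExpr]
    cases l <;> cases l' <;> simp [ofBool]
  zero_false := by
    rintro cs _ ⟨⟨l, l'⟩, rfl⟩
    rw [eval_zero, interp_toExpr]
    cases l <;> cases l' <;> simp [ofBool]

/-! ### Towers of exponentials -/

theorem exp2_two_pow (K n : ℕ) : exp2 K (2 ^ n) = exp2 (K + 1) n := by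
  induction K with
  | zero => rfl
  | succ K ih => rw [exp2, ih]; rfl

theorem add_exp2_le (K n d : ℕ) : d + exp2 K n ≤ exp2 K (d + n) := by
  induction K with
  | zero => rfl
  | succ K ih =>
    calc d + 2 ^ exp2 K n ≤ 2 ^ d * 2 ^ exp2 K n := by
          have h1 := d.lt_two_pow_self
          have h2 := (exp2 K n).one_le_two_pow
          nlinarith
      _ = 2 ^ (d + exp2 K n) := (pow_add _ _ _).symm
      _ ≤ 2 ^ exp2 K (d + n) := Nat.pow_le_pow_right (by simp) ih

theorem exp2_mono (K : ℕ) : Monotone (exp2 K) := by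
  induction K with
  | zero => exact fun _ _ h => h
  | succ K ih => exact fun _ _ h => Nat.pow_le_pow_right (by simp) (ih h)

/-- Three more exponentials absorb a polynomial and a constant factor. -/
theorem mul_exp2_le (d K a b n : ℕ) :
    d * exp2 K (a * n ^ b) ≤ exp2 (K + 3) (n + (b + d + a)) := by
  have h1 : d + a * n ^ b ≤ 2 ^ 2 ^ (n + (b + d + a)) := by
    calc d + a * n ^ b ≤ 2 ^ d * 2 ^ a * 2 ^ (n * b) := by
          have h1 := d.lt_two_pow_self
          have h2 := a.lt_two_pow_self
          have h3 : n ^ b ≤ 2 ^ (n * b) := by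
            rw [pow_mul]
            exact Nat.pow_le_pow_left n.lt_two_pow_self.le _
          have h4 : 1 ≤ 2 ^ (n * b) := Nat.one_le_two_pow
          have h5 : a * n ^ b ≤ a * 2 ^ (n * b) := Nat.mul_le_mul_left _ h3
          have h6 : d * 1 ≤ d * 2 ^ (n * b) := Nat.mul_le_mul_left _ h4
          have h7 : d + a ≤ 2 ^ d * 2 ^ a := by nlinarith
          have h8 := Nat.mul_le_mul_right (2 ^ (n * b)) h7
          nlinarith
      _ = 2 ^ (d + a + n * b) := by rw [pow_add, pow_add]
      _ ≤ 2 ^ 2 ^ (n + (b + d + a)) := by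
          refine Nat.pow_le_pow_right (by simp) ?_
          have h1 := n.lt_two_pow_self
          have h2 := b.lt_two_pow_self
          have h3 := (d + a).lt_two_pow_self
          have h4 : n * b + 1 ≤ 2 ^ n * 2 ^ b := by nlinarith
          rw [show n + (b + d + a) = n + b + (d + a) by ring, pow_add, pow_add]
          have h5 := Nat.mul_le_mul h4 h3
          nlinarith [Nat.zero_le (n * b * (d + a))]
  calc d * exp2 K (a * n ^ b) ≤ 2 ^ d * 2 ^ exp2 K (a * n ^ b) :=
        Nat.mul_le_mul d.lt_two_pow_self.le (exp2 K (a * n ^ b)).lt_two_pow_self.le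
    _ = 2 ^ (d + exp2 K (a * n ^ b)) := (pow_add _ _ _).symm
    _ ≤ 2 ^ exp2 K (d + a * n ^ b) := Nat.pow_le_pow_right (by simp) (add_exp2_le _ _ _)
    _ = exp2 (K + 1) (d + a * n ^ b) := rfl
    _ ≤ exp2 (K + 1) (2 ^ 2 ^ (n + (b + d + a))) := exp2_mono _ h1
    _ = exp2 (K + 3) (n + (b + d + a)) := by rw [exp2_two_pow, exp2_two_pow]

/-- Iterated exponentials of the base module count beyond any tower of exponentials.  The summand
`3` carries the induction: `2 ^ (k + 2)` is at least `2 ^ k + 3`. -/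
theorem exists_countingModule (c j : ℕ) : ∃ P : ℕ → ℕ, (∀ n, exp2 j (n + c) + 3 ≤ P n) ∧
    ∃ K ≤ 1, Nonempty (CountingModule P K) := by
  induction j with
  | zero => exact ⟨_, fun n => le_rfl, 0, by simp, ⟨baseModule (c + 2)⟩⟩
  | succ j ih =>
    obtain ⟨P, hP, K, hK, ⟨M⟩⟩ := ih
    refine ⟨_, fun n => ?_, 1, le_rfl, ⟨M.exp (fun n => (by have := hP n; omega)) hK⟩⟩
    have h1 : 2 ^ (exp2 j (n + c) + 2) ≤ 2 ^ (P n - 1) :=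
      Nat.pow_le_pow_right (by simp) (by have := hP n; omega)
    have h2 : 1 ≤ 2 ^ exp2 j (n + c) := Nat.one_le_two_pow
    rw [pow_add] at h1
    change 2 ^ exp2 j (n + c) + 3 ≤ 2 ^ (P n - 1)
    omega

/-! ### Computation tableaux of Turing machines -/

namespace DTM

variable (T : DTM)

instance : Finite T.A := T.finA
instance : Finite T.S := T.finS

/-- The contents of a position in a configuration: a letter, and the state if the head is there.
Positions to the left of the tape have the contents `none`. -/
abbrev Cell : Type := Option (T.A × Option T.S)

/-- The contents of position `i`. -/
def Cfg.cell {T : DTM} (c : T.Cfg) (i : ℕ) : T.Cell :=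
  open Classical in some (c.tape i, if i = c.pos then some c.state else none)

open Classical in
/-- The next configuration; configurations with a final state do not change. -/
noncomputable def nextOrHalt (c : T.Cfg) : T.Cfg := if T.Halted c then c else T.next c

open Classical in
/-- The state of a head that leaves the given position in direction `d`. -/
noncomputable def leaving (d : Dir) : T.Cell → Option T.S
  | some (a, some q) =>
    if q = T.accept ∨ q = T.reject then none
    else if (T.δ q a).2.1 = d then some (T.δ q a).2.2 else none
  | _ => none

open Classical in
/-- The next contents of a position, from the contents of its left neighbour, of the position
itself and of its right neighbour. -/
noncomputable def rule (l : T.Cell) : T.Cell → T.Cell → T.Cell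
  | none, _ => none
  | some (a, some q), _ =>
    if q = T.accept ∨ q = T.reject then some (a, some q)
    else some ((T.δ q a).1,
      if (T.δ q a).2.1 = .L ∧ l = none then some (T.δ q a).2.2 else none)
  | some (a, none), r => some (a, T.leaving .R l <|> T.leaving .L r)

variable {T}

theorem leaving_cell {c : T.Cfg} {d : Dir} {i : ℕ} (hc : ¬ T.Halted c) :
    T.leaving d (c.cell i) =
      open Classical in if i = c.pos ∧ (T.δ c.state (c.tape c.pos)).2.1 = d then
        some (T.next c).state else none := by
  classical
  by_cases hi : i = c.pos
  · subst hi
    simp only [Cfg.cell, leaving, if_true, true_and]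
    exact if_neg hc
  · simp [Cfg.cell, leaving, hi]

theorem leaving_cell_of_halted {c : T.Cfg} {d : Dir} {i : ℕ} (hc : T.Halted c) :
    T.leaving d (c.cell i) = none := by
  classical
  by_cases hi : i = c.pos
  · simp only [Cfg.cell, leaving, hi, if_true]
    exact if_pos hc
  · simp [Cfg.cell, leaving, hi]

/-- The rule describes the transitions, where `l` stands for the contents of position `i - 1`. -/
theorem cell_nextOrHalt (c : T.Cfg) {i : ℕ} {l : T.Cell}
    (hl : l = if i = 0 then none else c.cell (i - 1)) :
    (T.nextOrHalt c).cell i = T.rule l (c.cell i) (c.cell (i + 1)) := by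
  classical
  by_cases hc : T.Halted c
  · have hl' : T.leaving .R l = none := by
      rw [hl]
      split_ifs
      · rfl
      · exact leaving_cell_of_halted hc
    rw [nextOrHalt, if_pos hc]
    by_cases hi : i = c.pos
    · simp only [Cfg.cell, rule, hi, if_true]
      exact (if_pos hc).symm
    · have : c.cell i = some (c.tape i, none) := by simp [Cfg.cell, hi]
      rw [this, rule, hl', leaving_cell_of_halted hc]
      rfl
  · rw [nextOrHalt, if_neg hc]
    by_cases hi : i = c.pos
    · have h1 : c.cell i = some (c.tape c.pos, some c.state) := by simp [Cfg.cell, hi]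
      have hc' : ¬ (c.state = T.accept ∨ c.state = T.reject) := hc
      rw [h1, rule, if_neg hc']
      simp only [Cfg.cell, next, hi, Function.update_self, Option.some.injEq, Prod.mk.injEq,
        true_and]
      refine if_congr ?_ rfl rfl
      rw [hl]
      cases (T.δ c.state (c.tape c.pos)).2.1
      · simp only [move, true_and]
        split_ifs with h0
        · simp only [iff_true]; omega
        · simp only [Cfg.cell, reduceCtorEq, iff_false]; omega
      · simp [move]
    · have h1 : c.cell i = some (c.tape i, none) := by simp [Cfg.cell, hi]
      have hl' : T.leaving .R l = if i = c.pos + 1 ∧ (T.δ c.state (c.tape c.pos)).2.1 = .R then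
          some (T.next c).state else none := by
        rw [hl]
        split_ifs with h0 h2 h2
        · omega
        · rfl
        · rw [leaving_cell hc, if_pos ⟨by omega, h2.2⟩]
        · rw [leaving_cell hc, if_neg fun h => h2 ⟨by omega, h.2⟩]
      rw [h1, rule, hl', leaving_cell hc]
      simp only [Cfg.cell, next, Function.update_of_ne hi, Option.some.injEq, Prod.mk.injEq,
        true_and]
      have hdir : ∀ d : Dir, d = .L ∨ d = .R := by rintro (_ | _) <;> simp
      rcases hdir (T.δ c.state (c.tape c.pos)).2.1 with hd | hd
      · simp only [hd, move, reduceCtorEq, and_false, if_false, and_true]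
        refine (if_congr (by omega : i = c.pos - 1 ↔ i + 1 = c.pos) rfl rfl).trans ?_
        split_ifs <;> rfl
      · simp only [hd, move, reduceCtorEq, and_false, if_false, and_true]
        split_ifs <;> rfl

variable (T)

/-- The computation on `x` in skewed coordinates: the entry in row `t` and column `u` holds the
contents of position `u - t - 1` after `t` transitions, so that it depends only on entries in the
columns `u - 2`, `u - 1` and `u` of the row above. -/
noncomputable def tableau (x : List Bool) : ℕ → ℕ → T.Cell
  | 0, 0 => none
  | 0, u + 1 => (T.init x).cell u
  | t + 1, u => T.rule (tableau x t (u - 2)) (tableau x t (u - 1)) (tableau x t u)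

variable {T}

theorem tableau_eq (x : List Bool) (t u : ℕ) : T.tableau x t u =
    if u ≤ t then none else (T.nextOrHalt^[t] (T.init x)).cell (u - t - 1) := by
  induction t generalizing u with
  | zero => cases u <;> simp [tableau]
  | succ t ih =>
    rw [tableau, ih, ih, ih]
    by_cases hu : u ≤ t + 1
    · rw [if_pos hu, if_pos (by omega : u - 1 ≤ t)]
      rfl
    · rw [if_neg hu, if_neg (by omega : ¬ u - 1 ≤ t), if_neg (by omega : ¬ u ≤ t),
        Function.iterate_succ_apply', show u - t - 1 = u - (t + 1) - 1 + 1 by omega,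
        show u - 1 - t - 1 = u - (t + 1) - 1 by omega]
      refine (cell_nextOrHalt _ ?_).symm
      by_cases h : u - 2 ≤ t
      · rw [if_pos h, if_pos (by omega)]
      · rw [if_neg h, if_neg (by omega), show u - 2 - t - 1 = u - (t + 1) - 1 - 1 by omega]

theorem eq_iterate_of_reachesIn {k : ℕ} {c c' : T.Cfg} (h : T.ReachesIn k c c') :
    c' = T.nextOrHalt^[k] c := by
  induction h with
  | refl c => rfl
  | step k c c' hc _ ih => rw [ih, Function.iterate_succ_apply, nextOrHalt, if_neg hc]

theorem exists_reachesIn_iterate (k : ℕ) (c : T.Cfg) :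
    ∃ k', T.ReachesIn k' c (T.nextOrHalt^[k] c) := by
  induction k generalizing c with
  | zero => exact ⟨0, .refl c⟩
  | succ k ih =>
    rw [Function.iterate_succ_apply]
    by_cases hc : T.Halted c
    · rw [nextOrHalt, if_pos hc]
      exact ih c
    · rw [nextOrHalt, if_neg hc]
      obtain ⟨k', h⟩ := ih (T.next c)
      exact ⟨k' + 1, .step _ _ _ hc h⟩

theorem pos_iterate_le (x : List Bool) (k : ℕ) : (T.nextOrHalt^[k] (T.init x)).pos ≤ k := by
  induction k with
  | zero => rfl
  | succ k ih =>
    rw [Function.iterate_succ_apply', nextOrHalt]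
    split_ifs with h
    · omega
    · simp only [next, move]
      split <;> omega

/-- Acceptance is visible in the tableau: within `h` transitions the head does not get beyond
position `h`, so an accepting entry occurs up to column `2 * h + 1`.  It is never in row `0`, because
the initial state is not accepting, nor in column `0`. -/
theorem mem_iff_tableau {X : Set (List Bool)} (hX : T.Decides X) {h : ℕ → ℕ}
    (hT : T.RunsInTime h) {x : List Bool} (hx : x ≠ []) {m : ℕ} (hm : 2 * h x.length + 1 ≤ m) :
    x ∈ X ↔ ∃ t u, (0 < t ∧ t ≤ m) ∧ (0 < u ∧ u ≤ m) ∧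
      ∃ a, T.tableau x t u = some (a, some T.accept) := by
  classical
  constructor
  · intro hxX
    obtain ⟨k, c, hk, hc, hh⟩ := hT x hx
    have hacc : c.state = T.accept := hh.resolve_right fun hr => (hX x hx).2.2 ⟨k, c, hc, hr⟩ hxX
    obtain rfl := eq_iterate_of_reachesIn hc
    have hpos := pos_iterate_le (T := T) x k
    refine ⟨k, (T.nextOrHalt^[k] (T.init x)).pos + k + 1, ⟨?_, by omega⟩, ⟨by omega, by omega⟩,
      (T.nextOrHalt^[k] (T.init x)).tape (T.nextOrHalt^[k] (T.init x)).pos, ?_⟩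
    · rcases Nat.eq_zero_or_pos k with rfl | hk
      · exact absurd hacc T.start_ne_accept
      · exact hk
    · rw [tableau_eq, if_neg (by omega), show (T.nextOrHalt^[k] (T.init x)).pos + k + 1 - k - 1 =
        (T.nextOrHalt^[k] (T.init x)).pos by omega, Cfg.cell, if_pos rfl, hacc]
  · rintro ⟨t, u, -, -, a, h⟩
    rw [tableau_eq] at h
    split_ifs at h with htu
    simp only [Cfg.cell, Option.some.injEq, Prod.mk.injEq] at h
    obtain ⟨k, hk⟩ := exists_reachesIn_iterate t (T.init x)
    refine (hX x hx).1.2 ⟨k, _, hk, ?_⟩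
    have h2 := h.2
    split_ifs at h2
    exact Option.some.inj h2

end DTM

/-! ### The simulation of Turing machines -/

namespace CountingModule

variable {P : ℕ → ℕ} {K : ℕ} (M : CountingModule P K) (T : DTM)

/-- A numbering of the contents of tape positions. -/
noncomputable def cellIndex : T.Cell → ℕ := fun x => (Finite.equivFin T.Cell x : ℕ)

theorem cellIndex_injective : Function.Injective (cellIndex T) := fun _ _ h =>
  (Finite.equivFin T.Cell).injective (Fin.ext h)

/-- `cell cs t u` for given contents `x`: may evaluate to `true` if and only if `x` is the entry
of the tableau in row `t` and column `u`. -/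
noncomputable abbrev cellSym (x : T.Cell) : ℕ := M.fresh + (9 + cellIndex T x)

/-- The types of the new symbols. -/
def simTypes : ℕ → Ty
  | 1 => .arrow .list .bool
  | 2 => .arrow .list .bool
  | 3 => .arrow .list .bool
  | 4 => .arrow .list .list
  | 5 => .arrow .list (.arrow M.ty M.ty)
  | 6 => .arrow .list (.arrow .list (.arrow M.ty .list))
  | 7 => .arrow .list (.arrow M.ty M.ty)
  | 8 => M.ty
  | _ => .arrow .list (.arrow M.ty (.arrow M.ty .bool))

/-- The signature of the simulation. -/
def simSig : Signature := M.extendSig M.simTypes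

/-- `dec cs i`: the predecessor, where the predecessor of zero is zero. -/
def decBody : Expr :=
  .ite ((Expr.fn M.zero).apps [.var 0, .var 1]) (.var 1) ((Expr.fn M.pred).apps [.var 0, .var 1])

/-- `drop cs l i`: the list `l` without its first `i` elements. -/
def dropBody : Expr :=
  .ite ((Expr.fn M.zero).apps [.var 0, .var 2]) (.var 1)
    ((Expr.fn (M.fresh + 6)).apps
      [.var 0, (Expr.fn (M.fresh + 4)).apps [.var 1], (Expr.fn M.pred).apps [.var 0, .var 2]])

/-- The predecessor of `s`. -/
def decExpr (s : Expr) : Expr := (Expr.fn (M.fresh + 5)).apps [.var 0, s]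

/-- The input from the letter that belongs to column `u` of the first row. -/
def inputExpr : Expr :=
  (Expr.fn (M.fresh + 6)).apps [.var 0, .var 0, M.decExpr (M.decExpr (.var 2))]

variable {T}

open Classical in
/-- The test that the entry in the first row and column `u` is `x`. -/
noncomputable def initExpr (x : T.Cell) : Expr :=
  .ite ((Expr.fn M.zero).apps [.var 0, .var 2]) (ofBool (x = none))
    (.ite ((Expr.fn M.zero).apps [.var 0, M.decExpr (.var 2)])
      (ofBool (x = some (T.blank, some T.start)))
      (.ite ((Expr.fn (M.fresh + 2)).apps [M.inputExpr]) (ofBool (x = some (T.blank, none)))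
        (.ite ((Expr.fn (M.fresh + 3)).apps [M.inputExpr]) (ofBool (x = some (T.one, none)))
          (ofBool (x = some (T.zero, none))))))

/-- The conjunction of three boolean expressions. -/
def and₃ (s t u : Expr) : Expr := .ite s (.ite t u (.con .ff)) (.con .ff)

/-- The triples of contents that lead to the contents `x`. -/
noncomputable def causes (x : T.Cell) : List (T.Cell × T.Cell × T.Cell) :=
  (Set.toFinite {y : T.Cell × T.Cell × T.Cell | T.rule y.1 y.2.1 y.2.2 = x}).toFinset.toList

/-- The test that the three entries above the entry in row `t` and column `u` are `y`. -/
noncomputable def stepExpr (y : T.Cell × T.Cell × T.Cell) : Expr :=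
  and₃
    ((Expr.fn (M.cellSym T y.1)).apps
      [.var 0, (Expr.fn M.pred).apps [.var 0, .var 1], M.decExpr (M.decExpr (.var 2))])
    ((Expr.fn (M.cellSym T y.2.1)).apps
      [.var 0, (Expr.fn M.pred).apps [.var 0, .var 1], M.decExpr (.var 2)])
    ((Expr.fn (M.cellSym T y.2.2)).apps
      [.var 0, (Expr.fn M.pred).apps [.var 0, .var 1], .var 2])

/-- `cell cs t u` for the contents `x`: guess the three entries of the row above.  Only the value
`true` is reliable, as a wrong guess gives `false`. -/
noncomputable def cellBody (x : T.Cell) : Expr :=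
  .ite ((Expr.fn M.zero).apps [.var 0, .var 1]) (M.initExpr x)
    (.chooseList (.con .ff) ((causes x).map M.stepExpr))

variable (T)

/-- The contents of a position with the head in the accepting state. -/
noncomputable def acceptingCells : List T.Cell :=
  (Set.toFinite {x : T.Cell | ∃ a, x = some (a, some T.accept)}).toFinset.toList

/-- A positive number. -/
def guessExpr : Expr :=
  (Expr.fn (M.fresh + 7)).apps [.var 0, (Expr.fn M.seed).apps [.var 0]]

/-- The main function guesses an accepting entry of the tableau.  The empty word is rejected, as it
belongs to no decision problem. -/
noncomputable def mainBody : Expr :=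
  .ite ((Expr.fn (M.fresh + 2)).apps [.var 0]) (.con .ff)
    (.chooseList (.con .ff) ((acceptingCells T).map fun x =>
      (Expr.fn (M.cellSym T x)).apps [.var 0, M.guessExpr, M.guessExpr]))

/-- The clauses for all functions but `cell`: the symbols `M.fresh + 1` to `M.fresh + 7` are the main
function, `isnil`, `head`, `tail`, `dec`, `drop` and the guess of a positive number.  The symbol
`M.fresh + 8` has no clauses. -/
noncomputable def simFixed : Program :=
  [varClause (M.fresh + 1) 1 (M.mainBody T),
    nilClause (M.fresh + 2) (.con .tt), consClause (M.fresh + 2) (.con .ff),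
    consClause (M.fresh + 3) (.var 0),
    nilClause (M.fresh + 4) (.con .nil), consClause (M.fresh + 4) (.var 1),
    varClause (M.fresh + 5) 2 M.decBody, varClause (M.fresh + 6) 3 M.dropBody,
    varClause (M.fresh + 7) 2 (M.anyBody (M.fresh + 7) (M.fresh + 8))]

/-- The new clauses of the simulation. -/
noncomputable def simClauses : Program :=
  M.simFixed T ++ (Set.toFinite (Set.univ : Set T.Cell)).toFinset.toList.map fun x =>
    varClause (M.cellSym T x) 3 (M.cellBody x)

/-- A program that accepts the same problem as the Turing machine, if the module counts far
enough. -/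
noncomputable def simProg : Program := M.simClauses T ++ M.prog

variable {T}

theorem mem_simClauses {c : Clause} : c ∈ M.simClauses T ↔
    c ∈ M.simFixed T ∨ ∃ x : T.Cell, c = varClause (M.cellSym T x) 3 (M.cellBody x) := by
  simp [simClauses, eq_comm]

theorem simFixed_root {c : Clause} (hc : c ∈ M.simFixed T) :
    M.fresh ≤ c.root ∧ c.root < M.fresh + 8 := by
  revert c
  simp [simFixed, varClause, nilClause, consClause]

theorem simClauses_fresh : ∀ c ∈ M.simClauses T, M.fresh ≤ c.root := by
  intro c hc
  rcases M.mem_simClauses.1 hc with hc | ⟨x, rfl⟩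
  · exact (M.simFixed_root hc).1
  · simp [varClause]

theorem sim_arities : ∀ c ∈ M.simProg T, ∀ c' ∈ M.simProg T, c.root = c'.root →
    c.pats.length = c'.pats.length := by
  refine M.arities_append M.simClauses_fresh fun c hc c' hc' h => ?_
  rw [mem_simClauses] at hc hc'
  rcases hc with hc | ⟨x, rfl⟩ <;> rcases hc' with hc' | ⟨x', rfl⟩
  · have key : ∀ c ∈ M.simFixed T, ∀ c' ∈ M.simFixed T, c.root = c'.root →
        c.pats.length = c'.pats.length := by
      simp [simFixed, varClause, nilClause, consClause]
    exact key c hc c' hc' h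
  · have h1 := (M.simFixed_root hc).2
    simp only [varClause, cellSym] at h
    omega
  · have h1 := (M.simFixed_root hc').2
    simp only [varClause, cellSym] at h
    omega
  · simp [varClause]

theorem sim_arityOK : (M.simProg T).ArityOK := Program.arityOK_of M.sim_arities

theorem sim_extension : M.Extension (M.simProg T) :=
  ⟨M.sim_arityOK, M.simClauses T, rfl, M.simClauses_fresh⟩

theorem mem_simFixed {c : Clause} (hc : c ∈ M.simProg T) (h : M.fresh ≤ c.root)
    (h' : c.root < M.fresh + 9) : c ∈ M.simFixed T := by
  rcases List.mem_append.1 hc with hc | hc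
  · rcases M.mem_simClauses.1 hc with hc | ⟨x, rfl⟩
    · exact hc
    · simp only [varClause, cellSym] at h'
      omega
  · have := M.lt_fresh (M.root_mem hc)
    omega

theorem mem_simProg {c : Clause} (hc : c ∈ M.simFixed T) : c ∈ M.simProg T :=
  List.mem_append_left _ (M.mem_simClauses.2 (.inl hc))

theorem sim_defines {f k : ℕ} {s : Expr} (hmem : varClause f k s ∈ M.simFixed T)
    (hu : ∀ c ∈ M.simFixed T, c.root = f → c = varClause f k s) :
    (M.simProg T).Defines f k s := by
  refine ⟨M.mem_simProg hmem, fun c hc h => hu c (M.mem_simFixed hc ?_ ?_) h⟩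
  · exact h ▸ (M.simFixed_root hmem).1
  · exact h ▸ ((M.simFixed_root hmem).2.trans (by simp))

theorem main_defines : (M.simProg T).Defines (M.fresh + 1) 1 (M.mainBody T) :=
  M.sim_defines (by simp [simFixed]) (by simp [simFixed, varClause, nilClause, consClause])

theorem dec_defines : (M.simProg T).Defines (M.fresh + 5) 2 M.decBody :=
  M.sim_defines (by simp [simFixed]) (by simp [simFixed, varClause, nilClause, consClause])

theorem drop_defines : (M.simProg T).Defines (M.fresh + 6) 3 M.dropBody :=
  M.sim_defines (by simp [simFixed]) (by simp [simFixed, varClause, nilClause, consClause])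

theorem guess_defines :
    (M.simProg T).Defines (M.fresh + 7) 2 (M.anyBody (M.fresh + 7) (M.fresh + 8)) :=
  M.sim_defines (by simp [simFixed]) (by simp [simFixed, varClause, nilClause, consClause])

theorem sim_not_root : ∀ c ∈ M.simProg T, c.root ≠ M.fresh + 8 := by
  intro c hc h
  have := (M.simFixed_root (M.mem_simFixed hc (by omega) (by omega))).2
  omega

theorem cell_defines (x : T.Cell) :
    (M.simProg T).Defines (M.cellSym T x) 3 (M.cellBody x) := by
  refine M.defines_append (by simp) (M.mem_simClauses.2 (.inr ⟨x, rfl⟩)) fun c hc h => ?_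
  rcases M.mem_simClauses.1 hc with hc | ⟨x', rfl⟩
  · have := (M.simFixed_root hc).2
    simp only [cellSym] at h
    omega
  · simp only [varClause, cellSym, Nat.add_left_cancel_iff] at h
    rw [cellIndex_injective T h]

theorem sim_definesList : (M.simProg T).DefinesList (M.fresh + 2) (M.fresh + 4) where
  mem := by
    intro c hc
    refine M.mem_simProg ?_
    revert c
    simp [simFixed]
  empty := by
    have key : ∀ c ∈ M.simFixed T, c.root = M.fresh + 2 →
        c ∈ [nilClause (M.fresh + 2) (.con .tt), consClause (M.fresh + 2) (.con .ff)] := by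
      simp [simFixed, varClause, nilClause, consClause]
    intro c hc h
    simpa using key c (M.mem_simFixed hc (by omega) (by omega)) h
  tail := by
    have key : ∀ c ∈ M.simFixed T, c.root = M.fresh + 4 →
        c ∈ [nilClause (M.fresh + 4) (.con .nil), consClause (M.fresh + 4) (.var 1)] := by
      simp [simFixed, varClause, nilClause, consClause]
    intro c hc h
    simpa using key c (M.mem_simFixed hc (by omega) (by omega)) h

section Semantics

variable {M} {γ : Env} {cs : List Bool} {s t v : Expr}

theorem head_value {b : Bool} {bs : List Bool}
    (hs : HasOnlyValue (M.simProg T) γ s (encode (b :: bs))) :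
    HasOnlyValue (M.simProg T) γ ((Expr.fn (M.fresh + 3)).apps [s]) (ofBool b) := by
  intro w
  have hmem : consClause (M.fresh + 3) (.var 0) ∈ M.simProg T := M.mem_simProg (by simp [simFixed])
  have har : (M.simProg T).arity (M.fresh + 3) = 1 := (M.sim_arityOK _ hmem).symm
  rw [eval_apps_fn_of_hasOnlyValue M.sim_arityOK har (.cons hs .nil),
    eval_call_cons (s := .con .nil) M.sim_arityOK hmem]
  · exact hasOnlyValue_var rfl w
  · have key : ∀ c ∈ M.simFixed T, c.root = M.fresh + 3 →
        c ∈ [nilClause (M.fresh + 3) (.con .nil), consClause (M.fresh + 3) (.var 0)] := by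
      simp [simFixed, varClause, nilClause, consClause]
    intro c hc h
    exact key c (M.mem_simFixed hc (by omega) (by omega)) h

theorem dec_value (hv : v ∈ M.vals cs.length) (h0 : γ 0 = some (encode cs))
    (hs : HasOnlyValue (M.simProg T) γ s v) :
    ∃ w ∈ M.vals cs.length, M.interp cs.length w = M.interp cs.length v - 1 ∧
      HasOnlyValue (M.simProg T) γ (M.decExpr s) w := by
  have h := M.sim_extension (T := T)
  have key : ∀ w, Eval (M.simProg T) (.expr γ (M.decExpr s)) w ↔
      Eval (M.simProg T) (.expr (env₂ (encode cs) v) M.decBody) w := fun w => by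
    rw [decExpr, eval_apps_fn_of_hasOnlyValue h.arityOK (M.dec_defines.arity h.arityOK)
      (.cons (hasOnlyValue_var h0) (.cons hs .nil)), M.dec_defines.eval_call h.arityOK rfl]
  have h0' : HasOnlyValue (M.simProg T) (env₂ (encode cs) v) (.var 0) (encode cs) :=
    hasOnlyValue_var rfl
  have h1' : HasOnlyValue (M.simProg T) (env₂ (encode cs) v) (.var 1) v :=
    hasOnlyValue_var rfl
  rcases Nat.eq_zero_or_pos (M.interp cs.length v) with hz | hz
  · refine ⟨v, hv, by omega, fun w => ?_⟩
    rw [key, decBody, h.eval_ite_zero hv h0' h1', h1']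
    simp [hz]
  · obtain ⟨w, hw, hw1, hw2⟩ := h.pred_value hv hz h0' h1'
    refine ⟨w, hw, hw1, fun w' => ?_⟩
    rw [key, decBody, h.eval_ite_zero hv h0' h1', hw2]
    simp [hz, hz.ne']

theorem drop_value (hv : v ∈ M.vals cs.length) (l : List Bool) (w : Expr) :
    Eval (M.simProg T) (.call (M.fresh + 6) [encode cs, encode l, v]) w ↔
      w = encode (l.drop (M.interp cs.length v)) := by
  have h := M.sim_extension (T := T)
  induction hk : M.interp cs.length v generalizing v l with
  | zero =>
    rw [M.drop_defines.eval_call h.arityOK rfl, dropBody,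
      h.eval_ite_zero hv (hasOnlyValue_var rfl) (hasOnlyValue_var rfl),
      hasOnlyValue_var (v := encode l) rfl]
    simp [hk]
  | succ k ih =>
    obtain ⟨u, hu, hu1, hu2⟩ := h.pred_value (γ := fun i => [encode cs, encode l, v][i]?)
      (s := .var 0) (t := .var 2) hv (by omega) (hasOnlyValue_var rfl) (hasOnlyValue_var rfl)
    have h1 := tail_value (γ := fun i => [encode cs, encode l, v][i]?) (s := .var 1)
      h.arityOK M.sim_definesList (hasOnlyValue_var rfl)
    have ih' : Eval (M.simProg T) (.call (M.fresh + 6) [encode cs, encode l.tail, u]) w ↔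
        w = encode (l.tail.drop k) := ih hu l.tail (by omega)
    rw [M.drop_defines.eval_call h.arityOK rfl, dropBody,
      h.eval_ite_zero hv (hasOnlyValue_var rfl) (hasOnlyValue_var rfl),
      eval_apps_fn_of_hasOnlyValue h.arityOK (M.drop_defines.arity h.arityOK)
        (.cons (hasOnlyValue_var rfl) (.cons h1 (.cons hu2 .nil))), ih']
    simp [hk]

theorem eval_ofBool_iff {p : Program} {q : Prop} [Decidable q] :
    Eval p (.expr γ (ofBool q)) (.con .tt) ↔ q := by
  rw [ofBool, eval_con]
  by_cases hq : q <;> simp [hq]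

theorem eval_ite_ofBool {p : Program} {b : Bool} {s t u w : Expr}
    (hs : HasOnlyValue p γ s (ofBool b)) :
    Eval p (.expr γ (.ite s t u)) w ↔ if b then Eval p (.expr γ t) w else Eval p (.expr γ u) w := by
  rw [eval_ite, hs, hs]
  cases b <;> simp [ofBool]

theorem eval_initExpr (hcs : γ 0 = some (encode cs)) (hv : v ∈ M.vals cs.length)
    (h2 : γ 2 = some v) (x : T.Cell) :
    Eval (M.simProg T) (.expr γ (M.initExpr x)) (.con .tt) ↔
      T.tableau cs 0 (M.interp cs.length v) = x := by
  classical
  have h := M.sim_extension (T := T)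
  obtain ⟨v₁, hv₁, hi₁, hd₁⟩ := dec_value (T := T) hv hcs (hasOnlyValue_var h2)
  obtain ⟨v₂, hv₂, hi₂, hd₂⟩ := dec_value (T := T) hv₁ hcs hd₁
  have hin : HasOnlyValue (M.simProg T) γ M.inputExpr
      (encode (cs.drop (M.interp cs.length v₂))) := fun w => by
    rw [inputExpr, eval_apps_fn_of_hasOnlyValue h.arityOK (M.drop_defines.arity h.arityOK)
      (.cons (hasOnlyValue_var hcs) (.cons (hasOnlyValue_var hcs) (.cons hd₂ .nil))),
      drop_value hv₂]
  rw [initExpr, h.eval_ite_zero hv (hasOnlyValue_var hcs) (hasOnlyValue_var h2),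
    h.eval_ite_zero hv₁ (hasOnlyValue_var hcs) hd₁,
    eval_ite_ofBool (isEmpty_value h.arityOK M.sim_definesList hin), eval_ofBool_iff,
    eval_ofBool_iff, eval_ofBool_iff, eq_comm (b := x)]
  rcases hk : M.interp cs.length v with _ | _ | k
  · simp [DTM.tableau]
  · have h3 : M.interp cs.length v₁ = 0 := by omega
    simp [DTM.tableau, h3, DTM.Cfg.cell, DTM.init]
  · have h3 : 0 < M.interp cs.length v₁ := by omega
    have h4 : M.interp cs.length v₂ = k := by omega
    rw [h4] at hin
    simp only [h3, h3.ne', h4, DTM.tableau, DTM.Cfg.cell, DTM.init]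
    rcases hl : cs.drop k with _ | ⟨b, bs⟩
    · have : cs[k]? = none := by
        rw [List.getElem?_eq_none_iff]
        simpa using hl
      simp [this]
    · have : cs[k]? = some b := by
        have h5 : (cs.drop k)[0]? = some b := by rw [hl]; rfl
        simpa using h5
      rw [hl] at hin
      rw [eval_ite_ofBool (head_value hin), eval_ofBool_iff, eval_ofBool_iff]
      cases b <;> simp [this]

theorem eval_and₃ {p : Program} {s t u : Expr} :
    Eval p (.expr γ (and₃ s t u)) (.con .tt) ↔ Eval p (.expr γ s) (.con .tt) ∧
      Eval p (.expr γ t) (.con .tt) ∧ Eval p (.expr γ u) (.con .tt) := by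
  simp [and₃, eval_ite, eval_con]

/-- The functions `cell` compute the tableau.  Truncated subtraction of column numbers agrees on both
sides: `dec` maps zero to zero. -/
theorem eval_cell {v u : Expr} (hv : v ∈ M.vals cs.length) (hu : u ∈ M.vals cs.length)
    (x : T.Cell) : Eval (M.simProg T) (.call (M.cellSym T x) [encode cs, v, u]) (.con .tt) ↔
      T.tableau cs (M.interp cs.length v) (M.interp cs.length u) = x := by
  have h := M.sim_extension (T := T)
  induction hk : M.interp cs.length v generalizing v u x with
  | zero =>
    rw [(M.cell_defines x).eval_call h.arityOK rfl, cellBody,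
      h.eval_ite_zero hv (hasOnlyValue_var rfl) (hasOnlyValue_var rfl),
      eval_initExpr rfl hu rfl]
    simp [hk]
  | succ k ih =>
    set γ : Env := fun i => [encode cs, v, u][i]? with hγ
    have h0 : HasOnlyValue (M.simProg T) γ (.var 0) (encode cs) := hasOnlyValue_var rfl
    have h1 : HasOnlyValue (M.simProg T) γ (.var 1) v := hasOnlyValue_var rfl
    have h2 : HasOnlyValue (M.simProg T) γ (.var 2) u := hasOnlyValue_var rfl
    obtain ⟨v', hv', hi, hp⟩ := h.pred_value hv (by omega) h0 h1
    obtain ⟨u₁, hu₁, hi₁, hd₁⟩ := dec_value hu rfl h2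
    obtain ⟨u₂, hu₂, hi₂, hd₂⟩ := dec_value hu₁ rfl hd₁
    have key : ∀ (y : T.Cell) (s w : Expr), w ∈ M.vals cs.length →
        HasOnlyValue (M.simProg T) γ s w →
        (Eval (M.simProg T) (.expr γ ((Expr.fn (M.cellSym T y)).apps
          [.var 0, (Expr.fn M.pred).apps [.var 0, .var 1], s])) (.con .tt) ↔
          T.tableau cs k (M.interp cs.length w) = y) := fun y s w hw hs => by
      have ih' : Eval (M.simProg T) (.call (M.cellSym T y) [encode cs, v', w]) (.con .tt) ↔
          T.tableau cs k (M.interp cs.length w) = y := ih hv' hw y (by omega)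
      rw [eval_apps_fn_of_hasOnlyValue h.arityOK ((M.cell_defines y).arity h.arityOK)
        (.cons h0 (.cons hp (.cons hs .nil))), ih']
    have hstep : ∀ y : T.Cell × T.Cell × T.Cell,
        Eval (M.simProg T) (.expr γ (M.stepExpr y)) (.con .tt) ↔
          T.tableau cs k (M.interp cs.length u - 2) = y.1 ∧
          T.tableau cs k (M.interp cs.length u - 1) = y.2.1 ∧
          T.tableau cs k (M.interp cs.length u) = y.2.2 := fun y => by
      rw [stepExpr, eval_and₃, key _ _ _ hu₂ hd₂, key _ _ _ hu₁ hd₁, key _ _ _ hu h2, hi₂, hi₁,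
        Nat.sub_sub]
    rw [(M.cell_defines x).eval_call h.arityOK rfl, cellBody, h.eval_ite_zero hv h0 h1,
      eval_chooseList, eval_con]
    simp only [hk, List.mem_map, causes, Finset.mem_toList, Set.Finite.mem_toFinset,
      Set.mem_ofPred_eq, exists_exists_and_eq_and, hstep, DTM.tableau]
    constructor
    · rintro (⟨h, -⟩ | ⟨-, h | ⟨y, hy, h1, h2, h3⟩⟩)
      · omega
      · simp at h
      · rw [h1, h2, h3, hy]
    · intro hx
      exact .inr ⟨by omega, .inr ⟨⟨_, _, _⟩, hx, rfl, rfl, rfl⟩⟩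

theorem eval_main (hcs : cs ≠ []) :
    Eval (M.simProg T) (.call (M.fresh + 1) [encode cs]) (.con .tt) ↔
      ∃ t u, (0 < t ∧ t ≤ P cs.length - 1) ∧ (0 < u ∧ u ≤ P cs.length - 1) ∧
        ∃ a, T.tableau cs t u = some (a, some T.accept) := by
  have h := M.sim_extension (T := T)
  obtain ⟨m, hm, hm1, hm2⟩ := h.seed_value (γ := fun i => [encode cs][i]?) (s := .var 0)
    (hasOnlyValue_var rfl)
  have hguess : ∀ w, Eval (M.simProg T) (.expr (fun i => [encode cs][i]?) M.guessExpr) w ↔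
      Eval (M.simProg T) (.call (M.fresh + 7) [encode cs, m]) w := fun w => by
    rw [guessExpr, eval_apps_fn_of_hasOnlyValue h.arityOK (M.guess_defines.arity h.arityOK)
      (.cons (hasOnlyValue_var rfl) (.cons hm2 .nil))]
  obtain ⟨hg, hg'⟩ := h.eval_any M.guess_defines M.sim_not_root hm
  have hne : cs.isEmpty = false := by simpa using hcs
  have h1 := isEmpty_value (γ := fun i => [encode cs][i]?) (s := .var 0) (l := cs) h.arityOK
    (M.sim_definesList (T := T)) (hasOnlyValue_var rfl)
  rw [M.main_defines.eval_call h.arityOK rfl, mainBody, eval_ite_ofBool h1, hne,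
    if_neg (by simp), eval_chooseList, eval_con]
  simp only [reduceCtorEq, false_or, Expr.con.injEq, List.mem_map, acceptingCells,
    Finset.mem_toList, Set.Finite.mem_toFinset, Set.mem_ofPred_eq, exists_exists_and_eq_and]
  constructor
  · rintro ⟨_, ⟨a, rfl⟩, hx⟩
    rw [eval_apps_fn₃ h.arityOK ((M.cell_defines _).arity h.arityOK).ge] at hx
    obtain ⟨c, t, u, hc, ht, hu, hx⟩ := hx
    rw [hasOnlyValue_var (v := encode cs) rfl] at hc
    subst hc
    obtain ⟨h3, h4, h5⟩ := hg t ((hguess t).1 ht)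
    obtain ⟨h6, h7, h8⟩ := hg u ((hguess u).1 hu)
    exact ⟨_, _, ⟨h4, by omega⟩, ⟨h7, by omega⟩, a, (eval_cell h3 h6 _).1 hx⟩
  · rintro ⟨t, u, ⟨h3, h4⟩, ⟨h5, h6⟩, a, hx⟩
    obtain ⟨v, hv, rfl, hv'⟩ := hg' t h3 (by omega)
    obtain ⟨w, hw, rfl, hw'⟩ := hg' u h5 (by omega)
    refine ⟨_, ⟨a, rfl⟩, ?_⟩
    rw [eval_apps_fn₃ h.arityOK ((M.cell_defines _).arity h.arityOK).ge]
    exact ⟨_, v, w, eval_var.2 rfl, (hguess v).2 hv', (hguess w).2 hw', (eval_cell hv hw _).2 hx⟩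

theorem not_eval_main_nil :
    ¬ Eval (M.simProg T) (.call (M.fresh + 1) [encode []]) (.con .tt) := by
  have h := M.sim_extension (T := T)
  have h1 := isEmpty_value (γ := fun i => [encode []][i]?) (s := .var 0) (l := []) h.arityOK
    (M.sim_definesList (T := T)) (hasOnlyValue_var rfl)
  rw [M.main_defines.eval_call h.arityOK rfl, mainBody, eval_ite_ofBool h1]
  simp [eval_con]

end Semantics

/-! ### The simulating program is well-formed -/

section WellFormed

variable {M}

theorem simSig_valid : M.simSig.Valid := M.extendSig_valid _

theorem simSig_fresh {i : ℕ} : M.simSig.fn (M.fresh + i) = M.simTypes i :=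
  M.extendSig_fresh _ i

theorem simSig_cell (x : T.Cell) :
    M.simSig.fn (M.cellSym T x) = .arrow .list (.arrow M.ty (.arrow M.ty .bool)) := by
  rw [simSig_fresh, Nat.add_comm]
  rfl

theorem simSig_seed : M.simSig.fn M.seed = .arrow .list M.ty :=
  (M.extendSig_old _ M.seed_mem).trans M.seed_type

theorem simSig_pred : M.simSig.fn M.pred = .arrow .list (.arrow M.ty M.ty) :=
  (M.extendSig_old _ M.pred_mem).trans M.pred_type

theorem simSig_zero : M.simSig.fn M.zero = .arrow .list (.arrow M.ty .bool) :=
  (M.extendSig_old _ M.zero_mem).trans M.zero_type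

theorem goodRhs_ofBool {Γ : ℕ → Ty} {k : ℕ} (b : Bool) : GoodRhs M.simSig Γ k (ofBool b) .bool := by
  cases b
  exacts [.ff simSig_valid, .tt simSig_valid]

theorem simClauses_good (hK : K ≤ 1) : ∀ c ∈ M.simClauses T, c.Good M.simSig 1 := by
  have hty : M.ty.order ≤ 1 := M.order_ty_le.trans hK
  have hF := M.simSig_valid
  intro c hc
  rw [mem_simClauses] at hc
  rcases hc with hc | ⟨x, rfl⟩
  · revert c
    simp only [simFixed, List.forall_mem_cons, List.not_mem_nil, false_imp_iff, implies_true,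
      and_true]
    refine ⟨?_, nilClause_good hF simSig_fresh (.tt hF),
      consClause_good hF simSig_fresh (.ff hF),
      consClause_good hF simSig_fresh (.var (by simp) rfl),
      nilClause_good hF simSig_fresh (.encode hF []),
      consClause_good hF simSig_fresh (.var (by simp) rfl), ?_, ?_, ?_⟩
    · have h0 : GoodRhs M.simSig (tyEnv [.list]) 1 (.var 0) .list := .var (by simp) rfl
      have hguess : GoodRhs M.simSig (tyEnv [.list]) 1 M.guessExpr M.ty :=
        .call₂ simSig_fresh h0 (.call₁ simSig_seed h0)
      refine varClause_good [.list] .bool simSig_fresh (by simp [Ty.order])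
        (.ite (.call₁ simSig_fresh h0) (.ff hF) (.chooseList (.ff hF) ?_))
      simp only [List.mem_map]
      rintro _ ⟨x, -, rfl⟩
      exact .call₃ (simSig_cell x) h0 hguess hguess
    · have h0 : GoodRhs M.simSig (tyEnv [.list, M.ty]) 2 (.var 0) .list := .var (by simp) rfl
      have h1 : GoodRhs M.simSig (tyEnv [.list, M.ty]) 2 (.var 1) M.ty := .var (by simp) rfl
      exact varClause_good [.list, M.ty] M.ty simSig_fresh (by simp [Ty.order, hty])
        (.ite (.call₂ simSig_zero h0 h1) h1 (.call₂ simSig_pred h0 h1))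
    · have h0 : GoodRhs M.simSig (tyEnv [.list, .list, M.ty]) 3 (.var 0) .list :=
        .var (by simp) rfl
      have h1 : GoodRhs M.simSig (tyEnv [.list, .list, M.ty]) 3 (.var 1) .list :=
        .var (by simp) rfl
      have h2 : GoodRhs M.simSig (tyEnv [.list, .list, M.ty]) 3 (.var 2) M.ty :=
        .var (by simp) rfl
      exact varClause_good [.list, .list, M.ty] .list simSig_fresh (by simp [Ty.order, hty])
        (.ite (.call₂ simSig_zero h0 h2) h1
          (.call₃ simSig_fresh h0 (.call₁ simSig_fresh h1) (.call₂ simSig_pred h0 h2)))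
    · exact varClause_good [.list, M.ty] M.ty simSig_fresh (by simp [Ty.order, hty])
        (good_anyBody simSig_pred simSig_zero simSig_fresh simSig_fresh)
  · have h0 : GoodRhs M.simSig (tyEnv [.list, M.ty, M.ty]) 3 (.var 0) .list := .var (by simp) rfl
    have h1 : GoodRhs M.simSig (tyEnv [.list, M.ty, M.ty]) 3 (.var 1) M.ty := .var (by simp) rfl
    have h2 : GoodRhs M.simSig (tyEnv [.list, M.ty, M.ty]) 3 (.var 2) M.ty := .var (by simp) rfl
    have hdec {s : Expr} (hs : GoodRhs M.simSig (tyEnv [.list, M.ty, M.ty]) 3 s M.ty) :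
        GoodRhs M.simSig (tyEnv [.list, M.ty, M.ty]) 3 (M.decExpr s) M.ty :=
      .call₂ simSig_fresh h0 hs
    have hin : GoodRhs M.simSig (tyEnv [.list, M.ty, M.ty]) 3 M.inputExpr .list :=
      .call₃ simSig_fresh h0 h0 (hdec (hdec h2))
    have hpred := GoodRhs.call₂ simSig_pred h0 h1
    refine varClause_good [.list, M.ty, M.ty] .bool (simSig_cell x) (by simp [Ty.order, hty])
      (.ite (.call₂ simSig_zero h0 h1) ?_ (.chooseList (.ff hF) ?_))
    · exact .ite (.call₂ simSig_zero h0 h2) (goodRhs_ofBool _)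
        (.ite (.call₂ simSig_zero h0 (hdec h2)) (goodRhs_ofBool _)
          (.ite (.call₁ simSig_fresh hin) (goodRhs_ofBool _)
            (.ite (.call₁ simSig_fresh hin) (goodRhs_ofBool _) (goodRhs_ofBool _))))
    · simp only [List.mem_map]
      rintro _ ⟨y, -, rfl⟩
      exact .ite (.call₃ (simSig_cell _) h0 hpred (hdec (hdec h2)))
        (.ite (.call₃ (simSig_cell _) h0 hpred (hdec h2))
          (.call₃ (simSig_cell _) h0 hpred h2) (.ff hF)) (.ff hF)

end WellFormed

end CountingModule

/-- Every problem that a Turing machine decides in elementary time is accepted by a cons-free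
program of data order `1`. -/
theorem exists_program_of_mem_elementary {X : Set (List Bool)} (hX : X ∈ ELEMENTARY) :
    ∃ p : Program, p.IsDecisionProgram 1 ∧ p.ConsFree ∧ p.acceptedSet = X := by
  simp only [ELEMENTARY, EXPTIME, Set.mem_iUnion] at hX
  obtain ⟨L, a, b, hnil, d, -, T, hT, hdec⟩ := hX
  obtain ⟨P, hP, K, hK, ⟨M⟩⟩ := exists_countingModule (b + 2 * d + a) (L + 3)
  obtain ⟨hwf, hcf⟩ := M.wellFormed_append hK (CountingModule.simClauses_good (T := T) hK)
    M.sim_arities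
  refine ⟨M.simProg T, ⟨_, hwf, _, rfl, CountingModule.simSig_fresh⟩, hcf, ?_⟩
  ext x
  have hmain : x ∈ (M.simProg T).acceptedSet ↔
      Eval (M.simProg T) (.call (M.fresh + 1) [encode x]) (.con .tt) := by
    have h := M.sim_extension (T := T)
    have key : (M.simProg T).Executes [encode x] (.con .tt) ↔
        Eval (M.simProg T) (.expr (fun i => [encode x][i]?)
          ((Expr.fn (M.fresh + 1)).apps [.var 0])) (.con .tt) := by
      refine ⟨?_, fun h => ⟨.con _ [] (by simp), _, rfl, h⟩⟩
      rintro ⟨-, c, hc, h⟩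
      obtain rfl := Option.some.inj hc
      exact h
    rw [Program.acceptedSet, Set.mem_ofPred_eq, key, eval_apps_fn_of_hasOnlyValue h.arityOK
      (M.main_defines.arity h.arityOK) (.cons (hasOnlyValue_var rfl) .nil)]
  rw [hmain]
  rcases eq_or_ne x [] with rfl | hx
  · exact iff_of_false CountingModule.not_eval_main_nil hnil
  · rw [CountingModule.eval_main hx]
    refine (DTM.mem_iff_tableau hdec hT hx ?_).symm
    have h1 := mul_exp2_le (2 * d) L a b x.length
    have h2 := hP x.length
    have h3 : 2 * (d * exp2 L (a * x.length ^ b)) = 2 * d * exp2 L (a * x.length ^ b) := by ring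
    show 2 * (d * exp2 L (a * x.length ^ b)) + 1 ≤ P x.length - 1
    omega

end CFProg

theorem mainTheorem5 :
    (∀ X : Set (List Bool), X ∈ CFProg.ELEMENTARY →
      ∃ p : CFProg.Program, p.IsDecisionProgram 1 ∧ p.ConsFree ∧ p.acceptedSet = X) ∧
    (∀ P : ℕ → ℕ, (∀ n, 0 < P n) → ∀ K ≤ 1, Nonempty (CFProg.CountingModule P K) →
      Nonempty (CFProg.CountingModule (fun n => 2 ^ (P n - 1)) 1)) :=
  ⟨fun _ hX => CFProg.exists_program_of_mem_elementary hX,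
    fun _ hP _ hK ⟨M⟩ => ⟨M.exp hP hK⟩⟩
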